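/- Let $\eta>0$ and $0<\varphi\le\frac{\pi}{2}$. For $\beta>0$ put $\rho=\frac{\eta\beta}{2\pi}$ and let \[ Z_\varphi(\beta)=\Big[\frac{\rho}{2\pi}\,e^{-2\rho\ln(\rho)\sin\varphi}\,\big|\Gamma(i\rho\,e^{-i\varphi})\big|^2\Big]^3 \] be the partition function of the charged harmonic oscillator of frequency $\eta$ embedded in its own radiation field (the angle $\varphi$ measures the strength of the coupling). The effective measure of states $\mu_\varphi$ is the inverse Laplace transform of $Z_\varphi$, that is, the positive Borel measure supported in $[0,\infty)$ with $\int e^{-\beta\omega}\,d\mu_\varphi(\omega)=Z_\varphi(\beta)$ for all $\beta>0$. Put \[ \omega_\varphi=\frac{3}{\pi}\Big(\sin\varphi+\big(\tfrac{\pi}{2}-\varphi\big)\cos\varphi\Big)\eta . \] Then $\mu_\varphi$ exists and is unique, and there is a function $\phi:\mathbb R\to\mathbb R$ with the following properties. (i) $\phi(\omega)=0$ for $\omega<\omega_\varphi$; $\phi$ is positive and continuous on $[\omega_\varphi,\infty)$; $\phi(\omega_\varphi)=\frac{\pi}{\eta}\sin\varphi$; and \[ \mu_\varphi=\delta_{\omega_\varphi}+\phi\,\lambda^1,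 \] where $\delta_{\omega_\varphi}$ is the Dirac measure at $\omega_\varphi$ and $\lambda^1$ is Lebesgue measure on $\mathbb R$. (ii) $\phi$ is real analytic on $(\omega_\varphi,\infty)$ and extends to an analytic function on $\mathbb C$ up to singularities at \[ p_j=\omega_\varphi+j\eta e^{-i\varphi}\quad\text{and}\quad \overline{p_j}=\omega_\varphi+j\eta e^{i\varphi},\qquad j\in\mathbb Z\setminus\{0\}, \] and cuts along $\mathcal S=\{\omega_\varphi+se^{\pm i\varphi}: s\in\mathbb R,\ |s|\ge\eta\}$. That is, there is an analytic function $F$ on $\mathbb C\setminus\mathcal S$ with $F=\phi$ on $(\omega_\varphi,\infty)$ such that: at every point $z_0\in\mathcal S$ which is none of the $p_j,\overline{p_j}$, the function $F$ continues analytically from each of the two sides of $\mathcal S$ to a full neighbourhood of $z_0$ (the two continuations may differ); and each $p_j$ and each $\overline{p_j}$ ($j\ne0$) is a singular point of $F$, i.e. no function analytic in a neighbourhood of that point agrees with $F$ off $\mathcal S$ near it. -/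

import Mathlib

open MeasureTheory Topology Filter

noncomputable section

namespace ChargedOscillator

/-- The partition function `Z_φ(β)` of the charged oscillator embedded in its own radiation field,
for oscillator frequency `η` and coupling angle `φ`: with `ρ = η β / (2 π)`,
`Z_φ(β) = [ (ρ / 2π) e^{-2 ρ ln ρ sin φ} |Γ(i ρ e^{-iφ})|² ]³`. -/
def partitionFunction (η φ β : ℝ) : ℝ :=
  let ρ : ℝ := η * β / (2 * Real.pi)
  (ρ / (2 * Real.pi) * Real.exp (-2 * ρ * Real.log ρ * Real.sin φ) *
    ‖Complex.Gamma (Complex.I * ρ * Complex.exp (-(Complex.I * φ)))‖ ^ 2) ^ 3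

/-- `μ` is an effective measure of states for `(η, φ)`: a positive Borel measure supported in
`[0, ∞)` whose Laplace transform is the partition function `Z_φ` on `(0, ∞)`. -/
def IsEffectiveMeasureOfStates (η φ : ℝ) (μ : Measure ℝ) : Prop :=
  μ (Set.Iio 0) = 0 ∧
    ∀ β : ℝ, 0 < β →
      ∫⁻ ω, ENNReal.ofReal (Real.exp (-(β * ω))) ∂μ = ENNReal.ofReal (partitionFunction η φ β)

/-- The ground state frequency `ω_φ = (3/π) (sin φ + (π/2 - φ) cos φ) η`. -/
def groundFrequency (η φ : ℝ) : ℝ :=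
  3 / Real.pi * (Real.sin φ + (Real.pi / 2 - φ) * Real.cos φ) * η

/-- The point `ω_φ + s e^{iθ}`; it is used with `θ = φ` and `θ = -φ`. -/
def linePoint (η φ θ s : ℝ) : ℂ :=
  (groundFrequency η φ : ℂ) + (s : ℂ) * Complex.exp (Complex.I * θ)

/-- The points `p_j = ω_φ + j η e^{-iφ}` and their conjugates `ω_φ + j η e^{iφ}`,
for `j ∈ ℤ`, `j ≠ 0`. -/
def singularPoints (η φ : ℝ) : Set ℂ :=
  {z | ∃ j : ℤ, j ≠ 0 ∧
    (z = linePoint η φ (-φ) (j * η) ∨ z = linePoint η φ φ (j * η))}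

/-- The half-lines `ω_φ + s e^{± iφ}`, `s` real with `|s| ≥ η`. -/
def cutSet (η φ : ℝ) : Set ℂ :=
  {z | ∃ s : ℝ, η ≤ |s| ∧ (z = linePoint η φ (-φ) s ∨ z = linePoint η φ φ s)}

/-- `F`, given near `z₀` off the line through `z₀` in direction `u`, has at most a cut there:
from each of the two sides of the line, `F` continues analytically to a full neighbourhood
of `z₀` (the two continuations need not agree). -/
def HasAtMostCutAt (F : ℂ → ℂ) (u z₀ : ℂ) : Prop :=
  (∃ G : ℂ → ℂ, AnalyticAt ℂ G z₀ ∧ ∀ᶠ z in 𝓝 z₀, 0 < ((z - z₀) / u).im → F z = G z) ∧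
  (∃ G : ℂ → ℂ, AnalyticAt ℂ G z₀ ∧ ∀ᶠ z in 𝓝 z₀, ((z - z₀) / u).im < 0 → F z = G z)

/-- `p` is a singular point of `F`, a function given off the set `S`: no function that is analytic
at `p` agrees with `F` off `S` near `p`. -/
def IsSingularPointOff (F : ℂ → ℂ) (S : Set ℂ) (p : ℂ) : Prop :=
  ¬ ∃ G : ℂ → ℂ, AnalyticAt ℂ G p ∧ ∀ᶠ z in 𝓝 p, z ∉ S → F z = G z

end ChargedOscillator

end

namespace ChargedOscillator

open Set
open scoped Interval

/-! The measure. For `w = iρe^{-iφ}`, Gudermann's series writes `log Γ(w)` as Stirling's main term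
plus the integrals `∫₀¹ (1/2 - x)/(w + n + x) dx`, `n ≥ 0`. Each of these is a Laplace integral in
the variable `βη`; the sum over `n` under the integral is geometric and produces a cotangent. In
`Z_φ` the prefactors cancel the non-linear part of Stirling's term, and what is left is `Z_φ(β) =
e^{-β ω_φ} e^{Λ(β)}`, where `Λ(β)` is the Laplace transform at `βη` of an explicit function `k =
kernel φ`, positive on the real line (`partitionFunction_eq`, `kernel_pos`). Laplace transforms turn
convolutions into products, so `e^Λ - 1` is the transform of `Y = k + k*k/2! + k*k*k/3! + ⋯`, which
is `convExp k`. Rescaling `Y` by `η` and shifting it by `ω_φ` gives the density, positive because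
`k` is, with boundary value fixed by `Y(0) = k(0) = π sin φ`. Uniqueness is the injectivity of the
Laplace transform (`ext_of_lintegral_exp`).

The plane. `k` is meromorphic with simple poles at `j e^{±iφ}`, `j ≠ 0`. Convolution along segments
from `0` makes sense on star-shaped domains, so `Y` is holomorphic off the outward half-lines that
carry the poles.

The cuts. Multiplication by `e^{cz}` respects convolution. If `M(z) = e^{cz} - 1` vanishes at the
poles of a line, then `E = convExp (M k)` is holomorphic in a full strip around this line, and `M Y
= E + E * Y` (`exp_sub_one_mul_convExp`). This is a Volterra equation for `Y` whose kernel `E` has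
no poles; it can be solved near any point of the cut with `M ≠ 0`, that is, away from the poles
(`convExp_continuation`).

The poles. Multiplication by `z` is a derivation of convolution, whence `z Y = z k + (z k) * Y`
(`mul_convExp`). After a rotation the poles are the nonzero integers and `z k` has residue
`N/(2πi)`, `N > 0`, at the positive ones. At `s = j - iε` the path of integration is pushed below
the poles of `t ↦ (s - t) k(s - t)`, which contributes `N Y(s - n)` for `0 < n < j`; the rest of the
integral is `o(1/ε)`. Hence `c_j = lim 2πε Y(j - iε)` satisfies `j c_j = N (1 + c_1 + ⋯ + c_{j-1})`.
All terms are positive, so nothing cancels, and `Y` is unbounded near every pole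
(`tendsto_convExp_below_pole`). Complex conjugation supplies the remaining half-lines. -/

/-! ### Convolution along segments in a star-shaped domain -/

/-- A parametric integral of a jointly continuous family of holomorphic functions is holomorphic. -/
theorem differentiableOn_integral_param {U : Set ℂ} (hU : IsOpen U) {F : ℂ → ℝ → ℂ}
    (hc : ContinuousOn (Function.uncurry F) (U ×ˢ Icc 0 1))
    (hd : ∀ τ ∈ Icc (0 : ℝ) 1, DifferentiableOn ℂ (fun z => F z τ) U) :
    DifferentiableOn ℂ (fun z => ∫ τ in (0 : ℝ)..1, F z τ) U := by
  intro z₀ hz₀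
  obtain ⟨R, hR, hRU⟩ := Metric.isOpen_iff.1 hU z₀ hz₀
  set r := R / 3 with hr
  have hr0 : 0 < r := by positivity
  have hsub : Metric.closedBall z₀ (2 * r) ⊆ U := fun z hz =>
    hRU (by rw [Metric.mem_closedBall] at hz; rw [Metric.mem_ball]; linarith)
  have hcont (z : ℂ) (hz : z ∈ U) : ContinuousOn (F z) (Icc 0 1) := by
    have : F z = Function.uncurry F ∘ fun τ => (z, τ) := rfl
    rw [this]
    exact hc.comp (by fun_prop) (fun τ hτ => ⟨hz, hτ⟩)
  have hmeas (z : ℂ) (hz : z ∈ U) :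
      AEStronglyMeasurable (F z) (volume.restrict (Ι (0 : ℝ) 1)) := by
    rw [uIoc_of_le zero_le_one]
    exact ((hcont z hz).mono Ioc_subset_Icc_self).aestronglyMeasurable measurableSet_Ioc
  obtain ⟨C, hC⟩ := ((isCompact_closedBall z₀ (2 * r)).prod isCompact_Icc).exists_bound_of_continuousOn
    (hc.mono (prod_mono hsub (subset_refl (Icc (0 : ℝ) 1))))
  have hderiv (τ : ℝ) (hτ : τ ∈ Icc (0 : ℝ) 1) (z : ℂ) (hz : z ∈ U) :
      HasDerivAt (fun z => F z τ) (deriv (fun z => F z τ) z) z :=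
    ((hd τ hτ).differentiableAt (hU.mem_nhds hz)).hasDerivAt
  have hball : Metric.ball z₀ r ⊆ U := fun z hz => hsub (by
    rw [Metric.mem_ball] at hz; rw [Metric.mem_closedBall]; linarith)
  have key := intervalIntegral.hasDerivAt_integral_of_dominated_loc_of_deriv_le (μ := volume)
    (a := 0) (b := 1) (F := F) (F' := fun z τ => deriv (fun z => F z τ) z) (x₀ := z₀)
    (bound := fun _ => C / r) (Metric.ball_mem_nhds z₀ hr0)
    (by filter_upwards [hU.mem_nhds hz₀] with z hz using hmeas z hz)
    ((hcont z₀ hz₀).intervalIntegrable_of_Icc zero_le_one) ?_ ?_ (by simp) ?_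
  · exact key.2.differentiableAt.differentiableWithinAt
  -- The derivative is measurable in `τ` as a limit of difference quotients. The steps `r / (n + 2)`
  -- keep `z₀ + h n` inside the ball of radius `r`, on which the integrands are defined.
  · set h : ℕ → ℂ := fun n => ((r / ((n : ℝ) + 2) : ℝ) : ℂ) with hh
    have hhpos (n : ℕ) : (0 : ℝ) < r / (n + 2) := by positivity
    have hne (n : ℕ) : h n ≠ 0 := by
      exact Complex.ofReal_ne_zero.2 (hhpos n).ne'
    have hlim : Tendsto h atTop (𝓝 0) := by
      have h1 : Tendsto (fun n : ℕ => r / ((n : ℝ) + 2)) atTop (𝓝 0) :=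
        tendsto_const_nhds.div_atTop
          (tendsto_atTop_add_const_right _ _ tendsto_natCast_atTop_atTop)
      have h2 := (Complex.continuous_ofReal.tendsto 0).comp h1
      rwa [Complex.ofReal_zero] at h2
    refine aestronglyMeasurable_of_tendsto_ae atTop
      (f := fun n τ => (h n)⁻¹ * (F (z₀ + h n) τ - F z₀ τ)) (fun n => ?_) ?_
    · refine ((hmeas _ ?_).sub (hmeas z₀ hz₀)).const_mul _
      apply hball
      rw [Metric.mem_ball, dist_eq_norm, add_sub_cancel_left, hh, Complex.norm_real,
        Real.norm_of_nonneg (hhpos n).le, div_lt_iff₀ (by positivity)]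
      nlinarith [(Nat.cast_nonneg n : (0 : ℝ) ≤ n)]
    · refine (ae_restrict_iff' measurableSet_uIoc).2 (Eventually.of_forall fun τ hτ => ?_)
      rw [uIoc_of_le zero_le_one] at hτ
      have h2 := (hderiv τ (Ioc_subset_Icc_self hτ) z₀ hz₀).tendsto_slope_zero
      have h3 : Tendsto h atTop (𝓝[≠] 0) :=
        tendsto_nhdsWithin_iff.2 ⟨hlim, Eventually.of_forall hne⟩
      exact h2.comp h3
  · refine Eventually.of_forall fun τ hτ z hz => ?_
    rw [uIoc_of_le zero_le_one] at hτ
    have hsubz : Metric.closedBall z r ⊆ Metric.closedBall z₀ (2 * r) := by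
      refine Metric.closedBall_subset_closedBall' ?_
      rw [Metric.mem_ball] at hz; linarith
    refine Complex.norm_deriv_le_of_forall_mem_sphere_norm_le hr0 ?_ fun w hw => ?_
    · refine DifferentiableOn.diffContOnCl ?_
      rw [closure_ball z hr0.ne']
      exact (hd τ (Ioc_subset_Icc_self hτ)).mono (hsubz.trans hsub)
    · exact hC (w, τ) ⟨hsubz (Metric.sphere_subset_closedBall hw), Ioc_subset_Icc_self hτ⟩
  · refine Eventually.of_forall fun τ hτ z hz => ?_
    rw [uIoc_of_le zero_le_one] at hτ
    exact hderiv τ (Ioc_subset_Icc_self hτ) z (hball hz)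

/-- Convolution of `f` and `g` along the segment from `0` to `z`. -/
noncomputable def segConv (f g : ℂ → ℂ) (z : ℂ) : ℂ :=
  z * ∫ τ in (0 : ℝ)..1, f (τ * z) * g (((1 - τ : ℝ) : ℂ) * z)

/-- A set that contains with each of its points the segment to the origin. -/
def IsStar (U : Set ℂ) : Prop := ∀ z ∈ U, ∀ τ ∈ Icc (0 : ℝ) 1, (τ : ℂ) * z ∈ U

theorem one_sub_mem_Icc {τ : ℝ} (h : τ ∈ Icc (0 : ℝ) 1) : 1 - τ ∈ Icc (0 : ℝ) 1 :=
  ⟨by linarith [h.2], by linarith [h.1]⟩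

section Star
variable {U : Set ℂ} {f g h : ℂ → ℂ}

theorem continuousOn_mul_segment (hs : IsStar U) (hf : ContinuousOn f U) :
    ContinuousOn (fun p : ℂ × ℝ => f (p.2 * p.1)) (U ×ˢ Icc 0 1) :=
  hf.comp (by fun_prop) fun p hp => hs p.1 hp.1 p.2 hp.2

theorem segConv_differentiableOn (hU : IsOpen U) (hs : IsStar U)
    (hf : DifferentiableOn ℂ f U) (hg : DifferentiableOn ℂ g U) :
    DifferentiableOn ℂ (segConv f g) U := by
  refine differentiableOn_id.mul (differentiableOn_integral_param hU ?_ ?_)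
  · refine (continuousOn_mul_segment hs hf.continuousOn).mul ?_
    exact hg.continuousOn.comp (by fun_prop)
      fun p hp => hs p.1 hp.1 _ (one_sub_mem_Icc hp.2)
  · intro τ hτ
    refine (hf.comp (by fun_prop) fun z hz => hs z hz τ hτ).mul
      (hg.comp (by fun_prop) fun z hz => hs z hz _ (one_sub_mem_Icc hτ))

theorem segConv_congr (hs : IsStar U) {f' g' : ℂ → ℂ} (hf : EqOn f f' U) (hg : EqOn g g' U) :
    EqOn (segConv f g) (segConv f' g') U := by
  intro z hz
  unfold segConv
  congr 1
  refine intervalIntegral.integral_congr fun τ hτ => ?_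
  rw [uIcc_of_le zero_le_one] at hτ
  rw [hf (hs z hz τ hτ), hg (hs z hz _ (one_sub_mem_Icc hτ))]

theorem segConv_comm (f g : ℂ → ℂ) (z : ℂ) : segConv f g z = segConv g f z := by
  unfold segConv
  congr 1
  have := intervalIntegral.integral_comp_sub_left (a := 0) (b := 1)
    (fun τ : ℝ => g (τ * z) * f (((1 - τ : ℝ) : ℂ) * z)) 1
  simp only [sub_self, sub_zero, sub_sub_cancel] at this
  rw [← this]
  exact intervalIntegral.integral_congr fun τ _ => mul_comm _ _

theorem segConv_integrable (hs : IsStar U) (hf : ContinuousOn f U) (hg : ContinuousOn g U)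
    {z : ℂ} (hz : z ∈ U) :
    IntervalIntegrable (fun τ : ℝ => f (τ * z) * g (((1 - τ : ℝ) : ℂ) * z)) volume 0 1 := by
  refine ContinuousOn.intervalIntegrable_of_Icc zero_le_one (ContinuousOn.mul ?_ ?_)
  · exact hf.comp (by fun_prop) fun τ hτ => hs z hz τ hτ
  · exact hg.comp (by fun_prop) fun τ hτ => hs z hz _ (one_sub_mem_Icc hτ)

theorem segConv_add (hs : IsStar U) (hf : ContinuousOn f U) (hg : ContinuousOn g U)
    (hh : ContinuousOn h U) {z : ℂ} (hz : z ∈ U) :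
    segConv f (fun w => g w + h w) z = segConv f g z + segConv f h z := by
  unfold segConv
  rw [← mul_add, ← intervalIntegral.integral_add (segConv_integrable hs hf hg hz)
    (segConv_integrable hs hf hh hz)]
  simp only [mul_add]

theorem segConv_const_mul (c : ℂ) (f g : ℂ → ℂ) (z : ℂ) :
    segConv f (fun w => c * g w) z = c * segConv f g z := by
  unfold segConv
  simp only [mul_left_comm _ c]
  rw [intervalIntegral.integral_const_mul, mul_left_comm]

/-- Multiplication by the variable is a derivation of the convolution algebra. -/
theorem mul_segConv (hs : IsStar U) (hf : ContinuousOn f U) (hg : ContinuousOn g U)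
    {z : ℂ} (hz : z ∈ U) :
    z * segConv f g z = segConv (fun w => w * f w) g z + segConv f (fun w => w * g w) z := by
  unfold segConv
  rw [← mul_add, ← intervalIntegral.integral_add
    (segConv_integrable (f := fun w => w * f w) hs (continuousOn_id.mul hf) hg hz)
    (segConv_integrable (g := fun w => w * g w) hs hf (continuousOn_id.mul hg) hz)]
  rw [← intervalIntegral.integral_const_mul]
  congr 1
  refine intervalIntegral.integral_congr fun τ _ => ?_
  push_cast
  ring

/-- Multiplication by an exponential is an endomorphism of the convolution algebra. -/
theorem exp_mul_segConv (c : ℂ) (f g : ℂ → ℂ) (z : ℂ) :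
    Complex.exp (c * z) * segConv f g z =
      segConv (fun w => Complex.exp (c * w) * f w) (fun w => Complex.exp (c * w) * g w) z := by
  unfold segConv
  rw [mul_left_comm, ← intervalIntegral.integral_const_mul]
  congr 1
  refine intervalIntegral.integral_congr fun τ _ => ?_
  have : Complex.exp (c * z) =
      Complex.exp (c * (τ * z)) * Complex.exp (c * (((1 - τ : ℝ) : ℂ) * z)) := by
    rw [← Complex.exp_add]; push_cast; ring_nf
  rw [this]; ring

theorem norm_segConv_le {A B : ℝ} {z : ℂ} (hA : ∀ τ ∈ Icc (0 : ℝ) 1, ‖f (τ * z)‖ ≤ A)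
    (hB : ∀ τ ∈ Icc (0 : ℝ) 1, ‖g (τ * z)‖ ≤ B) : ‖segConv f g z‖ ≤ ‖z‖ * (A * B) := by
  unfold segConv
  rw [norm_mul]
  gcongr
  have := intervalIntegral.norm_integral_le_of_norm_le_const (a := 0) (b := 1) (C := A * B)
    (f := fun τ : ℝ => f (τ * z) * g (((1 - τ : ℝ) : ℂ) * z)) fun τ hτ => by
      rw [uIoc_of_le zero_le_one] at hτ
      have hτ' := Ioc_subset_Icc_self hτ
      rw [norm_mul]
      exact mul_le_mul (hA τ hτ') (hB _ (one_sub_mem_Icc hτ')) (norm_nonneg _)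
        ((norm_nonneg _).trans (hA τ hτ'))
  simpa using this

end Star

/-! ### Commutativity and associativity of convolution -/

section RealConv

/-- Convolution on the half-line. -/
noncomputable def rayConv (a b : ℝ → ℂ) (x : ℝ) : ℂ := ∫ t in (0 : ℝ)..x, a t * b (x - t)

/-- Both sides integrate `a t * b s * c (x - t - s)` over the triangle `t + s ≤ x`, in the two
orders. This form is symmetric in `a` and `b`, so Fubini on a square suffices; associativity follows
from it together with commutativity. -/
theorem rayConv_left_comm_of_continuous {a b c : ℝ → ℂ} (ha : Continuous a) (hb : Continuous b)
    (hc : Continuous c) {x : ℝ} (hx : 0 ≤ x) :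
    rayConv a (rayConv b c) x = rayConv b (rayConv a c) x := by
  -- Extension by zero from the triangle to the square `(0, x]²` makes both domains of integration
  -- independent of the other variable.
  set G : ℝ → ℝ → ℂ := fun t s => if t + s ≤ x then a t * b s * c (x - t - s) else 0 with hG
  have expand (a b : ℝ → ℂ) (G : ℝ → ℝ → ℂ)
      (hG : ∀ t s, G t s = if t + s ≤ x then a t * b s * c (x - t - s) else 0) :
      rayConv a (rayConv b c) x = ∫ t in Ioc 0 x, ∫ s in Ioc 0 x, G t s := by
    unfold rayConv
    rw [intervalIntegral.integral_of_le hx]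
    refine setIntegral_congr_fun measurableSet_Ioc fun t ht => ?_
    rw [intervalIntegral.integral_of_le (by linarith [ht.2]), ← integral_const_mul]
    have hsub : Ioc 0 (x - t) ⊆ Ioc 0 x := Ioc_subset_Ioc_right (by linarith [ht.1])
    rw [← inter_eq_self_of_subset_right hsub, ← setIntegral_indicator measurableSet_Ioc]
    refine setIntegral_congr_fun measurableSet_Ioc fun s hs => ?_
    simp only [indicator, mem_Ioc, hG]
    by_cases h : t + s ≤ x
    · rw [if_pos ⟨hs.1, by linarith⟩, if_pos h, mul_assoc]
    · rw [if_neg (fun h' => h (by linarith [h'.2])), if_neg h]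
  rw [expand a b G fun _ _ => rfl, expand b a (fun s t => G t s) fun s t => by
    simp only [hG, add_comm t s, mul_comm (a t)]; congr 2; ring_nf]
  refine integral_integral_swap ?_
  have hm : Measurable (Function.uncurry G) := by
    refine Measurable.ite (measurableSet_le (by fun_prop) (by fun_prop)) ?_ measurable_const
    exact Continuous.measurable (by fun_prop)
  obtain ⟨C, hC⟩ := (isCompact_Icc.prod isCompact_Icc).exists_bound_of_continuousOn
    (s := Icc (0 : ℝ) x ×ˢ Icc (0 : ℝ) x)
    (f := fun p : ℝ × ℝ => a p.1 * b p.2 * c (x - p.1 - p.2)) (by fun_prop)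
  have hfin : IsFiniteMeasure
      ((volume.restrict (Ioc 0 x)).prod (volume.restrict (Ioc (0 : ℝ) x))) := inferInstance
  refine Integrable.of_bound hm.aestronglyMeasurable C ?_
  rw [Measure.prod_restrict]
  refine (ae_restrict_iff' (measurableSet_Ioc.prod measurableSet_Ioc)).2
    (Eventually.of_forall fun p hp => ?_)
  have h1 := hC p ⟨Ioc_subset_Icc_self hp.1, Ioc_subset_Icc_self hp.2⟩
  simp only [Function.uncurry, hG]
  split_ifs
  · exact h1
  · rw [norm_zero]; exact (norm_nonneg _).trans h1

end RealConv

section Algebra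
variable {U : Set ℂ} {f g h : ℂ → ℂ}

/-- The restriction of `f` to the segment from `0` to `z`, extended by constants. -/
noncomputable def onRay (f : ℂ → ℂ) (z : ℂ) : ℝ → ℂ :=
  IccExtend (zero_le_one (α := ℝ)) fun τ : Icc (0 : ℝ) 1 => f ((τ : ℝ) * z)

theorem onRay_apply {τ : ℝ} (hτ : τ ∈ Icc (0 : ℝ) 1) (f : ℂ → ℂ) (z : ℂ) :
    onRay f z τ = f (τ * z) := by
  unfold onRay
  rw [IccExtend_of_mem _ _ hτ]

theorem continuous_onRay (hs : IsStar U) (hf : ContinuousOn f U) {z : ℂ} (hz : z ∈ U) :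
    Continuous (onRay f z) := by
  unfold onRay
  refine Continuous.Icc_extend' ?_
  exact hf.comp_continuous (by fun_prop) fun τ => hs z hz τ τ.2

theorem segConv_smul_eq (f g : ℂ → ℂ) (z : ℂ) {σ : ℝ} (hσ : σ ∈ Icc (0 : ℝ) 1) :
    segConv f g (σ * z) = z * rayConv (onRay f z) (onRay g z) σ := by
  unfold segConv rayConv
  rcases eq_or_lt_of_le hσ.1 with h0 | h0
  · simp [← h0]
  have := intervalIntegral.smul_integral_comp_mul_left (a := 0) (b := 1)
    (fun t : ℝ => onRay f z t * onRay g z (σ - t)) σ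
  rw [mul_zero, mul_one] at this
  rw [← this, Complex.real_smul, mul_left_comm, ← mul_assoc]
  congr 1
  refine intervalIntegral.integral_congr fun τ hτ => ?_
  rw [uIcc_of_le zero_le_one] at hτ
  have h1 : σ * τ ∈ Icc (0 : ℝ) 1 :=
    ⟨mul_nonneg hσ.1 hτ.1, mul_le_one₀ hσ.2 hτ.1 hτ.2⟩
  have h2 : σ - σ * τ ∈ Icc (0 : ℝ) 1 :=
    ⟨by nlinarith [hσ.1, hτ.2], by linarith [h1.1, hσ.2]⟩
  rw [onRay_apply h1, onRay_apply h2]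
  congr 2 <;> push_cast <;> ring

theorem segConv_eq (f g : ℂ → ℂ) (z : ℂ) :
    segConv f g z = z * rayConv (onRay f z) (onRay g z) 1 := by
  simpa using segConv_smul_eq f g z (right_mem_Icc.2 zero_le_one)

theorem rayConv_congr {a a' b b' : ℝ → ℂ} (ha : EqOn a a' (Icc 0 1)) (hb : EqOn b b' (Icc 0 1)) :
    rayConv a b 1 = rayConv a' b' 1 := by
  unfold rayConv
  refine intervalIntegral.integral_congr fun τ hτ => ?_
  rw [uIcc_of_le zero_le_one] at hτ
  rw [ha hτ, hb (one_sub_mem_Icc hτ)]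

theorem segConv_segConv (f g h : ℂ → ℂ) (z : ℂ) :
    segConv f (segConv g h) z =
      z ^ 2 * rayConv (onRay f z) (rayConv (onRay g z) (onRay h z)) 1 := by
  rw [segConv_eq, rayConv_congr (fun _ _ => rfl) (b' := fun σ => z * rayConv (onRay g z)
    (onRay h z) σ) fun σ hσ => by rw [onRay_apply hσ, segConv_smul_eq _ _ _ hσ] ]
  unfold rayConv
  simp only [mul_left_comm _ z]
  rw [intervalIntegral.integral_const_mul]
  ring

theorem segConv_left_comm (hs : IsStar U) (hf : ContinuousOn f U) (hg : ContinuousOn g U)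
    (hh : ContinuousOn h U) {z : ℂ} (hz : z ∈ U) :
    segConv f (segConv g h) z = segConv g (segConv f h) z := by
  rw [segConv_segConv, segConv_segConv, rayConv_left_comm_of_continuous
    (continuous_onRay hs hf hz) (continuous_onRay hs hg hz) (continuous_onRay hs hh hz) zero_le_one]

theorem segConv_assoc (hs : IsStar U) (hf : ContinuousOn f U) (hg : ContinuousOn g U)
    (hh : ContinuousOn h U) {z : ℂ} (hz : z ∈ U) :
    segConv (segConv f g) h z = segConv f (segConv g h) z := by
  rw [segConv_comm, segConv_left_comm hs hh hf hg hz]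
  exact segConv_congr hs (eqOn_refl f U) (fun w _ => segConv_comm h g w) hz

end Algebra

/-! ### The convolution exponential and its equations -/

/-- `convPow f n` is the `(n + 1)`-fold convolution power of `f`. -/
noncomputable def convPow (f : ℂ → ℂ) : ℕ → ℂ → ℂ
  | 0 => f
  | n + 1 => segConv f (convPow f n)

/-- The convolution exponential of `f`, without its Dirac term. -/
noncomputable def convExp (f : ℂ → ℂ) (z : ℂ) : ℂ :=
  ∑' n : ℕ, convPow f n z / ((n + 1).factorial : ℂ)

section
variable {U : Set ℂ} {f g : ℂ → ℂ}

theorem convPow_differentiableOn (hU : IsOpen U) (hs : IsStar U) (hf : DifferentiableOn ℂ f U)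
    (n : ℕ) : DifferentiableOn ℂ (convPow f n) U := by
  induction n with
  | zero => exact hf
  | succ n ih => exact segConv_differentiableOn hU hs hf ih

theorem convPow_congr (hs : IsStar U) (hfg : EqOn f g U) (n : ℕ) :
    EqOn (convPow f n) (convPow g n) U := by
  induction n with
  | zero => exact hfg
  | succ n ih => exact segConv_congr hs hfg ih

theorem convExp_congr (hs : IsStar U) (hfg : EqOn f g U) : EqOn (convExp f) (convExp g) U := by
  intro z hz
  unfold convExp
  exact tsum_congr fun n => by rw [convPow_congr hs hfg n hz]

/-- A crude geometric bound: the gain from the volume of the simplex is discarded, since the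
factorials in `convExp` already force convergence. It is stated along the whole segment so that the
induction can use it inside the integral. -/
theorem norm_convPow_le {C : ℝ} {z : ℂ} (hC : ∀ τ ∈ Icc (0 : ℝ) 1, ‖f (τ * z)‖ ≤ C) (n : ℕ) :
    ∀ τ ∈ Icc (0 : ℝ) 1, ‖convPow f n (τ * z)‖ ≤ C * (C * ‖z‖) ^ n := by
  induction n with
  | zero => simpa [convPow] using hC
  | succ n ih =>
    intro τ hτ
    have hC0 : 0 ≤ C := (norm_nonneg _).trans (hC τ hτ)
    have hmul (σ : ℝ) (hσ : σ ∈ Icc (0 : ℝ) 1) : σ * τ ∈ Icc (0 : ℝ) 1 :=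
      ⟨mul_nonneg hσ.1 hτ.1, mul_le_one₀ hσ.2 hτ.1 hτ.2⟩
    have h1 := norm_segConv_le (f := f) (g := convPow f n) (z := τ * z) (A := C)
      (B := C * (C * ‖z‖) ^ n)
      (fun σ hσ => by rw [← mul_assoc]; exact_mod_cast hC _ (hmul σ hσ))
      (fun σ hσ => by rw [← mul_assoc]; exact_mod_cast ih _ (hmul σ hσ))
    have h2 : ‖(τ : ℂ) * z‖ ≤ ‖z‖ := by
      rw [norm_mul, Complex.norm_real, Real.norm_of_nonneg hτ.1]
      exact mul_le_of_le_one_left (norm_nonneg _) hτ.2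
    calc ‖convPow f (n + 1) (τ * z)‖ ≤ ‖(τ : ℂ) * z‖ * (C * (C * (C * ‖z‖) ^ n)) := h1
      _ ≤ ‖z‖ * (C * (C * (C * ‖z‖) ^ n)) := by gcongr
      _ = C * (C * ‖z‖) ^ (n + 1) := by ring

theorem norm_convExp_term_le {C : ℝ} {z : ℂ} (hC : ∀ τ ∈ Icc (0 : ℝ) 1, ‖f (τ * z)‖ ≤ C) (n : ℕ)
    {τ : ℝ} (hτ : τ ∈ Icc (0 : ℝ) 1) :
    ‖convPow f n (τ * z) / ((n + 1).factorial : ℂ)‖ ≤ C * ((C * ‖z‖) ^ n / n.factorial) := by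
  have hC0 : 0 ≤ C := (norm_nonneg _).trans (hC τ hτ)
  rw [norm_div, Complex.norm_natCast, ← mul_div_assoc]
  have : (n.factorial : ℝ) ≤ (n + 1).factorial := by exact_mod_cast Nat.factorial_le n.le_succ
  gcongr
  exact norm_convPow_le hC n τ hτ

theorem summable_convExp_bound (C r : ℝ) :
    Summable fun n : ℕ => C * ((C * r) ^ n / n.factorial) :=
  (Real.summable_pow_div_factorial (C * r)).mul_left C

theorem exists_bound_on_segment (hs : IsStar U) (hf : ContinuousOn f U) {z : ℂ} (hz : z ∈ U) :
    ∃ C, ∀ τ ∈ Icc (0 : ℝ) 1, ‖f (τ * z)‖ ≤ C :=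
  isCompact_Icc.exists_bound_of_continuousOn
    (hf.comp (by fun_prop : ContinuousOn (fun τ : ℝ => (τ : ℂ) * z) (Icc 0 1))
      fun τ hτ => hs z hz τ hτ)

theorem summable_convExp (hs : IsStar U) (hf : ContinuousOn f U) {z : ℂ} (hz : z ∈ U) :
    Summable fun n : ℕ => convPow f n z / ((n + 1).factorial : ℂ) := by
  obtain ⟨C, hC⟩ := exists_bound_on_segment hs hf hz
  refine .of_norm_bounded (summable_convExp_bound C ‖z‖) fun n => ?_
  simpa using norm_convExp_term_le hC n (right_mem_Icc.2 zero_le_one)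

theorem convExp_differentiableOn (hU : IsOpen U) (hs : IsStar U) (hf : DifferentiableOn ℂ f U) :
    DifferentiableOn ℂ (convExp f) U := by
  intro z₀ hz₀
  obtain ⟨r, hr, hrU⟩ := Metric.nhds_basis_closedBall.mem_iff.1 (hU.mem_nhds hz₀)
  obtain ⟨C, hC⟩ := ((isCompact_closedBall z₀ r).prod isCompact_Icc).exists_bound_of_continuousOn
    ((continuousOn_mul_segment hs hf.continuousOn).mono
      (prod_mono hrU (subset_refl (Icc (0 : ℝ) 1))))
  have hC0 : 0 ≤ C := (norm_nonneg _).trans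
    (hC (z₀, 0) ⟨Metric.mem_closedBall_self hr.le, left_mem_Icc.2 zero_le_one⟩)
  have : DifferentiableOn ℂ (convExp f) (Metric.ball z₀ r) := by
    refine Complex.differentiableOn_tsum_of_summable_norm
      (summable_convExp_bound C (‖z₀‖ + r)) (fun n => ?_) Metric.isOpen_ball fun n w hw => ?_
    · exact ((convPow_differentiableOn hU hs hf n).mono
        (Metric.ball_subset_closedBall.trans hrU)).div_const _
    · have h1 := norm_convExp_term_le (f := f) (z := w) (C := C)
        (fun τ hτ => hC (w, τ) ⟨Metric.ball_subset_closedBall hw, hτ⟩) n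
        (right_mem_Icc.2 zero_le_one)
      rw [Complex.ofReal_one, one_mul] at h1
      refine h1.trans ?_
      have h2 : ‖w‖ ≤ ‖z₀‖ + r := by
        rw [Metric.mem_ball, dist_eq_norm] at hw
        calc ‖w‖ = ‖z₀ + (w - z₀)‖ := by ring_nf
          _ ≤ _ := (norm_add_le _ _).trans (by linarith)
      gcongr
  exact (this.differentiableAt (Metric.ball_mem_nhds z₀ hr)).differentiableWithinAt

/-- Leibniz's rule for the derivation `f ↦ z f` applied to a convolution power. The coefficient is
`n + 2` because `convPow f (n + 1)` has `n + 2` factors. -/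
theorem mul_convPow_succ (hU : IsOpen U) (hs : IsStar U) (hf : DifferentiableOn ℂ f U) (n : ℕ) :
    ∀ z ∈ U, z * convPow f (n + 1) z =
      ((n : ℂ) + 2) * segConv (fun w => w * f w) (convPow f n) z := by
  have hid : ContinuousOn (fun w => w * f w) U := continuousOn_id.mul hf.continuousOn
  induction n with
  | zero =>
    intro z hz
    change z * segConv f f z = _
    rw [mul_segConv hs hf.continuousOn hf.continuousOn hz, segConv_comm f]
    simp only [convPow, Nat.cast_zero]
    ring
  | succ n ih =>
    intro z hz
    have hp := convPow_differentiableOn hU hs hf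
    change z * segConv f (convPow f (n + 1)) z = _
    rw [mul_segConv hs hf.continuousOn (hp (n + 1)).continuousOn hz,
      segConv_congr hs (eqOn_refl f U) ih hz, segConv_const_mul,
      segConv_left_comm hs hf.continuousOn hid (hp n).continuousOn hz]
    simp only [convPow]
    push_cast
    ring

theorem segConv_convExp (hs : IsStar U) (hg : ContinuousOn g U) (hU : IsOpen U)
    (hf : DifferentiableOn ℂ f U) {z : ℂ} (hz : z ∈ U) :
    HasSum (fun n : ℕ => segConv g (convPow f n) z / ((n + 1).factorial : ℂ))
      (segConv g (convExp f) z) := by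
  obtain ⟨C, hC⟩ := exists_bound_on_segment hs hf.continuousOn hz
  obtain ⟨B, hB⟩ := exists_bound_on_segment hs hg hz
  unfold segConv
  simp only [mul_div_assoc]
  refine HasSum.mul_left z ?_
  have hp := convPow_differentiableOn hU hs hf
  have key := intervalIntegral.hasSum_integral_of_dominated_convergence (μ := volume)
    (a := (0 : ℝ)) (b := 1)
    (F := fun (n : ℕ) (τ : ℝ) => g (τ * z) * (convPow f n (((1 - τ : ℝ) : ℂ) * z) /
      ((n + 1).factorial : ℂ)))
    (f := fun τ => g (τ * z) * convExp f (((1 - τ : ℝ) : ℂ) * z))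
    (fun n _ => B * (C * ((C * ‖z‖) ^ n / n.factorial)))
    (fun n => ?_) (fun n => Eventually.of_forall fun τ hτ => ?_)
    (Eventually.of_forall fun τ _ => (summable_convExp_bound C ‖z‖).mul_left B) (by simp)
    (Eventually.of_forall fun τ hτ => ?_)
  · refine key.congr_fun fun n => ?_
    rw [← intervalIntegral.integral_div]
    simp only [mul_div_assoc]
  · have := (segConv_integrable hs hg ((hp n).continuousOn.div_const
      ((n + 1).factorial : ℂ)) hz).aestronglyMeasurable
    rwa [uIoc_of_le zero_le_one]
  · rw [uIoc_of_le zero_le_one] at hτ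
    have hτ' := Ioc_subset_Icc_self hτ
    rw [norm_mul]
    exact mul_le_mul (hB τ hτ') (norm_convExp_term_le hC n (one_sub_mem_Icc hτ')) (norm_nonneg _)
      ((norm_nonneg _).trans (hB τ hτ'))
  · rw [uIoc_of_le zero_le_one] at hτ
    exact (summable_convExp hs hf.continuousOn
      (hs z hz _ (one_sub_mem_Icc (Ioc_subset_Icc_self hτ)))).hasSum.mul_left _

/-- The differential equation of the convolution exponential. -/
theorem mul_convExp (hU : IsOpen U) (hs : IsStar U) (hf : DifferentiableOn ℂ f U) {z : ℂ}
    (hz : z ∈ U) :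
    z * convExp f z = z * f z + segConv (fun w => w * f w) (convExp f) z := by
  have h1 := (summable_convExp hs hf.continuousOn hz).hasSum.mul_left z
  have h2 := segConv_convExp (g := fun w => w * f w) hs (continuousOn_id.mul hf.continuousOn)
    hU hf hz
  rw [← hasSum_nat_add_iff' 1] at h1
  -- The Leibniz coefficient `n + 2` cancels against `(n + 2)!`, so the series of `(z f) * exp f` is
  -- `z` times the series of `exp f` without its first term.
  have h3 : (fun n : ℕ => segConv (fun w => w * f w) (convPow f n) z / ((n + 1).factorial : ℂ)) =
      fun n : ℕ => z * (convPow f (n + 1) z / ((n + 1 + 1).factorial : ℂ)) := by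
    funext n
    rw [← mul_div_assoc, mul_convPow_succ hU hs hf n z hz, Nat.factorial_succ (n + 1)]
    have h4 : ((n + 1).factorial : ℂ) ≠ 0 := by exact_mod_cast Nat.factorial_ne_zero _
    have h5 : (n : ℂ) + 2 ≠ 0 := by exact_mod_cast (by omega : n + 2 ≠ 0)
    rw [Nat.cast_mul, mul_div_mul_comm]
    have h6 : ((n + 1 + 1 : ℕ) : ℂ) = (n : ℂ) + 2 := by push_cast; ring
    rw [h6, div_self h5, one_mul]
  have h6 := h1.unique (h3 ▸ h2)
  simp only [Finset.range_one, Finset.sum_singleton, convPow, zero_add, Nat.factorial_one,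
    Nat.cast_one, div_one] at h6
  unfold convExp at h6 ⊢
  linear_combination h6

/-- The Volterra equation `z X = (z f) * X` has only the trivial solution. -/
theorem eq_zero_of_mul_eq_segConv (hs : IsStar U) {X : ℂ → ℂ} (hf : ContinuousOn f U)
    (hX : ContinuousOn X U) (h : ∀ z ∈ U, z * X z = segConv (fun w => w * f w) X z)
    {z : ℂ} (hz : z ∈ U) (hz0 : z ≠ 0) : X z = 0 := by
  obtain ⟨C, hC⟩ := exists_bound_on_segment hs hf hz
  obtain ⟨B, hB⟩ := exists_bound_on_segment hs hX hz
  have hC0 : 0 ≤ C := (norm_nonneg _).trans (hC 0 (left_mem_Icc.2 zero_le_one))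
  have hB0 : 0 ≤ B := (norm_nonneg _).trans (hB 0 (left_mem_Icc.2 zero_le_one))
  have hzn : 0 < ‖z‖ := norm_pos_iff.2 hz0
  have hmem {τ σ : ℝ} (hτ : τ ∈ Icc (0 : ℝ) 1) (hσ : σ ∈ Icc (0 : ℝ) 1) :
      τ * σ ∈ Icc (0 : ℝ) 1 := ⟨mul_nonneg hτ.1 hσ.1, mul_le_one₀ hτ.2 hσ.1 hσ.2⟩
  -- Picard iteration: division by `σ z` turns the equation into an integral over `τ`, and each
  -- further substitution integrates `τ ^ n`, which supplies the next factor of `1 / n!`.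
  have key (n : ℕ) : ∀ σ ∈ Ioc (0 : ℝ) 1,
      ‖X (σ * z)‖ ≤ B * (C * ‖z‖ * σ) ^ n / n.factorial := by
    induction n with
    | zero => intro σ hσ; simpa using hB σ (Ioc_subset_Icc_self hσ)
    | succ n ih =>
      intro σ hσ
      have hσ' := Ioc_subset_Icc_self hσ
      have hw := hs z hz σ hσ'
      have hσz : (σ : ℂ) * z ≠ 0 := mul_ne_zero (by exact_mod_cast hσ.1.ne') hz0
      have h1 := h _ hw
      rw [segConv_comm] at h1
      unfold segConv at h1
      have h2 := mul_left_cancel₀ hσz h1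
      rw [h2]
      have h3 : ‖∫ τ in (0 : ℝ)..1, X (τ * (σ * z)) *
          ((((1 - τ : ℝ) : ℂ) * (σ * z)) * f (((1 - τ : ℝ) : ℂ) * (σ * z)))‖ ≤
          ∫ τ in (0 : ℝ)..1, B * (C * ‖z‖ * σ) ^ (n + 1) / n.factorial * τ ^ n := by
        refine intervalIntegral.norm_integral_le_of_norm_le zero_le_one
          (Eventually.of_forall fun τ hτ => ?_)
          (Continuous.intervalIntegrable (by fun_prop) _ _)
        have hτ' := Ioc_subset_Icc_self hτ
        have h4 : ‖X (τ * (σ * z))‖ ≤ B * (C * ‖z‖ * (τ * σ)) ^ n / n.factorial := by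
          have := ih (τ * σ) ⟨mul_pos hτ.1 hσ.1, (hmem hτ' hσ').2⟩
          rwa [Complex.ofReal_mul, mul_assoc] at this
        have h5 : ‖f (((1 - τ : ℝ) : ℂ) * (σ * z))‖ ≤ C := by
          have := hC ((1 - τ) * σ) (hmem (one_sub_mem_Icc hτ') hσ')
          rwa [Complex.ofReal_mul, mul_assoc] at this
        have h6 : ‖((1 - τ : ℝ) : ℂ) * (σ * z)‖ ≤ ‖z‖ * σ := by
          rw [norm_mul, norm_mul, Complex.norm_real, Complex.norm_real,
            Real.norm_of_nonneg hσ.1.le, Real.norm_of_nonneg (by linarith [hτ.2])]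
          nlinarith [mul_pos hσ.1 hzn, hτ.1]
        rw [norm_mul, norm_mul]
        calc _ ≤ (B * (C * ‖z‖ * (τ * σ)) ^ n / n.factorial) * ((‖z‖ * σ) * C) := by
              have := hτ.1.le; have := hσ.1.le
              gcongr
          _ = _ := by rw [mul_pow, mul_pow, mul_pow]; ring
      refine h3.trans (le_of_eq ?_)
      rw [intervalIntegral.integral_const_mul, integral_pow, Nat.factorial_succ]
      push_cast
      simp only [one_pow, ne_eq, Nat.add_eq_zero_iff, one_ne_zero, and_false, not_false_eq_true,
        zero_pow, sub_zero]
      field_simp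
  have hlim : Tendsto (fun n : ℕ => B * (C * ‖z‖ * 1) ^ n / n.factorial) atTop (𝓝 0) := by
    have := (FloorSemiring.tendsto_pow_div_factorial_atTop (C * ‖z‖ * 1)).const_mul B
    simpa [mul_div_assoc] using this
  have h7 := ge_of_tendsto' hlim fun n => by
    have := key n 1 (right_mem_Ioc.2 zero_lt_one)
    rwa [Complex.ofReal_one, one_mul] at this
  exact norm_le_zero_iff.1 h7

/-- The equation satisfied by a convolution exponential when its kernel is multiplied by an
exponential. -/
theorem exp_sub_one_mul_convExp (hU : IsOpen U) (hs : IsStar U) (hf : DifferentiableOn ℂ f U)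
    (c : ℂ) {z : ℂ} (hz : z ∈ U) (hz0 : z ≠ 0) :
    (Complex.exp (c * z) - 1) * convExp f z =
      convExp (fun w => (Complex.exp (c * w) - 1) * f w) z +
      segConv (convExp (fun w => (Complex.exp (c * w) - 1) * f w)) (convExp f) z := by
  set fM : ℂ → ℂ := fun w => (Complex.exp (c * w) - 1) * f w with hfM
  set E := convExp fM with hE
  set Y := convExp f with hY
  have hfMd : DifferentiableOn ℂ fM U := by
    refine DifferentiableOn.mul ?_ hf
    fun_prop
  have hYd := convExp_differentiableOn hU hs hf
  have hEd := convExp_differentiableOn hU hs hfMd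
  have hEYd := segConv_differentiableOn hU hs hEd hYd
  -- Formally `e^{cz} exp(f) = exp(e^{cz} f) = exp(f) * exp((e^{cz} - 1) f)`. Both `e^{cw} Y` and `E
  -- + Y + E * Y` solve `w V = w k + (w k) * V` with `k = e^{cw} f`, so their difference `X` solves
  -- the homogeneous equation and vanishes.
  set X : ℂ → ℂ := fun w => Complex.exp (c * w) * Y w - (E w + Y w + segConv E Y w) with hX
  have hexpd : DifferentiableOn ℂ (fun w => Complex.exp (c * w)) U := by fun_prop
  have heY : ContinuousOn (fun w => Complex.exp (c * w) * Y w) U :=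
    hexpd.continuousOn.mul hYd.continuousOn
  have hXc : ContinuousOn X U :=
    heY.sub ((hEd.continuousOn.add hYd.continuousOn).add hEYd.continuousOn)
  have hk : ContinuousOn (fun w => Complex.exp (c * w) * f w) U :=
    hexpd.continuousOn.mul hf.continuousOn
  have hzk : ContinuousOn (fun w => w * f w) U := continuousOn_id.mul hf.continuousOn
  have hzM : ContinuousOn (fun w => w * fM w) U := continuousOn_id.mul hfMd.continuousOn
  have hze : ContinuousOn (fun w => w * (Complex.exp (c * w) * f w)) U := continuousOn_id.mul hk
  have hYc : ContinuousOn Y U := hYd.continuousOn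
  have hEc : ContinuousOn E U := hEd.continuousOn
  have hEYc : ContinuousOn (segConv E Y) U := hEYd.continuousOn
  have hEY' : ContinuousOn (fun w => E w + Y w) U := hEc.add hYc
  have hsM : ContinuousOn (segConv (fun w => w * fM w) E) U :=
    (segConv_differentiableOn hU hs (differentiableOn_id.mul hfMd) hEd).continuousOn
  have hsf : ContinuousOn (segConv (fun w => w * f w) Y) U :=
    (segConv_differentiableOn hU hs (differentiableOn_id.mul hf) hYd).continuousOn
  have main : ∀ w ∈ U, w * X w = segConv (fun v => v * (Complex.exp (c * v) * f v)) X w := by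
    intro w hw
    have a1 : w * (Complex.exp (c * w) * Y w) = w * (Complex.exp (c * w) * f w) +
        segConv (fun v => v * (Complex.exp (c * v) * f v))
          (fun v => Complex.exp (c * v) * Y v) w := by
      have e1 := mul_convExp hU hs hf hw
      have e2 := exp_mul_segConv c (fun v => v * f v) Y w
      have e3 : (fun v => Complex.exp (c * v) * (v * f v)) =
          fun v => v * (Complex.exp (c * v) * f v) := by funext v; ring
      rw [e3] at e2
      rw [← e2, hY]
      linear_combination Complex.exp (c * w) * e1
    have hsplit (g : ℂ → ℂ) (hg : ContinuousOn g U) (v : ℂ) (hv : v ∈ U) :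
        segConv (fun v => v * (Complex.exp (c * v) * f v)) g v =
          segConv (fun v => v * fM v) g v + segConv (fun v => v * f v) g v := by
      rw [segConv_comm, segConv_comm _ g, segConv_comm (fun v => v * f v) g,
        ← segConv_add hs hg hzM hzk hv]
      refine segConv_congr hs (eqOn_refl g U) (fun u _ => ?_) hv
      simp only [hfM]; ring
    have a2 : w * (E w + Y w + segConv E Y w) = w * (Complex.exp (c * w) * f w) +
        segConv (fun v => v * (Complex.exp (c * v) * f v))
          (fun v => E v + Y v + segConv E Y v) w := by
      have e1 := mul_convExp hU hs hf hw
      have e2 := mul_convExp hU hs hfMd hw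
      have e3 := mul_segConv hs hEc hYc hw
      have e4 : segConv (fun v => v * E v) Y w =
          segConv (fun v => v * fM v) Y w + segConv (fun v => v * fM v) (segConv E Y) w := by
        rw [segConv_congr hs (fun v hv => mul_convExp hU hs hfMd hv) (eqOn_refl Y U) hw,
          segConv_comm, segConv_add hs hYc hzM hsM hw, segConv_comm Y,
          segConv_comm Y, segConv_assoc hs hzM hEc hYc hw]
      have e5 : segConv E (fun v => v * Y v) w =
          segConv (fun v => v * f v) E w + segConv (fun v => v * f v) (segConv E Y) w := by
        rw [segConv_congr hs (eqOn_refl E U) (fun v hv => mul_convExp hU hs hf hv) hw,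
          segConv_add hs hEc hzk hsf hw, segConv_comm E,
          segConv_left_comm hs hEc hzk hYc hw]
      have e6 : segConv (fun v => v * (Complex.exp (c * v) * f v))
          (fun v => E v + Y v + segConv E Y v) w =
          segConv (fun v => v * (Complex.exp (c * v) * f v)) E w +
          segConv (fun v => v * (Complex.exp (c * v) * f v)) Y w +
          segConv (fun v => v * (Complex.exp (c * v) * f v)) (segConv E Y) w := by
        rw [segConv_add hs hze hEY' hEYc hw, segConv_add hs hze hEc hYc hw]
      rw [e6, hsplit E hEc w hw, hsplit Y hYc w hw, hsplit _ hEYc w hw, mul_add, mul_add, e3,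
        e4, e5, e1, e2]
      simp only [hfM]
      ring
    have a3 := segConv_add hs hze heY (h := fun v => -1 * (E v + Y v + segConv E Y v))
      (continuousOn_const.mul (hEY'.add hEYc)) hw
    rw [segConv_const_mul] at a3
    have a4 : X = fun v => Complex.exp (c * v) * Y v + -1 * (E v + Y v + segConv E Y v) := by
      funext v; simp only [hX]; ring
    have a5 : segConv (fun v => v * (Complex.exp (c * v) * f v)) X w =
        segConv (fun v => v * (Complex.exp (c * v) * f v))
          (fun v => Complex.exp (c * v) * Y v) w +
        -1 * segConv (fun v => v * (Complex.exp (c * v) * f v))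
          (fun v => E v + Y v + segConv E Y v) w := by
      rw [a4]; exact a3
    rw [a5]
    simp only [hX]
    linear_combination a1 - a2
  have := eq_zero_of_mul_eq_segConv hs hk hXc main hz hz0
  simp only [hX] at this
  linear_combination this

end

/-- A linear change of variable in a convolution. -/
theorem segConv_comp_mul (p : ℂ) (f g : ℂ → ℂ) (z : ℂ) :
    segConv (fun w => p * f (p * w)) (fun w => p * g (p * w)) z = p * segConv f g (p * z) := by
  unfold segConv
  have : ∀ τ : ℝ, p * f (p * (τ * z)) * (p * g (p * (((1 - τ : ℝ) : ℂ) * z))) =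
      p ^ 2 * (f (τ * (p * z)) * g (((1 - τ : ℝ) : ℂ) * (p * z))) := by
    intro τ; rw [mul_left_comm p, mul_left_comm p]; ring
  simp only [this]
  rw [intervalIntegral.integral_const_mul]
  ring

/-- Used with `p` of modulus one, this rotates a half-line of poles onto the real axis. -/
theorem convExp_comp_mul (p : ℂ) (f : ℂ → ℂ) (z : ℂ) :
    convExp (fun w => p * f (p * w)) z = p * convExp f (p * z) := by
  have h (n : ℕ) : convPow (fun w => p * f (p * w)) n = fun w => p * convPow f n (p * w) := by
    induction n with
    | zero => rfl
    | succ n ih => funext w; simp only [convPow]; rw [ih, segConv_comp_mul]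
  unfold convExp
  rw [← tsum_mul_left]
  exact tsum_congr fun n => by rw [h n, mul_div_assoc]

open ComplexConjugate in
theorem convExp_conj {f : ℂ → ℂ} (hf : ∀ w, f (conj w) = conj (f w)) (z : ℂ) :
    convExp f (conj z) = conj (convExp f z) := by
  have h (n : ℕ) : ∀ w, convPow f n (conj w) = conj (convPow f n w) := by
    induction n with
    | zero => exact hf
    | succ n ih =>
      intro w
      simp only [convPow, segConv]
      rw [map_mul, intervalIntegral, intervalIntegral, map_sub, ← integral_conj, ← integral_conj]
      simp only [map_mul, ← hf, ← ih, Complex.conj_ofReal]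
  unfold convExp
  rw [Complex.conj_tsum]
  exact tsum_congr fun n => by rw [h n, map_div₀, Complex.conj_natCast]

/-! ### Line integrals and Volterra equations -/

/-- The integral of `q` along the segment from `b` to `s`. -/
noncomputable def lineInt (q : ℂ → ℂ) (b s : ℂ) : ℂ :=
  (s - b) * ∫ τ in (0 : ℝ)..1, q (b + τ * (s - b))

theorem lineInt_zero (q : ℂ → ℂ) (s : ℂ) : lineInt q 0 s = segConv q (fun _ => 1) s := by
  simp [lineInt, segConv]

/-- In this form the convolution is a path integral in `t` with holomorphic integrand, so the path
may be cut at an intermediate point or deformed. -/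
theorem segConv_eq_lineInt (f g : ℂ → ℂ) (z : ℂ) :
    segConv f g z = lineInt (fun t => f (z - t) * g t) 0 z := by
  rw [segConv_comm]
  unfold segConv lineInt
  rw [sub_zero]
  congr 1
  refine intervalIntegral.integral_congr fun τ _ => ?_
  simp only [zero_add, mul_comm (g _)]
  congr 2
  push_cast; ring

section
variable {U : Set ℂ} {q : ℂ → ℂ}

/-- A holomorphic function on an open star-shaped set has a primitive. -/
theorem hasDerivAt_lineInt (hU : IsOpen U) (hs : IsStar U) (hq : DifferentiableOn ℂ q U)
    {v : ℂ} (hv : v ∈ U) : HasDerivAt (lineInt q 0) (q v) v := by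
  have hP : lineInt q 0 = segConv q (fun _ => 1) := funext (lineInt_zero q)
  have hd : DifferentiableOn ℂ (lineInt q 0) U := by
    rw [hP]; exact segConv_differentiableOn hU hs hq (differentiableOn_const _)
  -- Away from the centre, the derivative of `σ ↦ lineInt q 0 (σ w)` at `σ = 1` is computed twice:
  -- by the chain rule and by the fundamental theorem of calculus on the ray. The derivative is
  -- one-sided since the ray beyond `w` need not lie in `U`.
  have hne : ∀ w ∈ U, w ≠ 0 → deriv (lineInt q 0) w = q w := by
    intro w hw hw0
    have h1 : HasDerivAt (lineInt q 0) (deriv (lineInt q 0) w) w :=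
      (hd.differentiableAt (hU.mem_nhds hw)).hasDerivAt
    have h2 : HasDerivWithinAt (fun σ : ℝ => lineInt q 0 (σ * w)) (deriv (lineInt q 0) w * w)
        (Icc 0 1) 1 := by
      have h3 : HasDerivAt (fun σ : ℂ => lineInt q 0 (σ * w)) (deriv (lineInt q 0) w * w)
          ((1 : ℝ) : ℂ) := by
        have h4 : HasDerivAt (fun σ : ℂ => σ * w) (1 * w) ((1 : ℝ) : ℂ) :=
          (hasDerivAt_id _).mul_const w
        rw [one_mul] at h4
        exact HasDerivAt.comp (h₂ := lineInt q 0) (h := fun σ : ℂ => σ * w) ((1 : ℝ) : ℂ)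
          (by simpa using h1) h4
      exact h3.comp_ofReal.hasDerivWithinAt
    have hcr := continuous_onRay hs hq.continuousOn hw
    have h5 : HasDerivWithinAt (fun σ : ℝ => lineInt q 0 (σ * w)) (w * q w) (Icc 0 1) 1 := by
      have h6 : HasDerivAt (fun σ : ℝ => w * ∫ t in (0 : ℝ)..σ, onRay q w t)
          (w * onRay q w 1) 1 :=
        (intervalIntegral.integral_hasDerivAt_right (hcr.intervalIntegrable _ _)
          (hcr.stronglyMeasurableAtFilter _ _) hcr.continuousAt).const_mul w
      rw [onRay_apply (right_mem_Icc.2 zero_le_one), Complex.ofReal_one, one_mul] at h6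
      refine h6.hasDerivWithinAt.congr_of_mem (fun σ hσ => ?_) (right_mem_Icc.2 zero_le_one)
      rw [hP, segConv_smul_eq _ _ _ hσ]
      congr 1
      refine intervalIntegral.integral_congr fun t ht => ?_
      rw [uIcc_of_le hσ.1] at ht
      have : σ - t ∈ Icc (0 : ℝ) 1 := ⟨by linarith [ht.2], by linarith [ht.1, hσ.2]⟩
      rw [onRay_apply this (fun _ => 1), mul_one]
    have h7 := (uniqueDiffOn_Icc zero_lt_one).eq (right_mem_Icc.2 zero_le_one)
      h2.hasFDerivWithinAt h5.hasFDerivWithinAt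
    have h8 := DFunLike.congr_fun h7 1
    simp only [ContinuousLinearMap.toSpanSingleton_apply, one_smul] at h8
    exact mul_right_cancel₀ hw0 (h8.trans (mul_comm _ _))
  -- The ray argument gives nothing at `0`; there the two sides agree by continuity.
  have heq : deriv (lineInt q 0) v = q v := by
    by_cases hv0 : v = 0
    · have hc1 : ContinuousAt (deriv (lineInt q 0)) v :=
        ((hd.deriv hU).differentiableAt (hU.mem_nhds hv)).continuousAt
      have hc2 : ContinuousAt q v := (hq.differentiableAt (hU.mem_nhds hv)).continuousAt
      refine tendsto_nhds_unique (l := 𝓝[≠] v) (hc1.mono_left nhdsWithin_le_nhds)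
        ((hc2.mono_left nhdsWithin_le_nhds).congr' ?_)
      filter_upwards [nhdsWithin_le_nhds (hU.mem_nhds hv), self_mem_nhdsWithin] with w hw hw'
      exact (hne w hw (by rw [← hv0]; exact hw')).symm
    · exact hne v hv hv0
  rw [← heq]
  exact (hd.differentiableAt (hU.mem_nhds hv)).hasDerivAt

/-- Cauchy's theorem for a triangle with a vertex at the centre of a star-shaped set. -/
theorem lineInt_add (hU : IsOpen U) (hs : IsStar U) (hq : DifferentiableOn ℂ q U) {b s : ℂ}
    (h : ∀ τ ∈ Icc (0 : ℝ) 1, b + τ * (s - b) ∈ U) :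
    lineInt q 0 s = lineInt q 0 b + lineInt q b s := by
  have h1 : ∀ τ ∈ uIcc (0 : ℝ) 1, HasDerivAt (fun τ : ℝ => lineInt q 0 (b + τ * (s - b)))
      (q (b + τ * (s - b)) * (s - b)) τ := by
    intro τ hτ
    rw [uIcc_of_le zero_le_one] at hτ
    have h2 : HasDerivAt (fun σ : ℂ => b + σ * (s - b)) (1 * (s - b)) (τ : ℂ) :=
      ((hasDerivAt_id _).mul_const _).const_add b
    rw [one_mul] at h2
    exact (HasDerivAt.comp (τ : ℂ) (hasDerivAt_lineInt hU hs hq (h τ hτ)) h2).comp_ofReal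
  have hc : ContinuousOn (fun τ : ℝ => q (b + τ * (s - b)) * (s - b)) (Icc 0 1) :=
    (hq.continuousOn.comp (by fun_prop) h).mul continuousOn_const
  have h3 := intervalIntegral.integral_eq_sub_of_hasDerivAt h1
    (hc.intervalIntegrable_of_Icc zero_le_one)
  rw [intervalIntegral.integral_mul_const] at h3
  simp only [Complex.ofReal_one, one_mul, add_sub_cancel, Complex.ofReal_zero, zero_mul,
    add_zero] at h3
  rw [lineInt.eq_def q b s]
  linear_combination -h3

end

theorem isStar_ball (r : ℝ) : IsStar (Metric.ball (0 : ℂ) r) := by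
  intro z hz τ hτ
  rw [mem_ball_zero_iff] at hz ⊢
  rw [norm_mul, Complex.norm_real, Real.norm_of_nonneg hτ.1]
  exact (mul_le_of_le_one_left (norm_nonneg _) hτ.2).trans_lt hz

section Volterra
variable {r W B C : ℝ} {A w k : ℂ → ℂ}

/-- Existence of a holomorphic solution of a linear Volterra equation on a small disc. -/
theorem exists_volterra_solution (hr : 0 < r)
    (hA : DifferentiableOn ℂ A (Metric.ball 0 r)) (hw : DifferentiableOn ℂ w (Metric.ball 0 r))
    (hk : DifferentiableOn ℂ k (Metric.ball 0 r))
    (hAC : ∀ v ∈ Metric.ball (0 : ℂ) r, ‖A v‖ ≤ C) (hwW : ∀ v ∈ Metric.ball (0 : ℂ) r, ‖w v‖ ≤ W)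
    (hkB : ∀ v ∈ Metric.ball (0 : ℂ) r, ‖k v‖ ≤ B) (hsmall : W * B * r < 1) :
    ∃ X : ℂ → ℂ, DifferentiableOn ℂ X (Metric.ball 0 r) ∧
      ∀ v ∈ Metric.ball (0 : ℂ) r, X v = A v + w v * segConv k X v := by
  have h0 : (0 : ℂ) ∈ Metric.ball (0 : ℂ) r := Metric.mem_ball_self hr
  have hs := isStar_ball r
  have hW0 : 0 ≤ W := (norm_nonneg _).trans (hwW 0 h0)
  have hB0 : 0 ≤ B := (norm_nonneg _).trans (hkB 0 h0)
  have hC0 : 0 ≤ C := (norm_nonneg _).trans (hAC 0 h0)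
  set θ := W * B * r with hθ
  have hθ0 : 0 ≤ θ := by positivity
  -- The terms of the Neumann series, which decay geometrically with ratio `θ = W B r < 1`.
  let T : ℕ → ℂ → ℂ := fun n => Nat.rec A (fun _ Y v => w v * segConv k Y v) n
  have hTs (n : ℕ) (v : ℂ) : T (n + 1) v = w v * segConv k (T n) v := rfl
  have hTd (n : ℕ) : DifferentiableOn ℂ (T n) (Metric.ball 0 r) := by
    induction n with
    | zero => exact hA
    | succ n ih => exact hw.mul (segConv_differentiableOn Metric.isOpen_ball hs hk ih)
  have hTb (n : ℕ) : ∀ v ∈ Metric.ball (0 : ℂ) r, ‖T n v‖ ≤ C * θ ^ n := by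
    induction n with
    | zero => simpa [T] using hAC
    | succ n ih =>
      intro v hv
      rw [hTs, norm_mul]
      have h1 := norm_segConv_le (f := k) (g := T n) (z := v)
        (fun τ hτ => hkB _ (hs v hv τ hτ)) (fun τ hτ => ih _ (hs v hv τ hτ))
      have h2 : ‖v‖ ≤ r := (mem_ball_zero_iff.1 hv).le
      calc ‖w v‖ * ‖segConv k (T n) v‖ ≤ W * (r * (B * (C * θ ^ n))) := by
            have := hwW v hv
            gcongr
            refine h1.trans ?_
            gcongr
        _ = C * θ ^ (n + 1) := by rw [hθ]; ring
  have hsum : Summable fun n : ℕ => C * θ ^ n :=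
    (summable_geometric_of_lt_one hθ0 hsmall).mul_left C
  have hTsum (v : ℂ) (hv : v ∈ Metric.ball (0 : ℂ) r) : Summable fun n => T n v :=
    .of_norm_bounded hsum fun n => hTb n v hv
  refine ⟨fun v => ∑' n, T n v, Complex.differentiableOn_tsum_of_summable_norm hsum hTd
    Metric.isOpen_ball hTb, fun v hv => ?_⟩
  have h2 : HasSum (fun n => segConv k (T n) v) (segConv k (fun v => ∑' n, T n v) v) := by
    unfold segConv
    refine HasSum.mul_left v ?_
    refine intervalIntegral.hasSum_integral_of_dominated_convergence (μ := volume)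
      (fun n _ => B * (C * θ ^ n)) (fun n => ?_) (fun n => Eventually.of_forall fun τ hτ => ?_)
      (Eventually.of_forall fun τ _ => hsum.mul_left B) (by simp)
      (Eventually.of_forall fun τ hτ => ?_)
    · have := (segConv_integrable hs hk.continuousOn (hTd n).continuousOn hv).aestronglyMeasurable
      rwa [uIoc_of_le zero_le_one]
    · rw [uIoc_of_le zero_le_one] at hτ
      have hτ' := Ioc_subset_Icc_self hτ
      rw [norm_mul]
      have := hkB _ (hs v hv τ hτ')
      have := hTb n _ (hs v hv _ (one_sub_mem_Icc hτ'))
      gcongr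
    · rw [uIoc_of_le zero_le_one] at hτ
      exact (hTsum _ (hs v hv _ (one_sub_mem_Icc (Ioc_subset_Icc_self hτ)))).hasSum.mul_left _
  have h3 := (hTsum v hv).hasSum
  rw [← hasSum_nat_add_iff' 1] at h3
  have h4 := (h2.mul_left (w v)).unique h3
  simp only [Finset.range_one, Finset.sum_singleton] at h4
  have h5 : T 0 v = A v := rfl
  rw [h5] at h4
  linear_combination -h4

/-- Uniqueness of the solution of a linear Volterra equation on a star-shaped part of a small
disc. -/
theorem volterra_unique {S : Set ℂ} (hS : IsStar S) (hSr : S ⊆ Metric.ball 0 r) {X Y : ℂ → ℂ}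
    (hX : ContinuousOn X S) (hY : ContinuousOn Y S) (hk : ContinuousOn k S)
    (hwW : ∀ v ∈ S, ‖w v‖ ≤ W) (hkB : ∀ v ∈ S, ‖k v‖ ≤ B) (hsmall : W * B * r < 1)
    (hXe : ∀ v ∈ S, X v = A v + w v * segConv k X v)
    (hYe : ∀ v ∈ S, Y v = A v + w v * segConv k Y v) : EqOn X Y S := by
  intro v hv
  set Z : ℂ → ℂ := fun u => X u - Y u with hZ
  have hZc : ContinuousOn Z S := hX.sub hY
  have hZe : ∀ u ∈ S, Z u = w u * segConv k Z u := by
    intro u hu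
    have h1 := segConv_add hS hk hX (h := fun u => -1 * Y u) (continuousOn_const.mul hY) hu
    rw [segConv_const_mul] at h1
    have h2 : Z = fun u => X u + -1 * Y u := by funext u; simp only [hZ]; ring
    have h3 : segConv k Z u = segConv k X u + -1 * segConv k Y u := by rw [h2]; exact h1
    simp only [hZ] at h3 ⊢
    rw [h3, hXe u hu, hYe u hu]
    ring
  have hZray : ContinuousOn (fun τ : ℝ => ‖Z (τ * v)‖) (Icc 0 1) :=
    (hZc.comp (by fun_prop) fun τ hτ => hS v hv τ hτ).norm
  -- At a maximum of `‖Z‖` on the segment to `v`, the homogeneous equation bounds that maximum by `W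
  -- B r < 1` times itself.
  obtain ⟨σ, hσ, hmax⟩ := isCompact_Icc.exists_isMaxOn (nonempty_Icc.2 zero_le_one) hZray
  have hu := hS v hv σ hσ
  have hW0 : 0 ≤ W := (norm_nonneg _).trans (hwW v hv)
  have hB0 : 0 ≤ B := (norm_nonneg _).trans (hkB v hv)
  have h1 : ‖segConv k Z (σ * v)‖ ≤ ‖(σ : ℂ) * v‖ * (B * ‖Z (σ * v)‖) := by
    refine norm_segConv_le (fun τ hτ => hkB _ (hS _ hu τ hτ)) fun τ hτ => ?_
    have := hmax (show τ * σ ∈ Icc (0 : ℝ) 1 from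
      ⟨mul_nonneg hτ.1 hσ.1, mul_le_one₀ hτ.2 hσ.1 hσ.2⟩)
    simpa [mul_assoc] using this
  have h2 : ‖(σ : ℂ) * v‖ ≤ r := (mem_ball_zero_iff.1 (hSr hu)).le
  have h3 : ‖Z (σ * v)‖ ≤ W * B * r * ‖Z (σ * v)‖ := by
    calc ‖Z (σ * v)‖ = ‖w (σ * v)‖ * ‖segConv k Z (σ * v)‖ := by rw [hZe _ hu, norm_mul]
      _ ≤ W * (r * (B * ‖Z (σ * v)‖)) := by
        have := hwW _ hu
        gcongr
        refine h1.trans ?_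
        gcongr
      _ = _ := by ring
  have h4 : ‖Z (σ * v)‖ = 0 := by nlinarith [norm_nonneg (Z (σ * v))]
  have h5 := hmax (right_mem_Icc.2 zero_le_one)
  simp only [Complex.ofReal_one, one_mul, Set.mem_ofPred_eq, h4] at h5
  exact sub_eq_zero.1 (norm_le_zero_iff.1 h5)

end Volterra

/-! ### Continuation across a line of poles -/

/-- The horizontal strip of half-width `δ`. -/
def strip (δ : ℝ) : Set ℂ := {z | |z.im| < δ}

/-- The horizontal strip of half-width `δ`, cut along the real half-lines from `±1` outwards. -/
def slitStrip (δ : ℝ) : Set ℂ := {z | |z.im| < δ ∧ (z.im ≠ 0 ∨ |z.re| < 1)}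

theorem isOpen_strip (δ : ℝ) : IsOpen (strip δ) :=
  isOpen_lt (continuous_abs.comp Complex.continuous_im) continuous_const

theorem isOpen_slitStrip (δ : ℝ) : IsOpen (slitStrip δ) :=
  (isOpen_strip δ).inter ((isOpen_ne_fun Complex.continuous_im continuous_const).union
    (isOpen_lt (continuous_abs.comp Complex.continuous_re) continuous_const))

theorem slitStrip_subset (δ : ℝ) : slitStrip δ ⊆ strip δ := fun _ h => h.1

theorem abs_mul_lt {τ a b : ℝ} (hτ : τ ∈ Icc (0 : ℝ) 1) (h : |a| < b) : |τ * a| < b := by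
  rw [abs_mul, abs_of_nonneg hτ.1]
  exact (mul_le_of_le_one_left (abs_nonneg _) hτ.2).trans_lt h

theorem isStar_strip (δ : ℝ) : IsStar (strip δ) := by
  intro z hz τ hτ
  change |((τ : ℂ) * z).im| < δ
  rw [Complex.im_ofReal_mul]
  exact abs_mul_lt hτ hz

theorem isStar_slitStrip (δ : ℝ) : IsStar (slitStrip δ) := by
  intro z hz τ hτ
  refine ⟨isStar_strip δ z hz.1 τ hτ, ?_⟩
  rw [Complex.im_ofReal_mul, Complex.re_ofReal_mul]
  rcases hz.2 with h | h
  · rcases eq_or_ne τ 0 with rfl | h0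
    · right; simp
    · left; exact mul_ne_zero h0 h
  · right; exact abs_mul_lt hτ h

/-- If the poles of the kernel `f` on the real axis are cancelled by an exponential factor, its
convolution exponential continues analytically across the real axis between them, from
above (`ε = 1`) and from below (`ε = -1`). -/
theorem convExp_continuation {δ : ℝ} (hδ : 0 < δ) {f fM : ℂ → ℂ} {c : ℂ}
    (hf : DifferentiableOn ℂ f (slitStrip δ)) (hfM : DifferentiableOn ℂ fM (strip δ))
    (hM : ∀ z ∈ slitStrip δ, (Complex.exp (c * z) - 1) * f z = fM z)
    {x : ℝ} (hx : Complex.exp (c * x) ≠ 1) {ε : ℝ} (hε : ε = 1 ∨ ε = -1) :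
    ∃ G : ℂ → ℂ, AnalyticAt ℂ G x ∧ ∀ᶠ z in 𝓝 (x : ℂ), 0 < ε * z.im → convExp f z = G z := by
  set E := convExp fM with hE
  set Y := convExp f with hY
  have hEd : DifferentiableOn ℂ E (strip δ) :=
    convExp_differentiableOn (isOpen_strip δ) (isStar_strip δ) hfM
  have hYd : DifferentiableOn ℂ Y (slitStrip δ) :=
    convExp_differentiableOn (isOpen_slitStrip δ) (isStar_slitStrip δ) hf
  -- `E` is built from `fM`, which is holomorphic on the whole strip; on the slit strip it agrees
  -- with the convolution exponential of the multiplied kernel.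
  have hEq : ∀ z ∈ slitStrip δ, z ≠ 0 →
      (Complex.exp (c * z) - 1) * Y z = E z + segConv E Y z := by
    intro z hz hz0
    rw [hY, exp_sub_one_mul_convExp (isOpen_slitStrip δ) (isStar_slitStrip δ) hf c hz hz0,
      segConv_congr (isStar_slitStrip δ) (convExp_congr (isStar_slitStrip δ) hM)
        (eqOn_refl _ _) hz, convExp_congr (isStar_slitStrip δ) hM hz]
  have hεε : ε * ε = 1 := by rcases hε with rfl | rfl <;> norm_num
  have hεa : |ε| = 1 := by rcases hε with rfl | rfl <;> norm_num
  have hMc : Continuous fun z : ℂ => Complex.exp (c * z) - 1 := by fun_prop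
  obtain ⟨r₁, hr₁, hMr⟩ := Metric.eventually_nhds_iff_ball.1
    ((hMc.continuousAt (x := (x : ℂ))).eventually_ne (sub_ne_zero.2 hx))
  obtain ⟨W, hW⟩ := (isCompact_closedBall (x : ℂ) (r₁ / 2)).exists_bound_of_continuousOn
    (f := fun z => (Complex.exp (c * z) - 1)⁻¹)
    (hMc.continuousOn.inv₀ fun z hz => hMr z (Metric.closedBall_subset_ball (by linarith) hz))
  have hball0 : Metric.closedBall (0 : ℂ) (δ / 2) ⊆ strip δ := fun z hz => by
    rw [mem_closedBall_zero_iff] at hz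
    exact ((Complex.abs_im_le_norm z).trans hz).trans_lt (by linarith)
  obtain ⟨B, hB⟩ := (isCompact_closedBall (0 : ℂ) (δ / 2)).exists_bound_of_continuousOn
    (hEd.continuousOn.mono hball0)
  have hW0 : 0 ≤ W := (norm_nonneg _).trans (hW x (Metric.mem_closedBall_self (by linarith)))
  have hB0 : 0 ≤ B := (norm_nonneg _).trans (hB 0 (Metric.mem_closedBall_self (by linarith)))
  -- `r` is small enough that the factor `exp(c z) - 1` does not vanish on the disc used below, that
  -- differences of points stay inside the strip where `E` is bounded, and that the Neumann series
  -- converges.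
  obtain ⟨r, hr, hr1, hr2, hr3⟩ : ∃ r > 0, 2 * r ≤ r₁ / 2 ∧ 2 * r < δ / 2 ∧ W * B * r < 1 := by
    have hWB : 0 < W * B + 1 := by positivity
    refine ⟨min (min (r₁ / 4) (δ / 8)) (1 / (W * B + 1)), by positivity, ?_, ?_, ?_⟩
    · linarith [(min_le_left (min (r₁ / 4) (δ / 8)) (1 / (W * B + 1))).trans (min_le_left _ _)]
    · linarith [(min_le_left (min (r₁ / 4) (δ / 8)) (1 / (W * B + 1))).trans (min_le_right _ _)]
    · calc W * B * min (min (r₁ / 4) (δ / 8)) (1 / (W * B + 1)) ≤ W * B * (1 / (W * B + 1)) := by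
            gcongr; exact min_le_right _ _
        _ < 1 := by rw [mul_one_div, div_lt_one hWB]; linarith
  -- The base point lies on the given side at distance `r / 2` from `x`, so the disc of radius `r`
  -- about `b` reaches across the axis and contains `x`.
  set b : ℂ := x + (ε * (r / 2) : ℝ) * Complex.I with hb
  have hbre : b.re = x := by simp [hb]
  have hbim : b.im = ε * (r / 2) := by simp [hb]
  have hbx : ‖b - x‖ = r / 2 := by
    rw [hb, add_sub_cancel_left, norm_mul, Complex.norm_I, mul_one, Complex.norm_real, norm_mul,
      Real.norm_eq_abs, hεa, one_mul, Real.norm_of_nonneg (by positivity)]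
  have hbS : b ∈ slitStrip (δ / 2) := by
    refine ⟨?_, Or.inl ?_⟩
    · rw [hbim, abs_mul, hεa, one_mul, abs_of_pos (by positivity)]; linarith
    · rw [hbim]; exact mul_ne_zero (by rintro rfl; simp at hεa) (by positivity)
  have hD1 (v : ℂ) (hv : v ∈ Metric.closedBall (0 : ℂ) r) :
      b + v ∈ Metric.closedBall (x : ℂ) (r₁ / 2) := by
    rw [mem_closedBall_zero_iff] at hv
    rw [Metric.mem_closedBall, dist_eq_norm]
    calc ‖b + v - x‖ = ‖(b - x) + v‖ := by ring_nf
      _ ≤ ‖b - x‖ + ‖v‖ := norm_add_le _ _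
      _ ≤ _ := by rw [hbx]; linarith
  have hD2 (v : ℂ) (hv : v ∈ Metric.closedBall (0 : ℂ) r) : b + v ∈ strip (δ / 2) := by
    rw [mem_closedBall_zero_iff] at hv
    change |(b + v).im| < δ / 2
    have h1 := (Complex.abs_im_le_norm v).trans hv
    rw [Complex.add_im, hbim]
    calc |ε * (r / 2) + v.im| ≤ |ε * (r / 2)| + |v.im| := abs_add_le _ _
      _ = r / 2 + |v.im| := by rw [abs_mul, hεa, one_mul, abs_of_pos (by positivity)]
      _ < δ / 2 := by linarith
  have hbτ (τ : ℝ) (hτ : τ ∈ Icc (0 : ℝ) 1) : (τ : ℂ) * b ∈ slitStrip (δ / 2) :=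
    isStar_slitStrip _ b hbS τ hτ
  have hhalf : slitStrip (δ / 2) ⊆ slitStrip δ := fun z hz => ⟨by linarith [hz.1], hz.2⟩
  have hshalf : strip (δ / 2) ⊆ strip δ := fun z hz => by
    have : |z.im| < δ / 2 := hz
    change |z.im| < δ
    linarith
  have hsub (s t : ℂ) (hs : s ∈ strip (δ / 2)) (ht : t ∈ strip (δ / 2)) : s - t ∈ strip δ := by
    change |(s - t).im| < δ
    have h1 : |s.im| < δ / 2 := hs
    have h2 : |t.im| < δ / 2 := ht
    rw [Complex.sub_im]
    linarith [abs_sub s.im t.im]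
  -- The part of `E * Y` over the fixed segment from `0` to `b`. It depends on `s` only through `E`,
  -- hence is holomorphic across the axis; the remaining part, from `b` to `s`, is the Volterra
  -- operator.
  set A₁ : ℂ → ℂ := fun s => lineInt (fun t => E (s - t) * Y t) 0 b with hA₁
  have hA₁d : DifferentiableOn ℂ A₁ (strip (δ / 2)) := by
    have hmaps (p : ℂ × ℝ) (hp : p ∈ strip (δ / 2) ×ˢ Icc (0 : ℝ) 1) :
        p.1 - (0 + p.2 * (b - 0)) ∈ strip δ := by
      rw [zero_add, sub_zero]
      exact hsub _ _ hp.1 (slitStrip_subset _ (hbτ _ hp.2))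
    refine (differentiableOn_const (b - 0)).mul
      (differentiableOn_integral_param (isOpen_strip _) ?_ ?_)
    · refine (hEd.continuousOn.comp (by fun_prop) hmaps).mul ?_
      refine hYd.continuousOn.comp (by fun_prop) fun p hp => hhalf ?_
      rw [zero_add, sub_zero]
      exact hbτ _ hp.2
    · intro τ hτ
      exact (hEd.comp (f := fun s : ℂ => s - (0 + τ * (b - 0))) (by fun_prop) fun s hs => hmaps (s, τ) ⟨hs, hτ⟩).mul
        (differentiableOn_const _)
  set A : ℂ → ℂ := fun v => (E (b + v) + A₁ (b + v)) * (Complex.exp (c * (b + v)) - 1)⁻¹ with hA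
  set w : ℂ → ℂ := fun v => (Complex.exp (c * (b + v)) - 1)⁻¹ with hw
  have hM0 (v : ℂ) (hv : v ∈ Metric.closedBall (0 : ℂ) r) :
      Complex.exp (c * (b + v)) - 1 ≠ 0 :=
    hMr _ (Metric.closedBall_subset_ball (by linarith) (hD1 v hv))
  have hwd : DifferentiableOn ℂ w (Metric.closedBall 0 r) :=
    DifferentiableOn.inv (by fun_prop) hM0
  have hAd : DifferentiableOn ℂ A (Metric.closedBall 0 r) := by
    refine DifferentiableOn.mul (DifferentiableOn.add ?_ ?_) hwd
    · exact hEd.comp (by fun_prop) fun v hv => hshalf (hD2 v hv)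
    · exact hA₁d.comp (by fun_prop) fun v hv => hD2 v hv
  obtain ⟨C, hC⟩ := (isCompact_closedBall (0 : ℂ) r).exists_bound_of_continuousOn hAd.continuousOn
  have hbc := Metric.ball_subset_closedBall (x := (0 : ℂ)) (ε := r)
  have hEball : Metric.ball (0 : ℂ) r ⊆ Metric.closedBall 0 (δ / 2) :=
    Metric.ball_subset_closedBall.trans (Metric.closedBall_subset_closedBall (by linarith))
  obtain ⟨X, hXd, hXe⟩ := exists_volterra_solution hr (hAd.mono hbc) (hwd.mono hbc)
    (hEd.mono (hEball.trans hball0)) (fun v hv => hC v (hbc hv))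
    (fun v hv => hW _ (hD1 v (hbc hv))) (fun v hv => hB v (hEball hv)) hr3
  -- The part of the disc, centred at `b`, on the given side of the axis. There `Y` is defined and
  -- solves the same equation as `X`; star-shapedness about `b` lets uniqueness apply.
  set S : Set ℂ := {v | v ∈ Metric.ball (0 : ℂ) r ∧ 0 < ε * (b + v).im} with hS
  have hbv (v : ℂ) : ε * (b + v).im = r / 2 + ε * v.im := by
    rw [Complex.add_im, hbim, mul_add, ← mul_assoc, hεε, one_mul]
  have hSstar : IsStar S := by
    intro v hv τ hτ
    refine ⟨isStar_ball r v hv.1 τ hτ, ?_⟩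
    have h1 := hv.2
    rw [hbv] at h1 ⊢
    rw [Complex.im_ofReal_mul]
    rcases eq_or_lt_of_le hτ.1 with h0 | h0
    · rw [← h0, zero_mul, mul_zero, add_zero]; positivity
    · nlinarith [mul_pos h0 h1, mul_nonneg (sub_nonneg.2 hτ.2) hr.le]
  have hSY (v : ℂ) (hv : v ∈ S) : b + v ∈ slitStrip (δ / 2) := by
    refine ⟨hD2 v (hbc hv.1), Or.inl fun h => ?_⟩
    have := hv.2
    rw [h, mul_zero] at this
    exact lt_irrefl _ this
  have hYS : ∀ v ∈ S, Y (b + v) = A v + w v * segConv E (fun u => Y (b + u)) v := by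
    intro v hv
    have hv' := hSY v hv
    have h0 : b + v ≠ 0 := fun h => by
      have := hv.2
      rw [h, Complex.zero_im, mul_zero] at this
      exact lt_irrefl _ this
    have h1 := hEq _ (hhalf hv') h0
    rw [segConv_eq_lineInt, lineInt_add (isOpen_slitStrip (δ / 2)) (isStar_slitStrip (δ / 2))
      (b := b)] at h1
    · have h2 : lineInt (fun t => E (b + v - t) * Y t) b (b + v) =
          segConv E (fun u => Y (b + u)) v := by
        rw [segConv_comm]
        unfold lineInt segConv
        rw [add_sub_cancel_left]
        congr 1
        refine intervalIntegral.integral_congr fun τ _ => ?_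
        simp only [mul_comm (E _)]
        congr 2
        push_cast; ring
      rw [h2] at h1
      simp only [hA, hw, hA₁]
      have h3 := hM0 v (hbc hv.1)
      have h4 := inv_mul_cancel₀ h3
      linear_combination (Complex.exp (c * (b + v)) - 1)⁻¹ * h1 - Y (b + v) * h4
    · refine DifferentiableOn.mul ?_ (hYd.mono hhalf)
      exact hEd.comp (by fun_prop) fun t ht => hsub _ _ hv'.1 ht.1
    · intro τ hτ
      rw [add_sub_cancel_left]
      exact hSY _ (hSstar v hv τ hτ)
  have heq := volterra_unique hSstar (fun v hv => hv.1) (hXd.continuousOn.mono fun v hv => hv.1)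
    (hYd.continuousOn.comp (by fun_prop) fun v hv => hhalf (hSY v hv))
    (hEd.continuousOn.mono fun v hv => hball0 (hEball hv.1))
    (fun v hv => hW _ (hD1 v (hbc hv.1))) (fun v hv => hB v (hEball hv.1)) hr3
    (fun v hv => hXe v hv.1) hYS
  have hxb : (x : ℂ) - b ∈ Metric.ball (0 : ℂ) r := by
    rw [mem_ball_zero_iff, ← norm_neg, neg_sub, hbx]; linarith
  refine ⟨fun z => X (z - b), ?_, ?_⟩
  · refine AnalyticAt.fun_comp (f := fun z : ℂ => z - b) (g := X) ?_ (by fun_prop)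
    exact hXd.analyticAt (Metric.isOpen_ball.mem_nhds hxb)
  · have hcont : ContinuousAt (fun z : ℂ => z - b) x := by fun_prop
    filter_upwards [hcont.preimage_mem_nhds (Metric.isOpen_ball.mem_nhds hxb)] with z hz hz'
    have h1 : z - b ∈ S := ⟨hz, by rwa [add_sub_cancel]⟩
    have := heq h1
    rw [Function.comp_apply, add_sub_cancel] at this
    exact this.symm

/-! ### Path deformation and growth at the poles -/

/-- The factor `w` rotates the branch cut of the logarithm away from the path; it drops out of the
derivative. -/
theorem lineInt_inv_sub {b s P w : ℂ} (hw : w ≠ 0)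
    (h : ∀ τ ∈ Icc (0 : ℝ) 1, w * (b + τ * (s - b) - P) ∈ Complex.slitPlane) :
    lineInt (fun t => (t - P)⁻¹) b s = Complex.log (w * (s - P)) - Complex.log (w * (b - P)) := by
  have hne (τ : ℝ) (hτ : τ ∈ Icc (0 : ℝ) 1) : b + τ * (s - b) - P ≠ 0 :=
    right_ne_zero_of_mul (Complex.slitPlane_ne_zero (h τ hτ))
  have h1 : ∀ τ ∈ uIcc (0 : ℝ) 1,
      HasDerivAt (fun τ : ℝ => Complex.log (w * (b + τ * (s - b) - P)))
      ((b + τ * (s - b) - P)⁻¹ * (s - b)) τ := by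
    intro τ hτ
    rw [uIcc_of_le zero_le_one] at hτ
    have h2 : HasDerivAt (fun σ : ℂ => w * (b + σ * (s - b) - P)) (w * (1 * (s - b))) (τ : ℂ) :=
      ((((hasDerivAt_id _).mul_const _).const_add b).sub_const P).const_mul w
    have h3 := (HasDerivAt.clog h2 (h τ hτ)).comp_ofReal
    convert h3 using 1
    have := hne τ hτ
    field_simp
  have hc : ContinuousOn (fun τ : ℝ => (b + τ * (s - b) - P)⁻¹ * (s - b)) (Icc 0 1) :=
    (ContinuousOn.inv₀ (by fun_prop) hne).mul continuousOn_const
  have h3 := intervalIntegral.integral_eq_sub_of_hasDerivAt h1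
    (hc.intervalIntegrable_of_Icc zero_le_one)
  rw [intervalIntegral.integral_mul_const] at h3
  simp only [Complex.ofReal_one, one_mul, add_sub_cancel, Complex.ofReal_zero, zero_mul,
    add_zero] at h3
  rw [lineInt, mul_comm]
  exact h3

theorem log_sub_log_neg {z : ℂ} (hz : 0 < z.im) :
    Complex.log z - Complex.log (-z) = Real.pi * Complex.I := by
  apply Complex.ext
  · simp [Complex.log_re]
  · simp [Complex.log_im, Complex.arg_neg_eq_arg_sub_pi_of_im_pos hz]

section Residue

variable {δ : ℝ} {m : ℕ} {R s : ℂ} {Y κ : ℂ → ℂ}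

/-- The part of the slit strip between the abscissas `-1` and `m + 1`. -/
def slitBox (δ : ℝ) (m : ℕ) : Set ℂ := {t | t ∈ slitStrip δ ∧ -1 < t.re ∧ t.re < m + 1}

/-- The part of the strip between the abscissas `-1` and `m + 1`. -/
def box (δ : ℝ) (m : ℕ) : Set ℂ := {t | t ∈ strip δ ∧ -1 < t.re ∧ t.re < m + 1}

theorem isOpen_slitBox (δ : ℝ) (m : ℕ) : IsOpen (slitBox δ m) :=
  (isOpen_slitStrip δ).inter ((isOpen_lt continuous_const Complex.continuous_re).inter
    (isOpen_lt Complex.continuous_re continuous_const))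

theorem isOpen_box (δ : ℝ) (m : ℕ) : IsOpen (box δ m) :=
  (isOpen_strip δ).inter ((isOpen_lt continuous_const Complex.continuous_re).inter
    (isOpen_lt Complex.continuous_re continuous_const))

theorem isStar_slitBox (δ : ℝ) (m : ℕ) : IsStar (slitBox δ m) := by
  intro z hz τ hτ
  refine ⟨isStar_slitStrip δ z hz.1 τ hτ, ?_, ?_⟩
  · rw [Complex.re_ofReal_mul]
    rcases le_total 0 z.re with h | h
    · linarith [mul_nonneg hτ.1 h]
    · linarith [mul_le_mul_of_nonpos_right hτ.2 h, hz.2.1]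
  · rw [Complex.re_ofReal_mul]
    have : (0 : ℝ) ≤ m := Nat.cast_nonneg m
    rcases le_total 0 z.re with h | h
    · linarith [mul_le_mul_of_nonneg_right hτ.2 h, hz.2.2]
    · linarith [mul_nonpos_of_nonneg_of_nonpos hτ.1 h]

/-- Subtracting `Y(P) / (t - P)` at each pole `P = s - (n + 1)` leaves the divided difference of
`Y`, which is holomorphic. The path dependence is thereby confined to the integrals of `1 / (t -
P)`, which are logarithms. -/
theorem lineInt_split {b e : ℂ} (hY : DifferentiableOn ℂ Y (slitStrip δ))
    (hκ : DifferentiableOn ℂ κ (box δ m)) (hδ : 0 < δ)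
    (hs : ∀ n ∈ Finset.range m, s - (n + 1) ∈ slitStrip δ)
    (hst : ∀ t ∈ slitBox (δ / 2) m, s - t ∈ box δ m)
    (hbe : ∀ τ ∈ Icc (0 : ℝ) 1, b + τ * (e - b) ∈ slitBox (δ / 2) m ∧
      ∀ n ∈ Finset.range m, b + τ * (e - b) - (s - (n + 1)) ≠ 0) :
    lineInt (fun t => (κ (s - t) + R * ∑ n ∈ Finset.range m, (s - t - (n + 1))⁻¹) * Y t) b e =
      lineInt (fun t => κ (s - t) * Y t -
        R * ∑ n ∈ Finset.range m, dslope Y (s - (n + 1)) t) b e -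
      R * ∑ n ∈ Finset.range m,
        Y (s - (n + 1)) * lineInt (fun t => (t - (s - (n + 1)))⁻¹) b e := by
  have hsub : slitBox (δ / 2) m ⊆ slitStrip δ := fun z hz => ⟨by linarith [hz.1.1], hz.1.2⟩
  have hd (n : ℕ) (hn : n ∈ Finset.range m) :
      DifferentiableOn ℂ (dslope Y (s - (n + 1))) (slitStrip δ) :=
    (Complex.differentiableOn_dslope ((isOpen_slitStrip δ).mem_nhds (hs n hn))).2 hY
  have hc1 : ContinuousOn (fun τ : ℝ => κ (s - (b + τ * (e - b))) * Y (b + τ * (e - b)) -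
        R * ∑ n ∈ Finset.range m, dslope Y (s - (n + 1)) (b + τ * (e - b))) (Icc 0 1) := by
    refine ContinuousOn.sub (ContinuousOn.mul ?_ ?_) (continuousOn_const.mul
      (continuousOn_finsetSum _ fun n hn => ?_))
    · exact hκ.continuousOn.comp (by fun_prop) fun τ hτ => hst _ (hbe τ hτ).1
    · exact hY.continuousOn.comp (by fun_prop) fun τ hτ => hsub (hbe τ hτ).1
    · exact (hd n hn).continuousOn.comp (by fun_prop) fun τ hτ => hsub (hbe τ hτ).1
  have hc2 (n : ℕ) (hn : n ∈ Finset.range m) :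
      ContinuousOn (fun τ : ℝ => (b + τ * (e - b) - (s - (n + 1)))⁻¹) (Icc 0 1) :=
    ContinuousOn.inv₀ (by fun_prop) fun τ hτ => (hbe τ hτ).2 n hn
  have hc3 : ContinuousOn (fun τ : ℝ => R * ∑ n ∈ Finset.range m,
      Y (s - (n + 1)) * (b + τ * (e - b) - (s - (n + 1)))⁻¹) (Icc 0 1) :=
    continuousOn_const.mul (continuousOn_finsetSum _ fun n hn => continuousOn_const.mul (hc2 n hn))
  have key : ∫ τ in (0 : ℝ)..1, (κ (s - (b + τ * (e - b))) + R * ∑ n ∈ Finset.range m,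
      (s - (b + τ * (e - b)) - (n + 1))⁻¹) * Y (b + τ * (e - b)) =
      ∫ τ in (0 : ℝ)..1, ((κ (s - (b + τ * (e - b))) * Y (b + τ * (e - b)) -
        R * ∑ n ∈ Finset.range m, dslope Y (s - (n + 1)) (b + τ * (e - b))) -
        R * ∑ n ∈ Finset.range m, Y (s - (n + 1)) * (b + τ * (e - b) - (s - (n + 1)))⁻¹) := by
    refine intervalIntegral.integral_congr fun τ hτ => ?_
    rw [uIcc_of_le zero_le_one] at hτ
    have h1 : ∀ n ∈ Finset.range m, (s - (b + τ * (e - b)) - (n + 1))⁻¹ * Y (b + τ * (e - b)) =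
        -(dslope Y (s - (n + 1)) (b + τ * (e - b)) +
          Y (s - (n + 1)) * (b + τ * (e - b) - (s - (n + 1)))⁻¹) := by
      intro n hn
      have h2 := (hbe τ hτ).2 n hn
      rw [dslope_of_ne _ (sub_ne_zero.1 h2), slope_def_field]
      have h3 : s - (b + τ * (e - b)) - (n + 1) = -(b + τ * (e - b) - (s - (n + 1))) := by ring
      rw [h3]
      generalize b + τ * (e - b) - (s - (n + 1)) = u at h2
      field_simp
      ring
    rw [add_mul, mul_assoc, Finset.sum_mul, Finset.sum_congr rfl h1, Finset.sum_neg_distrib,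
      Finset.sum_add_distrib]
    ring
  unfold lineInt
  rw [key, intervalIntegral.integral_sub (hc1.intervalIntegrable_of_Icc zero_le_one)
    (hc3.intervalIntegrable_of_Icc zero_le_one), intervalIntegral.integral_const_mul,
    intervalIntegral.integral_finsetSum (f := fun (n : ℕ) (τ : ℝ) =>
      Y (s - (n + 1)) * (b + τ * (e - b) - (s - (n + 1)))⁻¹) fun n hn => (continuousOn_const.mul
      (hc2 n hn)).intervalIntegrable_of_Icc zero_le_one]
  simp only [intervalIntegral.integral_const_mul]
  simp only [mul_left_comm _ (e - b)]
  rw [← Finset.mul_sum]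
  ring

end Residue

section Pole

variable {δ : ℝ} {k : ℕ} {R : ℂ} {f κ : ℂ → ℂ}

/-- The equation of the convolution exponential below the pole `k + 1`, with the path of
integration pushed down past the poles of the kernel. -/
theorem mul_convExp_below_pole (hδ : 0 < δ) (hf : DifferentiableOn ℂ f (slitStrip δ))
    (hκ : DifferentiableOn ℂ κ (box δ (k + 1)))
    (hfκ : ∀ z ∈ slitBox δ (k + 1),
      z * f z = κ z + R * ∑ n ∈ Finset.range (k + 1), (z - (n + 1))⁻¹)
    {d ε : ℝ} (hd : d < δ / 2) (hε : 0 < ε) (hεd : (k + 1) * ε < d) {s b : ℂ}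
    (hs : s = (k + 1 : ℝ) - (ε : ℝ) * Complex.I) (hb : b = (k + 1 : ℝ) - (d : ℝ) * Complex.I) :
    s * convExp f s = s * f s + R * (2 * Real.pi * Complex.I) *
        ∑ n ∈ Finset.range k, convExp f (s - (n + 1)) +
      (lineInt (fun t => (κ (s - t) + R * ∑ n ∈ Finset.range (k + 1), (s - t - (n + 1))⁻¹) *
        convExp f t) 0 b +
      lineInt (fun t => (κ (s - t) + R * ∑ n ∈ Finset.range (k + 1), (s - t - (n + 1))⁻¹) *
        convExp f t) b s) := by
  set Y := convExp f with hYdef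
  have hY : DifferentiableOn ℂ Y (slitStrip δ) :=
    convExp_differentiableOn (isOpen_slitStrip δ) (isStar_slitStrip δ) hf
  have hk0 : (0 : ℝ) ≤ k := Nat.cast_nonneg k
  have hεd' : ε < d := by nlinarith
  have hd0 : 0 < d := hε.trans hεd'
  have hsre : s.re = k + 1 := by rw [hs]; simp
  have hsim : s.im = -ε := by rw [hs]; simp
  have hbre : b.re = k + 1 := by rw [hb]; simp
  have hbim : b.im = -d := by rw [hb]; simp
  have hsbox : s ∈ slitBox (δ / 2) (k + 1) := by
    refine ⟨⟨?_, Or.inl ?_⟩, ?_, ?_⟩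
    · rw [hsim, abs_neg, abs_of_pos hε]; linarith
    · rw [hsim]; linarith
    · rw [hsre]; linarith
    · rw [hsre]; push_cast; linarith
  have hbbox : b ∈ slitBox (δ / 2) (k + 1) := by
    refine ⟨⟨?_, Or.inl ?_⟩, ?_, ?_⟩
    · rw [hbim, abs_neg, abs_of_pos hd0]; linarith
    · rw [hbim]; linarith
    · rw [hbre]; linarith
    · rw [hbre]; push_cast; linarith
  have hbox2 : slitBox (δ / 2) (k + 1) ⊆ slitBox δ (k + 1) :=
    fun z hz => ⟨⟨by linarith [hz.1.1], hz.1.2⟩, hz.2⟩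
  have hsP : ∀ n ∈ Finset.range (k + 1), s - (n + 1) ∈ slitStrip δ := by
    intro n _
    refine ⟨?_, Or.inl ?_⟩
    · simp only [Complex.sub_im, Complex.add_im, Complex.natCast_im, Complex.one_im, hsim]
      rw [add_zero, sub_zero, abs_neg, abs_of_pos hε]; linarith
    · simp only [Complex.sub_im, Complex.add_im, Complex.natCast_im, Complex.one_im, hsim]
      linarith
  have hst : ∀ t ∈ slitBox (δ / 2) (k + 1), s - t ∈ box δ (k + 1) := by
    intro t ht
    refine ⟨?_, ?_, ?_⟩
    · change |(s - t).im| < δ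
      rw [Complex.sub_im, hsim]
      have h1 := abs_sub (-ε) t.im
      rw [abs_neg, abs_of_pos hε] at h1
      linarith [ht.1.1]
    · rw [Complex.sub_re, hsre]
      have := ht.2.2
      push_cast at this
      linarith
    · rw [Complex.sub_re, hsre]
      push_cast
      linarith [ht.2.1]
  set K : ℂ → ℂ := fun t => (κ (s - t) + R * ∑ n ∈ Finset.range (k + 1), (s - t - (n + 1))⁻¹) * Y t
    with hK
  set q : ℂ → ℂ := fun t => κ (s - t) * Y t -
    R * ∑ n ∈ Finset.range (k + 1), dslope Y (s - (n + 1)) t with hq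
  have hqd : DifferentiableOn ℂ q (slitBox (δ / 2) (k + 1)) := by
    have hsub : slitBox (δ / 2) (k + 1) ⊆ slitStrip δ := fun z hz => (hbox2 hz).1
    refine DifferentiableOn.sub (DifferentiableOn.mul ?_ (hY.mono hsub))
      ((differentiableOn_const R).mul (DifferentiableOn.fun_sum fun n hn => ?_))
    · exact hκ.comp (by fun_prop) hst
    · exact ((Complex.differentiableOn_dslope ((isOpen_slitStrip δ).mem_nhds (hsP n hn))).2
        hY).mono hsub
  -- coordinates along the three segments
  have hP (n : ℕ) : (s - ((n : ℂ) + 1)).re = k - n ∧ (s - ((n : ℂ) + 1)).im = -ε := by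
    constructor
    · simp [hsre]
    · simp [hsim]
  have seg0s (τ : ℝ) (n : ℕ) : (0 + τ * (s - 0) - (s - ((n : ℂ) + 1))).re = τ * (k + 1) - (k - n) ∧
      (0 + τ * (s - 0) - (s - ((n : ℂ) + 1))).im = ε * (1 - τ) := by
    rw [zero_add, sub_zero, Complex.sub_re, Complex.sub_im, (hP n).1, (hP n).2,
      Complex.re_ofReal_mul, Complex.im_ofReal_mul, hsre, hsim]
    constructor <;> ring
  have seg0b (τ : ℝ) (n : ℕ) : (0 + τ * (b - 0) - (s - ((n : ℂ) + 1))).re = τ * (k + 1) - (k - n) ∧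
      (0 + τ * (b - 0) - (s - ((n : ℂ) + 1))).im = ε - τ * d := by
    rw [zero_add, sub_zero, Complex.sub_re, Complex.sub_im, (hP n).1, (hP n).2,
      Complex.re_ofReal_mul, Complex.im_ofReal_mul, hbre, hbim]
    constructor <;> ring
  have segbs (τ : ℝ) (n : ℕ) : (b + τ * (s - b) - (s - ((n : ℂ) + 1))).re = n + 1 ∧
      (b + τ * (s - b) - (s - ((n : ℂ) + 1))).im = (1 - τ) * (ε - d) := by
    rw [Complex.sub_re, Complex.sub_im, (hP n).1, (hP n).2, Complex.add_re, Complex.add_im,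
      Complex.re_ofReal_mul, Complex.im_ofReal_mul, Complex.sub_re, Complex.sub_im, hbre, hbim,
      hsre, hsim]
    constructor <;> ring
  have in0s (τ : ℝ) (hτ : τ ∈ Icc (0 : ℝ) 1) : 0 + τ * (s - 0) ∈ slitBox (δ / 2) (k + 1) := by
    rw [zero_add, sub_zero]; exact isStar_slitBox _ _ s hsbox τ hτ
  have in0b (τ : ℝ) (hτ : τ ∈ Icc (0 : ℝ) 1) : 0 + τ * (b - 0) ∈ slitBox (δ / 2) (k + 1) := by
    rw [zero_add, sub_zero]; exact isStar_slitBox _ _ b hbbox τ hτ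
  have inbs (τ : ℝ) (hτ : τ ∈ Icc (0 : ℝ) 1) : b + τ * (s - b) ∈ slitBox (δ / 2) (k + 1) := by
    have hre : (b + τ * (s - b)).re = k + 1 := by
      rw [Complex.add_re, Complex.re_ofReal_mul, Complex.sub_re, hbre, hsre]; ring
    have him : (b + τ * (s - b)).im = -((1 - τ) * d + τ * ε) := by
      rw [Complex.add_im, Complex.im_ofReal_mul, Complex.sub_im, hbim, hsim]; ring
    have h1 : 0 < (1 - τ) * d + τ * ε := by
      nlinarith [mul_nonneg (sub_nonneg.2 hτ.2) (sub_nonneg.2 hεd'.le)]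
    have h2 : (1 - τ) * d + τ * ε ≤ d := by nlinarith [hτ.1]
    refine ⟨⟨?_, Or.inl ?_⟩, ?_, ?_⟩
    · rw [him, abs_neg, abs_of_pos h1]; linarith
    · rw [him]; linarith
    · rw [hre]; linarith
    · rw [hre]; push_cast; linarith
  -- The straight segment runs above the poles `s - (n + 1)`, so the cut of the logarithm is
  -- directed downwards from the pole, by the factor `-i`.
  have slit0s (n : ℕ) (τ : ℝ) (hτ : τ ∈ Icc (0 : ℝ) 1) :
      -Complex.I * (0 + τ * (s - 0) - (s - ((n : ℂ) + 1))) ∈ Complex.slitPlane := by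
    rw [Complex.mem_slitPlane_iff]
    simp only [Complex.mul_re, Complex.mul_im, Complex.neg_re, Complex.neg_im, Complex.I_re,
      Complex.I_im, seg0s τ n]
    rcases eq_or_lt_of_le hτ.2 with h | h
    · right
      rw [h]
      have : (0 : ℝ) ≤ n := Nat.cast_nonneg n
      intro h'
      linarith
    · left
      have := mul_pos hε (sub_pos.2 h)
      linarith
  -- The segment from `0` to `b` passes below the poles with `n < k`: they have abscissa at least
  -- `1`, where `(k + 1) ε < d` puts the segment below height `-ε`. The factor `i` directs the cut
  -- upwards.
  have slit0b (n : ℕ) (hn : n < k) (τ : ℝ) :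
      Complex.I * (0 + τ * (b - 0) - (s - ((n : ℂ) + 1))) ∈ Complex.slitPlane := by
    rw [Complex.mem_slitPlane_iff]
    simp only [Complex.mul_re, Complex.mul_im, Complex.I_re, Complex.I_im, seg0b τ n]
    by_cases h : τ * (k + 1) - (k - n : ℝ) = 0
    · left
      have h1 : (1 : ℝ) ≤ k - n := by
        have : (n : ℝ) + 1 ≤ k := by exact_mod_cast hn
        linarith
      nlinarith
    · right
      intro h'
      exact h (by linarith)
  have slitbs (n : ℕ) (τ : ℝ) :
      Complex.I * (b + τ * (s - b) - (s - ((n : ℂ) + 1))) ∈ Complex.slitPlane := by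
    rw [Complex.mem_slitPlane_iff]
    simp only [Complex.mul_re, Complex.mul_im, Complex.I_re, Complex.I_im, segbs τ n]
    right
    have : (0 : ℝ) ≤ n := Nat.cast_nonneg n
    intro h'
    linarith
  have slitbs' (n : ℕ) (τ : ℝ) :
      1 * (b + τ * (s - b) - (s - ((n : ℂ) + 1))) ∈ Complex.slitPlane := by
    rw [one_mul, Complex.mem_slitPlane_iff, (segbs τ n).1]
    left; positivity
  -- The pole with `n = k` lies at `-iε`, just under the starting point `0`. Neither path crosses
  -- the ray to its left, so the principal branch serves for both and there is no winding.
  have slit0s' (τ : ℝ) (hτ : τ ∈ Icc (0 : ℝ) 1) :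
      1 * (0 + τ * (s - 0) - (s - ((k : ℂ) + 1))) ∈ Complex.slitPlane := by
    rw [one_mul, Complex.mem_slitPlane_iff, (seg0s τ k).1, (seg0s τ k).2, sub_self, sub_zero]
    rcases eq_or_lt_of_le hτ.1 with h | h
    · right; rw [← h]; simp [hε.ne']
    · left; positivity
  have slit0b' (τ : ℝ) (hτ : τ ∈ Icc (0 : ℝ) 1) :
      1 * (0 + τ * (b - 0) - (s - ((k : ℂ) + 1))) ∈ Complex.slitPlane := by
    rw [one_mul, Complex.mem_slitPlane_iff, (seg0b τ k).1, (seg0b τ k).2, sub_self, sub_zero]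
    rcases eq_or_lt_of_le hτ.1 with h | h
    · right; rw [← h]; simp [hε.ne']
    · left; positivity
  have split0s := lineInt_split (R := R) hY hκ hδ hsP hst (b := 0) (e := s) fun τ hτ =>
    ⟨in0s τ hτ, fun n _ => right_ne_zero_of_mul (Complex.slitPlane_ne_zero (slit0s n τ hτ))⟩
  have split0b := lineInt_split (R := R) hY hκ hδ hsP hst (b := 0) (e := b) fun τ hτ =>
    ⟨in0b τ hτ, fun n hn => by
      rcases Nat.lt_succ_iff_lt_or_eq.1 (Finset.mem_range.1 hn) with h | h
      · exact right_ne_zero_of_mul (Complex.slitPlane_ne_zero (slit0b n h τ))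
      · rw [h]; exact right_ne_zero_of_mul (Complex.slitPlane_ne_zero (slit0b' τ hτ))⟩
  have splitbs := lineInt_split (R := R) hY hκ hδ hsP hst (b := b) (e := s) fun τ hτ =>
    ⟨inbs τ hτ, fun n _ => right_ne_zero_of_mul (Complex.slitPlane_ne_zero (slitbs n τ))⟩
  have hadd := lineInt_add (isOpen_slitBox (δ / 2) (k + 1)) (isStar_slitBox _ _) hqd inbs
  -- the winding of the path around the poles
  set ℓ : ℕ → ℂ → ℂ → ℂ := fun n => lineInt (fun t => (t - (s - (n + 1)))⁻¹) with hℓ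
  have hI : Complex.I ≠ 0 := Complex.I_ne_zero
  have wind (n : ℕ) (hn : n ∈ Finset.range k) :
      ℓ n 0 b + ℓ n b s - ℓ n 0 s = 2 * Real.pi * Complex.I := by
    rw [Finset.mem_range] at hn
    simp only [hℓ]
    rw [lineInt_inv_sub hI fun τ _ => slit0b n hn τ, lineInt_inv_sub hI fun τ _ => slitbs n τ,
      lineInt_inv_sub (neg_ne_zero.2 hI) (slit0s n)]
    have hn' : (n : ℝ) + 1 ≤ k := by exact_mod_cast hn
    -- At each end of the path the two branches of the logarithm differ by `πi`, with opposite
    -- orientation; the two contributions add up to `2πi`.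
    have e1 := log_sub_log_neg (z := Complex.I * (s - (s - (n + 1)))) (by
      rw [sub_sub_cancel]; simp; positivity)
    have e2 := log_sub_log_neg (z := -Complex.I * (0 - (s - (n + 1)))) (by
      rw [zero_sub, neg_mul_neg, Complex.I_mul_im, (hP n).1]; linarith)
    simp only [neg_mul, neg_neg] at e1 e2 ⊢
    linear_combination e1 + e2
  have wind' : ℓ k 0 b + ℓ k b s - ℓ k 0 s = 0 := by
    simp only [hℓ]
    rw [lineInt_inv_sub one_ne_zero slit0b', lineInt_inv_sub one_ne_zero fun τ _ => slitbs' k τ,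
      lineInt_inv_sub one_ne_zero slit0s']
    ring
  have hmain : s * Y s = s * f s + lineInt K 0 s := by
    rw [hYdef, mul_convExp (isOpen_slitStrip δ) (isStar_slitStrip δ) hf (hbox2 hsbox).1,
      segConv_eq_lineInt]
    congr 1
    unfold lineInt
    congr 1
    refine intervalIntegral.integral_congr fun τ hτ => ?_
    rw [uIcc_of_le zero_le_one] at hτ
    simp only [hK]
    rw [hfκ]
    have h1 : s - (0 + τ * (s - 0)) = ((1 - τ : ℝ) : ℂ) * s := by push_cast; ring
    rw [h1]
    exact hbox2 (isStar_slitBox _ _ s hsbox _ (one_sub_mem_Icc hτ))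
  have hsum : ∑ n ∈ Finset.range (k + 1), Y (s - (n + 1)) * ℓ n 0 b +
      ∑ n ∈ Finset.range (k + 1), Y (s - (n + 1)) * ℓ n b s -
      ∑ n ∈ Finset.range (k + 1), Y (s - (n + 1)) * ℓ n 0 s =
      (2 * Real.pi * Complex.I) * ∑ n ∈ Finset.range k, Y (s - (n + 1)) := by
    rw [← Finset.sum_add_distrib, ← Finset.sum_sub_distrib, Finset.sum_range_succ, ← mul_add,
      ← mul_sub, wind', mul_zero, add_zero, Finset.mul_sum]
    refine Finset.sum_congr rfl fun n hn => ?_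
    rw [← mul_add, ← mul_sub, wind n hn, mul_comm]
  linear_combination hmain + split0s - split0b - splitbs + hadd + R * hsum

end Pole

section
variable {δ N : ℝ} {k : ℕ} {R : ℂ} {f κ : ℂ → ℂ}

/-- The part of the path far from the pole contributes `o(1/ε)`. -/
theorem tendsto_mul_lineInt_zero (hκ : DifferentiableOn ℂ κ (box δ (k + 1))) {Y : ℂ → ℂ}
    (hY : ContinuousOn Y (slitStrip δ)) {d : ℝ} (hd0 : 0 < d) (hd : d < δ) {s : ℝ → ℂ} {b : ℂ}
    (hs : ∀ ε, s ε = (k + 1 : ℝ) - (ε : ℝ) * Complex.I)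
    (hb : b = (k + 1 : ℝ) - (d : ℝ) * Complex.I) :
    Tendsto (fun ε : ℝ => (ε : ℂ) * lineInt (fun t => (κ (s ε - t) +
      R * ∑ n ∈ Finset.range (k + 1), (s ε - t - (n + 1))⁻¹) * Y t) 0 b) (𝓝[>] 0) (𝓝 0) := by
  have hk1 : (0 : ℝ) < k + 1 := by positivity
  have hbS : b ∈ slitStrip δ := by
    rw [hb]
    refine ⟨?_, Or.inl ?_⟩
    · simpa [abs_of_pos hd0] using hd
    · simpa using hd0.ne'
  have hτb (τ : ℝ) (hτ : τ ∈ Icc (0 : ℝ) 1) : 0 + (τ : ℂ) * (b - 0) ∈ slitStrip δ := by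
    rw [zero_add, sub_zero]; exact isStar_slitStrip _ b hbS τ hτ
  set u : ℝ → ℝ → ℂ := fun ε τ => s ε - (0 + τ * (b - 0)) with hu
  have hure (ε τ : ℝ) : (u ε τ).re = (k + 1) * (1 - τ) := by
    simp only [hu, hs, hb]
    simp
    ring
  have huim (ε τ : ℝ) : (u ε τ).im = τ * d - ε := by
    simp only [hu, hs, hb]
    simp
    ring
  have hucont : Continuous fun p : ℝ × ℝ => u p.1 p.2 := by
    simp only [hu, hs]; fun_prop
  have hubox (ε τ : ℝ) (hε : ε ∈ Icc 0 d) (hτ : τ ∈ Icc (0 : ℝ) 1) : u ε τ ∈ box δ (k + 1) := by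
    refine ⟨?_, ?_, ?_⟩
    · change |(u ε τ).im| < δ
      rw [huim, abs_lt]
      constructor <;> nlinarith [hε.1, hε.2, hτ.1, hτ.2]
    · rw [hure]; nlinarith [hτ.2]
    · rw [hure]; push_cast; nlinarith [hτ.1]
  obtain ⟨Cκ, hCκ⟩ := (isCompact_Icc.prod isCompact_Icc).exists_bound_of_continuousOn
    (s := Icc 0 d ×ˢ Icc (0 : ℝ) 1) (f := fun p : ℝ × ℝ => κ (u p.1 p.2))
    (hκ.continuousOn.comp hucont.continuousOn fun p hp => hubox p.1 p.2 hp.1 hp.2)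
  obtain ⟨CY, hCY⟩ := isCompact_Icc.exists_bound_of_continuousOn
    (s := Icc (0 : ℝ) 1) (f := fun τ : ℝ => Y (0 + τ * (b - 0)))
    (hY.comp (by fun_prop) hτb)
  have hCY0 : 0 ≤ CY := (norm_nonneg _).trans (hCY 0 (left_mem_Icc.2 zero_le_one))
  have hCκ0 : 0 ≤ Cκ := (norm_nonneg _).trans
    (hCκ (0, 0) ⟨left_mem_Icc.2 hd0.le, left_mem_Icc.2 zero_le_one⟩)
  -- The linear form `d Re + (k + 1) Im` is constant in `τ` along the path, with value `d (k - n) -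
  -- (k + 1) ε` relative to the pole. It bounds the distance to the pole below by a multiple of `ε`,
  -- so that `ε` times the integrand is dominated by a constant.
  have hlow (ε τ : ℝ) (hε : 0 < ε) (hεd : 2 * (k + 1) * ε ≤ d) (n : ℕ)
      (hn : n ∈ Finset.range (k + 1)) :
      (k + 1) * ε ≤ (d + (k + 1)) * ‖u ε τ - (n + 1)‖ := by
    have hn' : n ≤ k := Nat.lt_succ_iff.1 (Finset.mem_range.1 hn)
    have h2 : (k + 1) * ε ≤ |d * (k - n) - (k + 1) * ε| := by
      rcases hn'.eq_or_lt with rfl | ha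
      · rw [sub_self, mul_zero, zero_sub, abs_neg]
        exact le_abs_self _
      · have ha' : (1 : ℝ) ≤ k - n := by
          have : (n : ℝ) + 1 ≤ k := by exact_mod_cast ha
          linarith
        refine le_trans ?_ (le_abs_self _)
        nlinarith
    have h3 : d * (k - n) - (k + 1) * ε =
        d * (u ε τ - (n + 1)).re + (k + 1) * (u ε τ - (n + 1)).im := by
      simp only [Complex.sub_re, Complex.sub_im, Complex.add_re, Complex.add_im,
        Complex.natCast_re, Complex.natCast_im, Complex.one_re, Complex.one_im, hure, huim]
      ring
    calc (k + 1) * ε ≤ |d * (k - n) - (k + 1) * ε| := h2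
      _ ≤ d * |(u ε τ - (n + 1)).re| + (k + 1) * |(u ε τ - (n + 1)).im| := by
        rw [h3]
        refine (abs_add_le _ _).trans (le_of_eq ?_)
        rw [abs_mul, abs_mul, abs_of_pos hd0, abs_of_pos hk1]
      _ ≤ d * ‖u ε τ - (n + 1)‖ + (k + 1) * ‖u ε τ - (n + 1)‖ := by
        gcongr
        · exact Complex.abs_re_le_norm _
        · exact Complex.abs_im_le_norm _
      _ = _ := by ring
  set F : ℝ → ℝ → ℂ := fun ε τ => (ε : ℂ) * ((κ (u ε τ) +
    R * ∑ n ∈ Finset.range (k + 1), (u ε τ - (n + 1))⁻¹) * Y (0 + τ * (b - 0))) with hF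
  set L : ℝ := (d + (k + 1)) / (k + 1) with hL
  have hsmall : ∀ᶠ ε : ℝ in 𝓝[>] 0, 0 < ε ∧ 2 * (k + 1) * ε ≤ d ∧ ε ≤ d := by
    have h1 : Ioo (0 : ℝ) (d / (2 * (k + 1))) ∈ 𝓝[>] (0 : ℝ) := Ioo_mem_nhdsGT (by positivity)
    filter_upwards [h1] with ε hε
    have h2 : 2 * ((k : ℝ) + 1) * ε ≤ d := by
      have := (lt_div_iff₀ (by positivity)).1 hε.2
      linarith
    have : (0 : ℝ) ≤ k := Nat.cast_nonneg k
    exact ⟨hε.1, h2, by nlinarith [hε.1]⟩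
  have hne (ε τ : ℝ) (hε : 0 < ε) (hεd : 2 * (k + 1) * ε ≤ d) (n : ℕ)
      (hn : n ∈ Finset.range (k + 1)) : u ε τ - (n + 1) ≠ 0 := by
    intro h
    have := hlow ε τ hε hεd n hn
    rw [h, norm_zero, mul_zero] at this
    nlinarith
  have hlim : Tendsto (fun ε => ∫ τ in (0 : ℝ)..1, F ε τ) (𝓝[>] 0)
      (𝓝 (∫ _ in (0 : ℝ)..1, (0 : ℂ))) := by
    refine intervalIntegral.tendsto_integral_filter_of_dominated_convergence
      (fun _ => (d * Cκ + ‖R‖ * ((k + 1) * L)) * CY) ?_ ?_ (by simp) ?_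
    · filter_upwards [hsmall] with ε hε
      rw [uIoc_of_le zero_le_one]
      have hcε : Continuous (u ε) := hucont.comp (by fun_prop : Continuous fun τ : ℝ => (ε, τ))
      refine ContinuousOn.aestronglyMeasurable (ContinuousOn.mono (s := Icc 0 1) ?_
        Ioc_subset_Icc_self) measurableSet_Ioc
      refine continuousOn_const.mul (ContinuousOn.mul (ContinuousOn.add ?_
        (continuousOn_const.mul (continuousOn_finsetSum _ fun n hn => ?_))) ?_)
      · exact hκ.continuousOn.comp hcε.continuousOn fun τ hτ => hubox ε τ ⟨hε.1.le, hε.2.2⟩ hτ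
      · exact ContinuousOn.inv₀ (by fun_prop) fun τ _ => hne ε τ hε.1 hε.2.1 n hn
      · exact hY.comp (by fun_prop) hτb
    · filter_upwards [hsmall] with ε hε
      refine Eventually.of_forall fun τ hτ => ?_
      rw [uIoc_of_le zero_le_one] at hτ
      have hτ' := Ioc_subset_Icc_self hτ
      simp only [hF]
      rw [← mul_assoc, norm_mul, mul_add]
      refine mul_le_mul ?_ (hCY τ hτ') (norm_nonneg _) (by positivity)
      refine (norm_add_le _ _).trans (add_le_add ?_ ?_)
      · rw [norm_mul, Complex.norm_real, Real.norm_of_nonneg hε.1.le]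
        exact mul_le_mul hε.2.2 (hCκ (ε, τ) ⟨⟨hε.1.le, hε.2.2⟩, hτ'⟩) (norm_nonneg _) hd0.le
      · rw [mul_left_comm, norm_mul, Finset.mul_sum]
        refine mul_le_mul_of_nonneg_left ?_ (norm_nonneg _)
        refine (norm_sum_le_of_le (f := fun n : ℕ => (ε : ℂ) * (u ε τ - (n + 1))⁻¹)
          (n := fun _ => L) _ fun n hn => ?_).trans ?_
        · rw [norm_mul, norm_inv, Complex.norm_real, Real.norm_of_nonneg hε.1.le,
            ← div_eq_mul_inv, div_le_iff₀ (norm_pos_iff.2 (hne ε τ hε.1 hε.2.1 n hn)), hL,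
            div_mul_eq_mul_div, le_div_iff₀ hk1, mul_comm]
          exact hlow ε τ hε.1 hε.2.1 n hn
        · rw [Finset.sum_const, Finset.card_range, nsmul_eq_mul]
          push_cast
          exact le_rfl
    · refine Eventually.of_forall fun τ hτ => ?_
      rw [uIoc_of_le zero_le_one] at hτ
      have hcτ : Continuous fun ε : ℝ => u ε τ :=
        hucont.comp (by fun_prop : Continuous fun ε : ℝ => (ε, τ))
      have h1 : ContinuousAt (fun ε : ℝ => F ε τ) 0 := by
        refine ContinuousAt.mul (by fun_prop) (ContinuousAt.mul (ContinuousAt.add ?_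
          (continuousAt_const.mul (tendsto_finsetSum _ fun n hn => ?_))) continuousAt_const)
        · exact ContinuousAt.comp (g := κ) (hκ.differentiableAt ((isOpen_box δ (k + 1)).mem_nhds
            (hubox 0 τ (left_mem_Icc.2 hd0.le) (Ioc_subset_Icc_self hτ)))).continuousAt
            hcτ.continuousAt
        · refine ContinuousAt.inv₀ (by fun_prop) fun h => ?_
          have h2 := congrArg Complex.im h
          simp only [Complex.sub_im, Complex.add_im, Complex.natCast_im, Complex.one_im, huim,
            Complex.zero_im] at h2
          have := mul_pos hτ.1 hd0
          linarith
      have h2 : F 0 τ = 0 := by simp [hF]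
      rw [← h2]
      exact h1.tendsto.mono_left nhdsWithin_le_nhds
  have h3 := hlim.const_mul (b - 0)
  rw [intervalIntegral.integral_zero, mul_zero] at h3
  refine h3.congr fun ε => ?_
  unfold lineInt
  simp only [hF]
  rw [intervalIntegral.integral_const_mul]
  ring

/-- The residues of the convolution exponential below its poles are positive multiples of
`1 / (2 π i)`. -/
theorem tendsto_convExp_below_pole (hδ : 0 < δ) (hN : 0 < N) {κ : ℕ → ℂ → ℂ}
    (hf : DifferentiableOn ℂ f (slitStrip δ)) (hκ : ∀ m, DifferentiableOn ℂ (κ m) (box δ m))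
    (hfκ : ∀ m, ∀ z ∈ slitBox δ m, z * f z = κ m z +
      N / (2 * Real.pi * Complex.I) * ∑ n ∈ Finset.range m, (z - (n + 1))⁻¹) (k : ℕ) :
    ∃ c : ℝ, 0 < c ∧ Tendsto (fun ε : ℝ => (2 * Real.pi * ε : ℂ) *
      convExp f ((k + 1 : ℝ) - (ε : ℝ) * Complex.I)) (𝓝[>] 0) (𝓝 (c : ℂ)) := by
  induction k using Nat.strong_induction_on with
  | _ k ih =>
  -- The limits are made into a total function of `j`, with junk value `0` for `j ≥ k`, which is
  -- never used.
  have ih' : ∀ j, ∃ c : ℝ, j < k → 0 < c ∧ Tendsto (fun ε : ℝ => (2 * Real.pi * ε : ℂ) *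
      convExp f ((j + 1 : ℝ) - (ε : ℝ) * Complex.I)) (𝓝[>] 0) (𝓝 (c : ℂ)) := by
    intro j
    by_cases hj : j < k
    · obtain ⟨c, hc⟩ := ih j hj
      exact ⟨c, fun _ => hc⟩
    · exact ⟨0, fun h => absurd h hj⟩
  choose c hc using ih'
  set Y := convExp f with hYdef
  have hY : DifferentiableOn ℂ Y (slitStrip δ) :=
    convExp_differentiableOn (isOpen_slitStrip δ) (isStar_slitStrip δ) hf
  set R : ℂ := N / (2 * Real.pi * Complex.I) with hR
  have hpi : (Real.pi : ℂ) ≠ 0 := by exact_mod_cast Real.pi_ne_zero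
  have hRN : R * (2 * Real.pi * Complex.I) = N := by
    rw [hR]; field_simp [Complex.I_ne_zero]
  have hk0 : (0 : ℝ) ≤ k := Nat.cast_nonneg k
  have himag (v : ℝ) (hv : |v| < δ) : (v : ℂ) * Complex.I ∈ slitBox δ (k + 1) := by
    refine ⟨⟨by simpa using hv, Or.inr (by simp)⟩, by simp, ?_⟩
    simp only [Complex.re_ofReal_mul, Complex.I_re, mul_zero]
    positivity
  -- On the last leg `s - t` is purely imaginary, so only a bound for `f` on a segment of the
  -- imaginary axis is needed there.
  obtain ⟨C, hC⟩ := isCompact_Icc.exists_bound_of_continuousOn (s := Icc (0 : ℝ) (δ / 2))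
    (f := fun v : ℝ => f (v * Complex.I)) (hf.continuousOn.comp (by fun_prop) fun v hv =>
      (himag v (by rw [abs_of_nonneg hv.1]; linarith [hv.2])).1)
  have hC0 : 0 ≤ C := (norm_nonneg _).trans (hC 0 (left_mem_Icc.2 (by positivity)))
  -- `C d² ≤ 1/2` lets the contribution of the last leg be absorbed into the left-hand side of the a
  -- priori estimate.
  obtain ⟨d, hd0, hdδ, hdC⟩ : ∃ d > 0, d < δ / 2 ∧ C * d * d ≤ 1 / 2 := by
    refine ⟨min (min (δ / 4) 1) (1 / (2 * (C + 1))), by positivity, ?_, ?_⟩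
    · linarith [(min_le_left (min (δ / 4) 1) (1 / (2 * (C + 1)))).trans (min_le_left _ _)]
    · have h1 := (min_le_left (min (δ / 4) 1) (1 / (2 * (C + 1)))).trans (min_le_right _ _)
      have h2 := min_le_right (min (δ / 4) 1) (1 / (2 * (C + 1)))
      have h0 : 0 < min (min (δ / 4) 1) (1 / (2 * (C + 1))) := by positivity
      set d := min (min (δ / 4) 1) (1 / (2 * (C + 1)))
      rw [le_div_iff₀ (by positivity)] at h2
      have h3 : C * d ≤ 1 / 2 := by nlinarith
      have h4 : 0 ≤ C * d := by positivity
      nlinarith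
  set b : ℂ := (k + 1 : ℝ) - (d : ℝ) * Complex.I with hb
  set s : ℝ → ℂ := fun ε => (k + 1 : ℝ) - (ε : ℝ) * Complex.I with hs
  have hsre (ε : ℝ) : (s ε).re = k + 1 := by simp [hs]
  have hsim (ε : ℝ) : (s ε).im = -ε := by simp [hs]
  have hsbox (ε : ℝ) (h0 : 0 < ε) (h1 : ε < δ) : s ε ∈ slitBox δ (k + 1) := by
    refine ⟨⟨?_, Or.inl ?_⟩, ?_, ?_⟩
    · rw [hsim, abs_neg, abs_of_pos h0]; exact h1
    · rw [hsim]; linarith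
    · rw [hsre]; linarith
    · rw [hsre]; push_cast; linarith
  have hscont : Continuous s := by simp only [hs]; fun_prop
  set K : ℝ → ℂ → ℂ := fun ε t => (κ (k + 1) (s ε - t) +
    R * ∑ n ∈ Finset.range (k + 1), (s ε - t - (n + 1))⁻¹) * Y t with hK
  have hG1 := tendsto_mul_lineInt_zero (R := R) (hκ (k + 1)) hY.continuousOn hd0 (by linarith)
    (fun ε => rfl : ∀ ε, s ε = _) hb
  change Tendsto (fun ε : ℝ => (ε : ℂ) * lineInt (K ε) 0 b) _ _ at hG1
  -- the last leg of the path
  have hG2 (ε B : ℝ) (hε : 0 < ε) (hεd : ε ≤ d) (hB : ∀ y ∈ Icc ε d, y * ‖Y (s y)‖ ≤ B) :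
      ‖lineInt (K ε) b (s ε)‖ ≤ d * (C * B) := by
    have hB0 : 0 ≤ B := le_trans (by positivity) (hB d (right_mem_Icc.2 hεd))
    have hsb : s ε - b = ((d - ε : ℝ) : ℂ) * Complex.I := by
      simp only [hs, hb]; push_cast; ring
    have hnorm : ‖s ε - b‖ = d - ε := by
      rw [hsb, norm_mul, Complex.norm_I, mul_one, Complex.norm_real,
        Real.norm_of_nonneg (by linarith)]
    unfold lineInt
    rw [norm_mul, hnorm]
    refine mul_le_mul (by linarith) ?_ (norm_nonneg _) hd0.le
    have := intervalIntegral.norm_integral_le_of_norm_le_const (a := (0 : ℝ)) (b := 1) (C := C * B)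
      (f := fun τ : ℝ => K ε (b + τ * (s ε - b))) fun τ hτ => ?_
    · simpa using this
    · rw [uIoc_of_le zero_le_one] at hτ
      set y : ℝ := d - τ * (d - ε) with hy
      have hyε : ε ≤ y := by nlinarith [hτ.2]
      have hyd : y ≤ d := by nlinarith [hτ.1]
      have h1 : b + τ * (s ε - b) = s y := by
        rw [hsb]; simp only [hs, hb, hy]; push_cast; ring
      have h2 : s ε - s y = ((y - ε : ℝ) : ℂ) * Complex.I := by
        simp only [hs]; push_cast; ring
      have habs : |y - ε| < δ := by rw [abs_of_nonneg (by linarith)]; linarith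
      simp only [hK]
      rw [h1, h2, ← hfκ (k + 1) _ (himag _ habs), norm_mul, norm_mul, norm_mul, Complex.norm_I,
        mul_one, Complex.norm_real, Real.norm_of_nonneg (by linarith)]
      have h3 := hC (y - ε) ⟨by linarith, by linarith⟩
      calc (y - ε) * ‖f (((y - ε : ℝ) : ℂ) * Complex.I)‖ * ‖Y (s y)‖
          ≤ y * C * ‖Y (s y)‖ := by
            have : 0 ≤ y := by linarith
            gcongr
            linarith
        _ = C * (y * ‖Y (s y)‖) := by ring
        _ ≤ C * B := by gcongr; exact hB y ⟨hyε, hyd⟩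
  have hmain (ε : ℝ) (hε : 0 < ε) (hεd : (k + 1) * ε < d) :
      s ε * Y (s ε) = s ε * f (s ε) + N * ∑ n ∈ Finset.range k, Y (s ε - (n + 1)) +
        (lineInt (K ε) 0 b + lineInt (K ε) b (s ε)) := by
    have := mul_convExp_below_pole hδ hf (hκ (k + 1)) (hfκ (k + 1)) hdδ hε hεd
      (s := s ε) (b := b) rfl rfl
    rw [hRN] at this
    exact this
  have hid : Tendsto (fun ε : ℝ => (ε : ℂ)) (𝓝[>] 0) (𝓝 0) := by
    have := (Complex.continuous_ofReal.tendsto 0).mono_left (nhdsWithin_le_nhds (s := Ioi 0))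
    simpa using this
  -- The limit of `2πε s Y(s)`: `N` comes from the pole of `z f` itself, and `N c` from each earlier
  -- pole passed by the deformed path.
  set Λ : ℝ := N + N * ∑ n ∈ Finset.range k, c (k - 1 - n) with hΛ
  have hsf : Tendsto (fun ε : ℝ => (2 * Real.pi * ε : ℂ) * (s ε * f (s ε))) (𝓝[>] 0) (𝓝 (N : ℂ)) := by
    have hκc : Tendsto (fun ε : ℝ => κ (k + 1) (s ε)) (𝓝[>] 0) (𝓝 (κ (k + 1) (s 0))) := by
      have h0 : s 0 ∈ box δ (k + 1) := by
        refine ⟨?_, ?_, ?_⟩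
        · change |(s 0).im| < δ; rw [hsim]; simpa using hδ
        · rw [hsre]; linarith
        · rw [hsre]; push_cast; linarith
      have h1 : ContinuousAt (fun ε : ℝ => κ (k + 1) (s ε)) 0 :=
        ContinuousAt.comp (g := κ (k + 1)) ((hκ (k + 1)).differentiableAt
          ((isOpen_box δ (k + 1)).mem_nhds h0)).continuousAt hscont.continuousAt
      exact h1.tendsto.mono_left nhdsWithin_le_nhds
    have hn (n : ℕ) (hn : n ∈ Finset.range k) :
        Tendsto (fun ε : ℝ => (ε : ℂ) * (s ε - (n + 1))⁻¹) (𝓝[>] 0) (𝓝 0) := by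
      have h1 : ContinuousAt (fun ε : ℝ => (s ε - (n + 1))⁻¹) 0 := by
        refine ContinuousAt.inv₀ (by fun_prop) fun h => ?_
        have h2 := congrArg Complex.re h
        simp only [Complex.sub_re, Complex.add_re, Complex.natCast_re, Complex.one_re, hsre,
          Complex.zero_re] at h2
        have : (n : ℝ) < k := by exact_mod_cast Finset.mem_range.1 hn
        linarith
      simpa using hid.mul (h1.tendsto.mono_left nhdsWithin_le_nhds)
    have h2 : Tendsto (fun ε : ℝ => (2 * Real.pi : ℂ) * ((ε : ℂ) * κ (k + 1) (s ε) +
        R * (∑ n ∈ Finset.range k, (ε : ℂ) * (s ε - (n + 1))⁻¹ + Complex.I))) (𝓝[>] 0)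
        (𝓝 ((2 * Real.pi : ℂ) * (0 * κ (k + 1) (s 0) + R * (∑ n ∈ Finset.range k, 0 +
          Complex.I)))) :=
      ((hid.mul hκc).add (((tendsto_finsetSum _ hn).add_const _).const_mul R)).const_mul _
    have h3 : (2 * Real.pi : ℂ) * (0 * κ (k + 1) (s 0) + R * (∑ n ∈ Finset.range k, 0 +
          Complex.I)) = N := by
      rw [← hRN]; simp; ring
    rw [h3] at h2
    refine h2.congr' ?_
    filter_upwards [Ioo_mem_nhdsGT hδ] with ε hε
    rw [hfκ (k + 1) _ (hsbox ε hε.1 hε.2), Finset.sum_range_succ]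
    have h4 : s ε - (k + 1) = -(ε * Complex.I) := by simp only [hs]; push_cast; ring
    have h5 : (ε : ℂ) ≠ 0 := by exact_mod_cast hε.1.ne'
    have h6 : (ε : ℂ) * (-(ε * Complex.I))⁻¹ = Complex.I := by
      rw [inv_neg, mul_inv, Complex.inv_I]; field_simp
    rw [h4, ← Finset.mul_sum]
    linear_combination -(2 * Real.pi * R) * h6
  have hshift : Tendsto (fun ε : ℝ => (2 * Real.pi * ε : ℂ) *
      (N * ∑ n ∈ Finset.range k, Y (s ε - (n + 1)))) (𝓝[>] 0)
      (𝓝 ((N : ℂ) * ∑ n ∈ Finset.range k, (c (k - 1 - n) : ℂ))) := by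
    have h1 : Tendsto (fun ε : ℝ => (N : ℂ) * ∑ n ∈ Finset.range k, (2 * Real.pi * ε : ℂ) *
        Y (s ε - (n + 1))) (𝓝[>] 0) (𝓝 ((N : ℂ) * ∑ n ∈ Finset.range k, (c (k - 1 - n) : ℂ))) := by
      refine (tendsto_finsetSum _ fun n hn => ?_).const_mul _
      have hn' := Finset.mem_range.1 hn
      refine (hc (k - 1 - n) (by omega)).2.congr fun ε => ?_
      congr 2
      have h2 : ((k - 1 - n : ℕ) : ℝ) = k - 1 - n := by
        rw [Nat.cast_sub (by omega), Nat.cast_sub (by omega)]; simp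
      simp only [hs]
      rw [h2]
      push_cast; ring
    refine h1.congr fun ε => ?_
    rw [← Finset.mul_sum]; ring
  set H : ℝ → ℂ := fun ε => (2 * Real.pi * ε : ℂ) * (s ε * f (s ε)) +
    (2 * Real.pi * ε : ℂ) * (N * ∑ n ∈ Finset.range k, Y (s ε - (n + 1))) +
    2 * Real.pi * ((ε : ℂ) * lineInt (K ε) 0 b) with hH
  have hHlim : Tendsto H (𝓝[>] 0) (𝓝 (Λ : ℂ)) := by
    have := (hsf.add hshift).add (hG1.const_mul (2 * Real.pi : ℂ))
    convert this using 2
    rw [hΛ]; push_cast; ring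
  have hHeq (ε : ℝ) (hε : 0 < ε) (hεd : (k + 1) * ε < d) :
      (2 * Real.pi * ε : ℂ) * (s ε * Y (s ε)) = H ε +
        2 * Real.pi * ((ε : ℂ) * lineInt (K ε) b (s ε)) := by
    rw [hmain ε hε hεd]; simp only [hH]; ring
  -- an a priori bound
  obtain ⟨B, hB⟩ : ∃ B, ∀ y ∈ Ioc 0 d, y * ‖Y (s y)‖ ≤ B := by
    have hev : ∀ᶠ ε in 𝓝[>] (0 : ℝ), ‖H ε‖ ≤ |Λ| + 1 ∧ (k + 1) * ε < d := by
      have h1 : ∀ᶠ ε in 𝓝[>] (0 : ℝ), ‖H ε‖ < |Λ| + 1 :=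
        hHlim.norm.eventually_lt_const (by rw [Complex.norm_real, Real.norm_eq_abs]; linarith)
      have h2 : Ioo (0 : ℝ) (d / (k + 1)) ∈ 𝓝[>] (0 : ℝ) := Ioo_mem_nhdsGT (by positivity)
      filter_upwards [h1, h2] with ε h3 h4
      refine ⟨h3.le, ?_⟩
      have := (lt_div_iff₀ (by positivity)).1 h4.2
      linarith
    obtain ⟨ε₀, hε₀, hev⟩ := mem_nhdsGT_iff_exists_Ioo_subset.1 hev
    have hε₀ : 0 < ε₀ := hε₀
    have hVc (a : ℝ) (ha : 0 < a) : ContinuousOn (fun y : ℝ => y * ‖Y (s y)‖) (Icc a d) := by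
      refine continuousOn_id.mul (ContinuousOn.norm (hY.continuousOn.comp hscont.continuousOn
        fun y hy => (hsbox y (ha.trans_le hy.1) (by linarith [hy.2])).1))
    obtain ⟨B₁, hB₁⟩ := isCompact_Icc.exists_bound_of_continuousOn (hVc ε₀ hε₀)
    refine ⟨max B₁ (2 * (|Λ| + 1)), fun y hy => ?_⟩
    -- At the maximum `V` of `y ‖Y(s y)‖` the last leg contributes at most `π V`, while the
    -- left-hand side is at least `2π V` because `‖s z‖ ≥ 1`. So `V` is bounded independently of the
    -- left end of the interval.
    obtain ⟨z, hz, hmax⟩ := isCompact_Icc.exists_isMaxOn (nonempty_Icc.2 hy.2) (hVc y hy.1)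
    refine (hmax (left_mem_Icc.2 hy.2)).trans ?_
    rcases le_or_gt ε₀ z with h | h
    · exact ((le_abs_self _).trans (hB₁ z ⟨h, hz.2⟩)).trans (le_max_left _ _)
    · refine le_trans ?_ (le_max_right _ _)
      have hz0 : 0 < z := hy.1.trans_le hz.1
      obtain ⟨h1, h2⟩ := hev ⟨hz0, h⟩
      set V := z * ‖Y (s z)‖ with hV
      have hV0 : 0 ≤ V := by positivity
      have h3 := hG2 z V hz0 hz.2 fun w hw => hmax ⟨hz.1.trans hw.1, hw.2⟩
      have h4 := congrArg norm (hHeq z hz0 h2)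
      have h5 : ‖(2 * Real.pi * z : ℂ) * (s z * Y (s z))‖ = 2 * Real.pi * ‖s z‖ * V := by
        rw [norm_mul, norm_mul, norm_mul, norm_mul, Complex.norm_real, Complex.norm_real,
          Real.norm_of_nonneg hz0.le, Real.norm_of_nonneg Real.pi_pos.le, hV]
        simp only [Complex.norm_ofNat]; ring
      have h6 : ‖H z + 2 * Real.pi * ((z : ℂ) * lineInt (K z) b (s z))‖ ≤
          (|Λ| + 1) + 2 * Real.pi * (d * (d * (C * V))) := by
        refine (norm_add_le _ _).trans (add_le_add h1 ?_)
        rw [norm_mul, norm_mul, norm_mul, Complex.norm_real, Complex.norm_real,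
          Real.norm_of_nonneg hz0.le, Real.norm_of_nonneg Real.pi_pos.le, Complex.norm_ofNat]
        have := hz.2
        have := Real.pi_pos
        gcongr
      have h7 : 1 ≤ ‖s z‖ := by
        refine le_trans ?_ (Complex.abs_re_le_norm _)
        rw [hsre, abs_of_pos (by positivity)]; linarith
      have h8 : 2 * Real.pi * V ≤ 2 * Real.pi * ‖s z‖ * V := by
        have := Real.pi_pos
        have : 2 * Real.pi * 1 * V ≤ 2 * Real.pi * ‖s z‖ * V := by gcongr
        linarith
      have h9 : 2 * Real.pi * (d * (d * (C * V))) ≤ 2 * Real.pi * (V / 2) := by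
        have := Real.pi_pos
        gcongr
        nlinarith
      have h10 : Real.pi * V ≤ |Λ| + 1 := by linarith [h5 ▸ h4]
      nlinarith [Real.pi_gt_three, abs_nonneg Λ]
  have hG2lim : Tendsto (fun ε : ℝ => (2 * Real.pi : ℂ) * ((ε : ℂ) * lineInt (K ε) b (s ε)))
      (𝓝[>] 0) (𝓝 0) := by
    have h1 : Tendsto (fun ε : ℝ => (ε : ℂ) * lineInt (K ε) b (s ε)) (𝓝[>] 0) (𝓝 0) := by
      refine squeeze_zero_norm' (a := fun ε : ℝ => ε * (d * (C * B))) ?_ ?_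
      · filter_upwards [Ioo_mem_nhdsGT hd0] with ε hε
        rw [norm_mul, Complex.norm_real, Real.norm_of_nonneg hε.1.le]
        exact mul_le_mul_of_nonneg_left (hG2 ε B hε.1 hε.2.le fun y hy =>
          hB y ⟨hε.1.trans_le hy.1, hy.2⟩) hε.1.le
      · have h2 : Tendsto (fun ε : ℝ => ε * (d * (C * B))) (𝓝 0) (𝓝 (0 * (d * (C * B)))) :=
          tendsto_id.mul_const _
        rw [zero_mul] at h2
        exact h2.mono_left nhdsWithin_le_nhds
    simpa using h1.const_mul (2 * Real.pi : ℂ)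
  have hfin : Tendsto (fun ε : ℝ => (2 * Real.pi * ε : ℂ) * (s ε * Y (s ε))) (𝓝[>] 0)
      (𝓝 (Λ : ℂ)) := by
    have h1 := hHlim.add hG2lim
    rw [add_zero] at h1
    refine h1.congr' ?_
    have h2 : Ioo (0 : ℝ) (d / (k + 1)) ∈ 𝓝[>] (0 : ℝ) := Ioo_mem_nhdsGT (by positivity)
    filter_upwards [h2] with ε hε
    have := (lt_div_iff₀ (by positivity)).1 hε.2
    exact (hHeq ε hε.1 (by linarith)).symm
  refine ⟨Λ / (k + 1), ?_, ?_⟩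
  · refine div_pos (add_pos_of_pos_of_nonneg hN (mul_nonneg hN.le ?_)) (by positivity)
    refine Finset.sum_nonneg fun n hn => ?_
    have hn' := Finset.mem_range.1 hn
    exact (hc (k - 1 - n) (by omega)).1.le
  · have hs0 : s 0 = ((k : ℝ) : ℂ) + 1 := by simp [hs]
    have hs1 : Tendsto s (𝓝[>] 0) (𝓝 (((k : ℝ) : ℂ) + 1)) := by
      rw [← hs0]; exact (hscont.tendsto 0).mono_left nhdsWithin_le_nhds
    have hne : ((k : ℝ) : ℂ) + 1 ≠ 0 := by
      have : (k : ℝ) + 1 ≠ 0 := by positivity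
      exact_mod_cast this
    have h1 := hfin.div hs1 hne
    push_cast at h1 ⊢
    refine h1.congr fun ε => ?_
    have hsne : s ε ≠ 0 := fun h => by
      have := hsre ε
      rw [h, Complex.zero_re] at this
      linarith
    have h2 : ((k : ℂ) + 1 - ε * Complex.I) = s ε := by simp only [hs]; push_cast; ring
    rw [h2, Pi.div_apply, div_eq_iff hsne]
    ring

end

/-! ### Partial fractions of the cotangent -/

/-- The tail `∑_{n ≥ m} 1 / ((n + 1)² - z²)` of the partial fractions of the cotangent. -/
noncomputable def qTail (m : ℕ) (z : ℂ) : ℂ := ∑' n : ℕ, (((n + m + 1 : ℕ) : ℂ) ^ 2 - z ^ 2)⁻¹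

/-- The plane cut along the real half-lines from `±(m + 1)` outwards. -/
def slitPlaneFrom (m : ℕ) : Set ℂ := {z | z.im ≠ 0 ∨ |z.re| < m + 1}

theorem isOpen_slitPlaneFrom (m : ℕ) : IsOpen (slitPlaneFrom m) :=
  (isOpen_ne_fun Complex.continuous_im continuous_const).union
    (isOpen_lt (continuous_abs.comp Complex.continuous_re) continuous_const)

theorem isStar_slitPlaneFrom (m : ℕ) : IsStar (slitPlaneFrom m) := by
  intro z hz τ hτ
  change ((τ : ℂ) * z).im ≠ 0 ∨ |((τ : ℂ) * z).re| < m + 1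
  rw [Complex.im_ofReal_mul, Complex.re_ofReal_mul]
  rcases hz with h | h
  · rcases eq_or_ne τ 0 with rfl | h0
    · right; simp; positivity
    · left; exact mul_ne_zero h0 h
  · right; exact abs_mul_lt hτ h

theorem norm_qTail_term_le (m n : ℕ) {z : ℂ} (hz : ‖z‖ ≤ (m + 1) / 2) :
    ‖(((n + m + 1 : ℕ) : ℂ) ^ 2 - z ^ 2)⁻¹‖ ≤ 2 * (((n + m + 1 : ℕ) : ℝ) ^ 2)⁻¹ := by
  set a : ℝ := ((n + m + 1 : ℕ) : ℝ) with ha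
  have ha0 : 0 < a := by positivity
  have hza : ‖z‖ ≤ a / 2 := hz.trans (by
    rw [ha]; push_cast; linarith [(Nat.cast_nonneg n : (0 : ℝ) ≤ n)])
  have h1 : a ^ 2 / 2 ≤ ‖((n + m + 1 : ℕ) : ℂ) ^ 2 - z ^ 2‖ := by
    have h2 := norm_sub_norm_le (((n + m + 1 : ℕ) : ℂ) ^ 2) (z ^ 2)
    rw [norm_pow, norm_pow, Complex.norm_natCast] at h2
    nlinarith [norm_nonneg z]
  rw [norm_inv]
  calc _ ≤ (a ^ 2 / 2)⁻¹ := inv_anti₀ (by positivity) h1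
    _ = 2 * (a ^ 2)⁻¹ := by rw [inv_div]; ring

theorem summable_qTail_bound (m : ℕ) :
    Summable fun n : ℕ => 2 * (((n + m + 1 : ℕ) : ℝ) ^ 2)⁻¹ :=
  ((summable_nat_add_iff (m + 1)).2
    (Real.summable_nat_pow_inv.2 (le_refl 2))).mul_left 2

theorem exists_nat_norm_lt (z : ℂ) : ∃ k : ℕ, ∀ m : ℕ, ‖z‖ < ((m + k : ℕ) + 1) / 2 := by
  obtain ⟨k, hk⟩ := exists_nat_gt (2 * ‖z‖)
  refine ⟨k, fun m => ?_⟩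
  push_cast
  linarith [(Nat.cast_nonneg m : (0 : ℝ) ≤ m)]

theorem qTail_term_add (m k n : ℕ) (z : ℂ) :
    (((n + k + m + 1 : ℕ) : ℂ) ^ 2 - z ^ 2)⁻¹ = (((n + (m + k) + 1 : ℕ) : ℂ) ^ 2 - z ^ 2)⁻¹ := by
  rw [show n + k + m + 1 = n + (m + k) + 1 by omega]

theorem summable_qTail (m : ℕ) (z : ℂ) :
    Summable fun n : ℕ => (((n + m + 1 : ℕ) : ℂ) ^ 2 - z ^ 2)⁻¹ := by
  obtain ⟨k, hk⟩ := exists_nat_norm_lt z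
  rw [← summable_nat_add_iff k]
  simp only [qTail_term_add]
  exact .of_norm_bounded (summable_qTail_bound (m + k))
    fun n => norm_qTail_term_le (m + k) n (hk m).le

theorem qTail_eq_sum_add (m k : ℕ) (z : ℂ) :
    qTail m z = ∑ n ∈ Finset.range k, (((n + m + 1 : ℕ) : ℂ) ^ 2 - z ^ 2)⁻¹ + qTail (m + k) z := by
  unfold qTail
  rw [← (summable_qTail m z).sum_add_tsum_nat_add k]
  simp only [qTail_term_add]

theorem natCast_sq_sub_sq_ne_zero {m : ℕ} {z : ℂ} (hz : z ∈ slitPlaneFrom m) (n : ℕ) :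
    ((n + m + 1 : ℕ) : ℂ) ^ 2 - z ^ 2 ≠ 0 := by
  intro h
  have h1 : ((n + m + 1 : ℕ) : ℂ) = z ∨ ((n + m + 1 : ℕ) : ℂ) = -z :=
    sq_eq_sq_iff_eq_or_eq_neg.1 (sub_eq_zero.1 h)
  have h2 : z.im = 0 ∧ |z.re| = ((n + m + 1 : ℕ) : ℝ) := by
    rcases h1 with h1 | h1
    · rw [← h1, Complex.natCast_im, Complex.natCast_re, abs_of_nonneg (by positivity)]
      exact ⟨rfl, rfl⟩
    · rw [← neg_eq_iff_eq_neg.2 h1, Complex.neg_im, Complex.neg_re, Complex.natCast_im,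
        Complex.natCast_re, abs_neg, abs_of_nonneg (by positivity)]
      exact ⟨neg_zero, rfl⟩
  rcases hz with h3 | h3
  · exact h3 h2.1
  · rw [h2.2] at h3
    push_cast at h3
    linarith [(Nat.cast_nonneg n : (0 : ℝ) ≤ n)]

/-- Around a given point all but finitely many terms are free of poles on a disc and dominated by a
convergent series; the remaining finite sum is rational. -/
theorem qTail_differentiableOn (m : ℕ) : DifferentiableOn ℂ (qTail m) (slitPlaneFrom m) := by
  intro z hz
  obtain ⟨k, hk⟩ := exists_nat_norm_lt z
  have h1 : DifferentiableOn ℂ (qTail (m + k)) (Metric.ball 0 (((m + k : ℕ) + 1) / 2)) := by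
    refine Complex.differentiableOn_tsum_of_summable_norm (summable_qTail_bound (m + k))
      (fun n => ?_) Metric.isOpen_ball
      fun n w hw => norm_qTail_term_le (m + k) n (mem_ball_zero_iff.1 hw).le
    refine DifferentiableOn.inv (by fun_prop) fun w hw h => ?_
    have h2 := norm_qTail_term_le (m + k) n (mem_ball_zero_iff.1 hw).le
    have h3 : ((n + (m + k) + 1 : ℕ) : ℂ) ^ 2 = w ^ 2 := sub_eq_zero.1 h
    have h4 := congrArg norm h3
    rw [norm_pow, norm_pow, Complex.norm_natCast] at h4
    have h5 := mem_ball_zero_iff.1 hw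
    push_cast at h4 h5
    nlinarith [norm_nonneg w, (Nat.cast_nonneg n : (0 : ℝ) ≤ n), (Nat.cast_nonneg m : (0 : ℝ) ≤ m),
      (Nat.cast_nonneg k : (0 : ℝ) ≤ k)]
  have h6 : DifferentiableAt ℂ (qTail (m + k)) z :=
    h1.differentiableAt (Metric.isOpen_ball.mem_nhds (mem_ball_zero_iff.2 (hk m)))
  rw [show qTail m = fun w => ∑ n ∈ Finset.range k, (((n + m + 1 : ℕ) : ℂ) ^ 2 - w ^ 2)⁻¹ +
    qTail (m + k) w from funext (qTail_eq_sum_add m k)]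
  refine DifferentiableAt.differentiableWithinAt (DifferentiableAt.add
    (DifferentiableAt.fun_sum fun n _ => ?_) h6)
  exact DifferentiableAt.inv (by fun_prop) (natCast_sq_sub_sq_ne_zero hz n)

theorem qTail_neg (m : ℕ) (z : ℂ) : qTail m (-z) = qTail m z := by
  unfold qTail; simp only [neg_sq]

open ComplexConjugate in
theorem qTail_conj (m : ℕ) (z : ℂ) : qTail m (conj z) = conj (qTail m z) := by
  unfold qTail
  rw [Complex.conj_tsum]
  simp only [map_inv₀, map_sub, map_pow, Complex.conj_natCast]

theorem qTail_zero : qTail 0 0 = (Real.pi : ℂ) ^ 2 / 6 := by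
  have h1 := (hasSum_nat_add_iff' 1).2 hasSum_zeta_two
  have h2 := Complex.hasSum_ofReal.2 h1
  unfold qTail
  refine Eq.trans ?_ (h2.tsum_eq.trans (by simp))
  refine tsum_congr fun n => ?_
  push_cast
  simp

/-- The entire function `∫₀¹ (1/2 - x) e^{-zx} dx`. -/
noncomputable def hKernel (z : ℂ) : ℂ :=
  ∫ x in (0 : ℝ)..1, ((1 / 2 - x : ℝ) : ℂ) * Complex.exp (-(z * x))

theorem hKernel_differentiable : Differentiable ℂ hKernel := by
  rw [← differentiableOn_univ]
  refine differentiableOn_integral_param isOpen_univ ?_ fun τ _ => by fun_prop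
  exact Continuous.continuousOn (by fun_prop)

theorem hKernel_zero : hKernel 0 = 0 := by
  unfold hKernel
  simp only [zero_mul, neg_zero, Complex.exp_zero, mul_one]
  rw [intervalIntegral.integral_ofReal, intervalIntegral.integral_sub (by simp) (by simp)]
  simp

theorem hKernel_eq {z : ℂ} (hz : z ≠ 0) :
    hKernel z = (1 + Complex.exp (-z)) / (2 * z) - (1 - Complex.exp (-z)) / z ^ 2 := by
  have h1 : ∀ x ∈ uIcc (0 : ℝ) 1, HasDerivAt
      (fun x : ℝ => Complex.exp (-(z * x)) * (-(1 / 2 - x) / z + 1 / z ^ 2))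
      (((1 / 2 - x : ℝ) : ℂ) * Complex.exp (-(z * x))) x := by
    intro x _
    have h2 : HasDerivAt (fun x : ℂ => Complex.exp (-(z * x)) * (-(1 / 2 - x) / z + 1 / z ^ 2))
        (Complex.exp (-(z * x)) * (-(z * 1)) * (-(1 / 2 - x) / z + 1 / z ^ 2) +
          Complex.exp (-(z * x)) * (-(-1) / z)) (x : ℂ) :=
      (((hasDerivAt_id _).const_mul z).neg.cexp).mul
        ((((hasDerivAt_id _).const_sub (1 / 2)).neg.div_const z).add_const _)
    convert h2.comp_ofReal using 1
    push_cast
    field_simp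
    ring
  have h3 := intervalIntegral.integral_eq_sub_of_hasDerivAt h1
    (Continuous.intervalIntegrable (by fun_prop) _ _)
  unfold hKernel
  rw [h3]
  simp only [Complex.ofReal_one, Complex.ofReal_zero, mul_one, mul_zero, neg_zero,
    Complex.exp_zero]
  field_simp
  ring

/-- The Mittag-Leffler expansion of the cotangent in terms of `hKernel`. -/
theorem one_sub_exp_mul_qTail {z : ℂ} (hz : z ∈ slitPlaneFrom 0) :
    (1 - Complex.exp (-(2 * Real.pi * Complex.I * z))) * qTail 0 z =
      2 * Real.pi ^ 2 * hKernel (2 * Real.pi * Complex.I * z) := by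
  by_cases hz0 : z = 0
  · simp [hz0, hKernel_zero]
  have hpi : (Real.pi : ℂ) ≠ 0 := by exact_mod_cast Real.pi_ne_zero
  have hint : z ∈ Complex.integerComplement := by
    rintro ⟨n, hn⟩
    rcases hz with h | h
    · rw [← hn] at h; simp at h
    · rw [← hn, Complex.intCast_re, Nat.cast_zero, zero_add] at h
      have h1 : |n| < 1 := by exact_mod_cast h
      rw [Int.abs_lt_one_iff] at h1
      rw [h1] at hn
      exact hz0 (by simpa using hn.symm)
  have hcot := cot_series_rep' hint
  have hterm (n : ℕ) : 1 / (z - (n + 1)) + 1 / (z + (n + 1)) =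
      -2 * z * (((n + 0 + 1 : ℕ) : ℂ) ^ 2 - z ^ 2)⁻¹ := by
    have h1 := natCast_sq_sub_sq_ne_zero hz n
    push_cast at h1 ⊢
    rw [add_zero] at h1 ⊢
    have h2 : ((n : ℂ) + 1 - z) * (n + 1 + z) ≠ 0 := by
      rw [show ((n : ℂ) + 1 - z) * (n + 1 + z) = ((n : ℂ) + 1) ^ 2 - z ^ 2 by ring]; exact h1
    have h3 := left_ne_zero_of_mul h2
    have h4 := right_ne_zero_of_mul h2
    have h5 : z - (n + 1) ≠ 0 := by rw [← neg_ne_zero, neg_sub]; exact h3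
    have h6 : z + (n + 1) ≠ 0 := by rw [add_comm]; exact h4
    field_simp
    ring
  rw [tsum_congr hterm, tsum_mul_left] at hcot
  change _ = -2 * z * qTail 0 z at hcot
  have hw0 : 2 * Real.pi * Complex.I * z ≠ 0 := by
    simp [hpi, Complex.I_ne_zero, hz0]
  have hne : 1 - Complex.exp (-(2 * Real.pi * Complex.I * z)) ≠ 0 := by
    intro h
    rw [sub_eq_zero, eq_comm, Complex.exp_eq_one_iff] at h
    obtain ⟨n, hn⟩ := h
    refine hint ⟨-n, ?_⟩
    have : (2 * Real.pi * Complex.I) * (-(n : ℂ)) = (2 * Real.pi * Complex.I) * z := by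
      linear_combination hn
    have h2 := mul_left_cancel₀ (by simp [hpi, Complex.I_ne_zero]) this
    push_cast
    exact h2
  have hcot2 : Complex.cot (Real.pi * z) * (1 - Complex.exp (-(2 * Real.pi * Complex.I * z))) =
      Complex.I * (1 + Complex.exp (-(2 * Real.pi * Complex.I * z))) := by
    have e1 : Complex.exp (2 * Complex.I * (Real.pi * z)) *
        Complex.exp (-(2 * Real.pi * Complex.I * z)) = 1 := by
      rw [← Complex.exp_add, ← Complex.exp_zero]; congr 1; ring
    rw [Complex.cot_eq_exp_ratio]
    set e := Complex.exp (-(2 * Real.pi * Complex.I * z))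
    set e' := Complex.exp (2 * Complex.I * (Real.pi * z))
    have h3 : 1 - e' ≠ 0 := by
      intro h
      have : e' = 1 := (sub_eq_zero.1 h).symm
      rw [this, one_mul] at e1
      exact hne (by rw [e1, sub_self])
    have h4 : Complex.I * (1 - e') ≠ 0 := mul_ne_zero Complex.I_ne_zero h3
    rw [div_mul_eq_mul_div, div_eq_iff h4]
    linear_combination (-2 : ℂ) * e1 - (1 + e) * (1 - e') * Complex.I_sq
  rw [hKernel_eq hw0]
  set e := Complex.exp (-(2 * Real.pi * Complex.I * z))
  have h5 : (2 * Real.pi * Complex.I * z) ^ 2 = -(4 * Real.pi ^ 2 * z ^ 2) := by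
    linear_combination 4 * Real.pi ^ 2 * z ^ 2 * Complex.I_sq
  have h6 : (1 + e) / (2 * (2 * Real.pi * Complex.I * z)) =
      -(Complex.I * (1 + e)) / (4 * Real.pi * z) := by
    rw [div_eq_div_iff (by simp [hpi, Complex.I_ne_zero, hz0]) (by simp [hpi, hz0])]
    linear_combination 4 * Real.pi * z * (1 + e) * Complex.I_sq
  rw [h5, h6, ← hcot2]
  have h7 : qTail 0 z = -(Real.pi * Complex.cot (Real.pi * z) - 1 / z) / (2 * z) := by
    rw [hcot]; field_simp
  rw [h7]
  field_simp
  ring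

/-! ### The kernel and its poles -/

/-- The unit complex number `e^{iθ}`. -/
noncomputable def unitAt (θ : ℝ) : ℂ := Complex.exp (Complex.I * θ)

theorem unitAt_ne_zero (θ : ℝ) : unitAt θ ≠ 0 := Complex.exp_ne_zero _

theorem norm_unitAt (θ : ℝ) : ‖unitAt θ‖ = 1 := by
  rw [unitAt, Complex.norm_exp_I_mul_ofReal]

theorem unitAt_add (θ θ' : ℝ) : unitAt (θ + θ') = unitAt θ * unitAt θ' := by
  unfold unitAt; rw [← Complex.exp_add]; push_cast; ring_nf

theorem unitAt_neg_mul (θ : ℝ) : unitAt (-θ) * unitAt θ = 1 := by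
  rw [← unitAt_add, neg_add_cancel]; simp [unitAt]

open ComplexConjugate in
theorem unitAt_conj (θ : ℝ) : conj (unitAt θ) = unitAt (-θ) := by
  unfold unitAt
  rw [← Complex.exp_conj, map_mul, Complex.conj_I, Complex.conj_ofReal]
  push_cast; ring_nf

theorem unitAt_re (θ : ℝ) : (unitAt θ).re = Real.cos θ := by
  rw [unitAt, mul_comm, Complex.exp_ofReal_mul_I_re]

theorem unitAt_im (θ : ℝ) : (unitAt θ).im = Real.sin θ := by
  rw [unitAt, mul_comm, Complex.exp_ofReal_mul_I_im]

/-- The kernel whose Laplace transform is the logarithm of the partition function, up to the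
contribution of the ground state. -/
noncomputable def kernel (φ : ℝ) (z : ℂ) : ℂ :=
  3 / Real.pi * (Complex.I * unitAt (-φ) * qTail 0 (unitAt (-φ) * z) -
    Complex.I * unitAt φ * qTail 0 (unitAt φ * z))

/-- The plane without the half-lines `s e^{± iφ}`, `|s| ≥ 1`. -/
def kernelDomain (φ : ℝ) : Set ℂ :=
  {z | unitAt φ * z ∈ slitPlaneFrom 0 ∧ unitAt (-φ) * z ∈ slitPlaneFrom 0}

theorem isOpen_kernelDomain (φ : ℝ) : IsOpen (kernelDomain φ) :=
  ((isOpen_slitPlaneFrom 0).preimage (by fun_prop : Continuous fun z => unitAt φ * z)).inter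
    ((isOpen_slitPlaneFrom 0).preimage (by fun_prop : Continuous fun z => unitAt (-φ) * z))

theorem isStar_kernelDomain (φ : ℝ) : IsStar (kernelDomain φ) := by
  intro z hz τ hτ
  constructor
  · have := isStar_slitPlaneFrom 0 _ hz.1 τ hτ
    rwa [mul_left_comm] at this
  · have := isStar_slitPlaneFrom 0 _ hz.2 τ hτ
    rwa [mul_left_comm] at this

theorem kernel_differentiableOn (φ : ℝ) : DifferentiableOn ℂ (kernel φ) (kernelDomain φ) := by
  have h (θ : ℝ) (hθ : MapsTo (fun z => unitAt θ * z) (kernelDomain φ) (slitPlaneFrom 0)) :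
      DifferentiableOn ℂ (fun z => qTail 0 (unitAt θ * z)) (kernelDomain φ) :=
    (qTail_differentiableOn 0).comp (by fun_prop) hθ
  exact ((((h (-φ) fun z hz => hz.2).const_mul _).sub
    ((h φ fun z hz => hz.1).const_mul _)).const_mul _)

open ComplexConjugate in
theorem kernel_conj (φ : ℝ) (z : ℂ) : kernel φ (conj z) = conj (kernel φ z) := by
  have h1 : conj (unitAt (-φ)) = unitAt φ := by rw [unitAt_conj, neg_neg]
  unfold kernel
  simp only [map_mul, map_sub, map_div₀, ← qTail_conj, Complex.conj_I, unitAt_conj, h1,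
    Complex.conj_ofReal, map_ofNat]
  ring

theorem kernel_zero (φ : ℝ) : kernel φ 0 = ((Real.pi * Real.sin φ : ℝ) : ℂ) := by
  have hpi : (Real.pi : ℂ) ≠ 0 := by exact_mod_cast Real.pi_ne_zero
  have h : unitAt (-φ) - unitAt φ = -(2 * Complex.I * (Real.sin φ : ℂ)) := by
    rw [← unitAt_conj]
    apply Complex.ext <;> simp [unitAt_re, unitAt_im, -Complex.ofReal_sin]
    ring
  unfold kernel
  rw [mul_zero, mul_zero, qTail_zero]
  push_cast
  push_cast at h
  field_simp
  linear_combination 3 * Complex.I * h - 6 * Complex.sin φ * Complex.I_sq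

theorem unitAt_mul_mem_slitPlaneFrom {θ : ℝ} (h : Real.sin θ ≠ 0) (x : ℝ) :
    unitAt θ * x ∈ slitPlaneFrom 0 := by
  rcases eq_or_ne x 0 with rfl | hx
  · right; simp
  · left; rw [Complex.im_mul_ofReal, unitAt_im]; exact mul_ne_zero h hx

theorem ofReal_mem_kernelDomain {φ : ℝ} (h : 0 < Real.sin φ) (x : ℝ) :
    (x : ℂ) ∈ kernelDomain φ :=
  ⟨unitAt_mul_mem_slitPlaneFrom h.ne' x,
    unitAt_mul_mem_slitPlaneFrom (by rw [Real.sin_neg]; exact (neg_neg_of_pos h).ne) x⟩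

theorem kernel_im (φ x : ℝ) : (kernel φ x).im = 0 := by
  have := kernel_conj φ x
  rw [Complex.conj_ofReal] at this
  exact Complex.conj_eq_iff_im.1 this.symm

theorem kernel_re (φ x : ℝ) :
    (kernel φ x).re = 6 / Real.pi * (-(Complex.I * unitAt φ * qTail 0 (unitAt φ * x))).re := by
  have h1 : kernel φ x = ((3 / Real.pi : ℝ) : ℂ) *
      (-(Complex.I * unitAt φ * qTail 0 (unitAt φ * x)) +
        (starRingEnd ℂ) (-(Complex.I * unitAt φ * qTail 0 (unitAt φ * x)))) := by
    unfold kernel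
    rw [map_neg, map_mul, map_mul, ← qTail_conj, map_mul, Complex.conj_ofReal, unitAt_conj,
      Complex.conj_I]
    push_cast
    ring
  rw [h1, Complex.add_conj, Complex.re_ofReal_mul, Complex.ofReal_re]
  ring

/-- Positivity holds term by term: with `a = n + 1`, the real part of `-i e^{iφ} / (a² - e^{2iφ}
x²)` has numerator `sin φ (a² + x²)`. -/
theorem kernel_pos {φ : ℝ} (h : 0 < Real.sin φ) (x : ℝ) : 0 < (kernel φ x).re := by
  rw [kernel_re]
  refine mul_pos (by positivity) ?_
  unfold qTail
  rw [← neg_mul, ← tsum_mul_left, Complex.re_tsum ((summable_qTail 0 _).mul_left _)]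
  have hterm (n : ℕ) : 0 < (-(Complex.I * unitAt φ) *
      (((n + 0 + 1 : ℕ) : ℂ) ^ 2 - (unitAt φ * x) ^ 2)⁻¹).re := by
    have h0 := natCast_sq_sub_sq_ne_zero (unitAt_mul_mem_slitPlaneFrom h.ne' x) n
    set a : ℝ := ((n + 0 + 1 : ℕ) : ℝ) with ha
    have ha0 : 0 < a := by rw [ha]; positivity
    have hac : ((n + 0 + 1 : ℕ) : ℂ) = (a : ℂ) := by rw [ha]; simp
    rw [hac] at h0 ⊢
    rw [← div_eq_mul_inv, Complex.div_re, ← add_div]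
    refine div_pos ?_ (Complex.normSq_pos.2 h0)
    have hcs := Real.sin_sq_add_cos_sq φ
    simp only [sq, Complex.neg_re, Complex.neg_im, Complex.mul_re, Complex.mul_im, Complex.I_re,
      Complex.I_im, Complex.sub_re, Complex.sub_im, Complex.ofReal_re, Complex.ofReal_im,
      unitAt_re, unitAt_im]
    have : 0 < Real.sin φ * (a ^ 2 + x ^ 2) := mul_pos h (by positivity)
    nlinarith [congrArg (fun t => t * (Real.sin φ * x ^ 2)) hcs]
  exact ((Complex.hasSum_re ((summable_qTail 0 _).mul_left _).hasSum).summable).tsum_pos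
    (fun n => (hterm n).le) 0 (hterm 0)

/-- The kernel, rotated so that a ray of singularities becomes the real line. -/
noncomputable def rayKernel (θ : ℝ) (z : ℂ) : ℂ :=
  3 * Complex.I / Real.pi * (qTail 0 z - unitAt (2 * θ) * qTail 0 (unitAt (2 * θ) * z))

theorem unitAt_mul_kernel (φ : ℝ) (z : ℂ) :
    unitAt φ * kernel φ (unitAt φ * z) = rayKernel φ z := by
  have h1 := unitAt_neg_mul φ
  have h2 : unitAt (2 * φ) = unitAt φ * unitAt φ := by rw [two_mul, unitAt_add]
  unfold kernel rayKernel
  rw [← mul_assoc (unitAt (-φ)), h1, one_mul, ← mul_assoc (unitAt φ) (unitAt φ), ← h2]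
  linear_combination (3 / Real.pi * Complex.I * qTail 0 z) * h1 + (3 / Real.pi * Complex.I *
    qTail 0 (unitAt (2 * φ) * z)) * h2

theorem kernel_neg (φ : ℝ) (z : ℂ) : kernel φ (-z) = kernel φ z := by
  unfold kernel; rw [mul_neg, mul_neg, qTail_neg, qTail_neg]

theorem kernel_neg_left (φ : ℝ) (z : ℂ) : kernel (-φ) z = -kernel φ z := by
  unfold kernel; rw [neg_neg]; ring

/-- If `v z` is a real number `t`, then `|Im z| = |t| |Im v|`, and the hypothesis forces `|t| < 1`.
-/
theorem mul_mem_slitPlaneFrom_of_im_lt {v z : ℂ} (hv : ‖v‖ = 1) (hz : |z.im| < |v.im|) :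
    v * z ∈ slitPlaneFrom 0 := by
  by_cases h : (v * z).im = 0
  · right
    have h1 : z = (starRingEnd ℂ) v * ((v * z).re : ℂ) := by
      have h2 : (((v * z).re : ℝ) : ℂ) = v * z := Complex.ext (by simp) (by simp [h])
      rw [h2, ← mul_assoc, ← Complex.normSq_eq_conj_mul_self, Complex.normSq_eq_norm_sq, hv]
      simp
    have h3 : z.im = -v.im * (v * z).re := by
      conv_lhs => rw [h1]
      rw [Complex.im_mul_ofReal, Complex.conj_im]
    rw [h3, abs_mul, abs_neg] at hz
    have h4 : 0 < |v.im| := lt_of_le_of_lt (by positivity) hz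
    rw [Nat.cast_zero, zero_add]
    by_contra h5
    nlinarith [not_lt.1 h5]
  · exact Or.inl h

theorem slitStrip_subset_slitPlaneFrom (δ : ℝ) : slitStrip δ ⊆ slitPlaneFrom 0 := fun z hz => by
  rcases hz.2 with h | h
  · exact Or.inl h
  · right; simpa using h

theorem neg_mem_slitPlaneFrom {m : ℕ} {z : ℂ} (hz : z ∈ slitPlaneFrom m) :
    -z ∈ slitPlaneFrom m := by
  rcases hz with h | h
  · left; simpa using h
  · right; simpa using h

/-- In general the second line of poles meets the real axis only at an angle, so it stays out of a
strip and `N = 3`. For `φ = π/2` the two lines coincide, the poles add up and `N = 6`. -/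
theorem exists_rayKernel_eq {θ : ℝ}
    (hθ : (unitAt (2 * θ)).im ≠ 0 ∨ unitAt (2 * θ) = -1) :
    ∃ δ : ℝ, 0 < δ ∧ ∃ N : ℝ, 0 < N ∧ ∃ r : ℂ → ℂ, DifferentiableOn ℂ r (strip δ) ∧
      (∀ z, rayKernel θ z = N * Complex.I / Real.pi * qTail 0 z + r z) ∧
      ∀ z ∈ slitStrip δ, unitAt (2 * θ) * z ∈ slitPlaneFrom 0 := by
  rcases hθ with h | h
  · refine ⟨|(unitAt (2 * θ)).im|, abs_pos.2 h, 3, by norm_num,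
      fun z => -(3 * Complex.I / Real.pi * unitAt (2 * θ) * qTail 0 (unitAt (2 * θ) * z)),
      ?_, fun z => ?_, fun z hz => mul_mem_slitPlaneFrom_of_im_lt (norm_unitAt _) hz.1⟩
    · exact (((qTail_differentiableOn 0).comp (by fun_prop) fun z hz =>
        mul_mem_slitPlaneFrom_of_im_lt (norm_unitAt _) hz).const_mul _).neg
    · unfold rayKernel; push_cast; ring
  · refine ⟨1, one_pos, 6, by norm_num, fun _ => 0, differentiableOn_const _, fun z => ?_,
      fun z hz => ?_⟩
    · unfold rayKernel; rw [h, neg_one_mul, neg_one_mul, qTail_neg]; push_cast; ring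
    · rw [h, neg_one_mul]
      exact neg_mem_slitPlaneFrom (slitStrip_subset_slitPlaneFrom 1 hz)

theorem rayKernel_differentiableOn {δ N : ℝ} {θ : ℝ} {r : ℂ → ℂ}
    (hr : DifferentiableOn ℂ r (strip δ))
    (h : ∀ z, rayKernel θ z = N * Complex.I / Real.pi * qTail 0 z + r z) :
    DifferentiableOn ℂ (rayKernel θ) (slitStrip δ) := by
  rw [show rayKernel θ = _ from funext h]
  exact (((qTail_differentiableOn 0).mono (slitStrip_subset_slitPlaneFrom δ)).const_mul _).add
    (hr.mono fun z hz => hz.1)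

/-- The factor `e^{-2πiz} - 1` vanishes exactly at the integers and cancels all real poles of the
kernel, leaving the entire function `hKernel`. The constant `σ` is needed because rotation onto one
of the two rays reverses the sign of the kernel. -/
theorem convExp_rayKernel_continuation {θ : ℝ}
    (hθ : (unitAt (2 * θ)).im ≠ 0 ∨ unitAt (2 * θ) = -1) (σ : ℂ) {x : ℝ} (hx : ∀ n : ℤ, x ≠ n)
    {ε : ℝ} (hε : ε = 1 ∨ ε = -1) :
    ∃ G : ℂ → ℂ, AnalyticAt ℂ G x ∧
      ∀ᶠ z in 𝓝 (x : ℂ), 0 < ε * z.im → convExp (fun w => σ * rayKernel θ w) z = G z := by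
  obtain ⟨δ, hδ, N, -, r, hr, hf, -⟩ := exists_rayKernel_eq hθ
  refine convExp_continuation hδ (c := -(2 * Real.pi * Complex.I))
    ((rayKernel_differentiableOn hr hf).const_mul σ)
    (fM := fun z => σ * (N * Complex.I / Real.pi * -(2 * Real.pi ^ 2 *
      hKernel (2 * Real.pi * Complex.I * z)) +
      (Complex.exp (-(2 * Real.pi * Complex.I) * z) - 1) * r z)) ?_ ?_ ?_ hε
  · have h1 : Differentiable ℂ fun z => hKernel (2 * Real.pi * Complex.I * z) :=
      hKernel_differentiable.comp (by fun_prop)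
    exact (((h1.differentiableOn.const_mul _).neg.const_mul _).add
      ((by fun_prop : DifferentiableOn ℂ (fun z : ℂ =>
        Complex.exp (-(2 * Real.pi * Complex.I) * z) - 1) (strip δ)).mul hr)).const_mul σ
  · intro z hz
    have h1 := one_sub_exp_mul_qTail (slitStrip_subset_slitPlaneFrom δ hz)
    rw [hf, ← h1, neg_mul]
    ring
  · intro h
    rw [Complex.exp_eq_one_iff] at h
    obtain ⟨n, hn⟩ := h
    apply hx (-n)
    have h1 : (2 * Real.pi * Complex.I) * ((x : ℝ) : ℂ) = (2 * Real.pi * Complex.I) * ((-n : ℤ) : ℂ) := by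
      push_cast; linear_combination -hn
    have h2 := mul_left_cancel₀ Complex.two_pi_I_ne_zero h1
    exact_mod_cast h2

/-- Separates the first `m` poles on the positive axis, each with residue `-1/2`, from a remainder
without poles at abscissas between `-1` and `m + 1`. -/
theorem mul_qTail_eq (m : ℕ) {z : ℂ} (hz : z ∈ slitPlaneFrom 0) :
    z * qTail 0 z = -(1 / 2) * ∑ n ∈ Finset.range m, (z - (n + 1))⁻¹ +
      (-(1 / 2) * ∑ n ∈ Finset.range m, (z + (n + 1))⁻¹ + z * qTail m z) := by
  rw [qTail_eq_sum_add 0 m, zero_add, mul_add, ← add_assoc]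
  congr 1
  rw [← mul_add, ← Finset.sum_add_distrib, Finset.mul_sum, Finset.mul_sum]
  refine Finset.sum_congr rfl fun n _ => ?_
  have h1 := natCast_sq_sub_sq_ne_zero hz n
  push_cast at h1 ⊢
  rw [add_zero] at h1 ⊢
  have h2 : ((n : ℂ) + 1 - z) * (n + 1 + z) ≠ 0 := by
    rw [show ((n : ℂ) + 1 - z) * (n + 1 + z) = ((n : ℂ) + 1) ^ 2 - z ^ 2 by ring]; exact h1
  have h3 := left_ne_zero_of_mul h2
  have h4 := right_ne_zero_of_mul h2
  have h5 : z - (n + 1) ≠ 0 := by rw [← neg_ne_zero, neg_sub]; exact h3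
  have h6 : z + (n + 1) ≠ 0 := by rw [add_comm]; exact h4
  field_simp
  ring

theorem tendsto_convExp_rayKernel {θ : ℝ}
    (hθ : (unitAt (2 * θ)).im ≠ 0 ∨ unitAt (2 * θ) = -1) (k : ℕ) :
    ∃ c : ℝ, 0 < c ∧ Tendsto (fun ε : ℝ => (2 * Real.pi * ε : ℂ) *
      convExp (rayKernel θ) ((k + 1 : ℝ) - (ε : ℝ) * Complex.I)) (𝓝[>] 0) (𝓝 (c : ℂ)) := by
  have hpi : (Real.pi : ℂ) ≠ 0 := by exact_mod_cast Real.pi_ne_zero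
  obtain ⟨δ, hδ, N, hN, r, hr, hf, -⟩ := exists_rayKernel_eq hθ
  refine tendsto_convExp_below_pole hδ hN (κ := fun m z => N * Complex.I / Real.pi *
    (-(1 / 2) * ∑ n ∈ Finset.range m, (z + (n + 1))⁻¹ + z * qTail m z) + z * r z)
    (rayKernel_differentiableOn hr hf) (fun m => ?_) (fun m z hz => ?_) k
  · refine DifferentiableOn.add (DifferentiableOn.const_mul (DifferentiableOn.add
      (DifferentiableOn.const_mul (DifferentiableOn.fun_sum fun n _ => ?_) _)
      (differentiableOn_id.mul ((qTail_differentiableOn m).mono ?_))) _)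
      (differentiableOn_id.mul (hr.mono fun z hz => hz.1))
    · refine DifferentiableOn.inv (by fun_prop) fun z hz h => ?_
      have h1 := congrArg Complex.re h
      have h2 := hz.2.1
      simp at h1
      linarith [(Nat.cast_nonneg n : (0 : ℝ) ≤ n)]
    · intro z hz
      have := hz.2
      right
      rw [abs_lt]
      constructor <;> linarith [this.1, this.2, (Nat.cast_nonneg m : (0 : ℝ) ≤ m)]
  · have h1 := mul_qTail_eq m (slitStrip_subset_slitPlaneFrom δ hz.1)
    have h2 : (N : ℂ) / (2 * Real.pi * Complex.I) = N * Complex.I / Real.pi * -(1 / 2) := by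
      have := Complex.I_ne_zero
      field_simp
      linear_combination (N : ℂ) * Complex.I_sq
    rw [hf, h2]
    linear_combination (N * Complex.I / Real.pi) * h1

/-! ### The density in the complex plane -/

/-- The analytic continuation of the density of states. -/
noncomputable def density (η φ : ℝ) (z : ℂ) : ℂ :=
  (η : ℂ)⁻¹ * convExp (kernel φ) ((z - groundFrequency η φ) / η)

theorem linePoint_eq (η φ θ s : ℝ) :
    linePoint η φ θ s = groundFrequency η φ + s * unitAt θ := rfl

theorem mem_cutSet_of_not_mem {η φ θ : ℝ} (hη : 0 < η) (hθ : θ = φ ∨ θ = -φ) {z : ℂ}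
    (hz : unitAt (-θ) * ((z - groundFrequency η φ) / η) ∉ slitPlaneFrom 0) : z ∈ cutSet η φ := by
  have hη' : (η : ℂ) ≠ 0 := by exact_mod_cast hη.ne'
  set w := unitAt (-θ) * ((z - groundFrequency η φ) / η) with hw
  have h1 : w.im = 0 := by
    by_contra h; exact hz (Or.inl h)
  have h2 : 1 ≤ |w.re| := by
    by_contra h; exact hz (Or.inr (by simpa using h))
  have h3 : (w.re : ℂ) = w := Complex.ext (by simp) (by simp [h1])
  have h4 : z = linePoint η φ θ (w.re * η) := by
    rw [linePoint_eq, Complex.ofReal_mul, h3, hw]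
    field_simp
    linear_combination -(z - groundFrequency η φ) * unitAt_neg_mul θ
  refine ⟨w.re * η, ?_, ?_⟩
  · rw [abs_mul, abs_of_pos hη]; nlinarith
  · rcases hθ with rfl | rfl
    · exact Or.inr h4
    · exact Or.inl h4

theorem mem_kernelDomain_iff {η φ : ℝ} (hη : 0 < η) {z : ℂ} :
    (z - groundFrequency η φ) / η ∈ kernelDomain φ ↔ z ∉ cutSet η φ := by
  have hη' : (η : ℂ) ≠ 0 := by exact_mod_cast hη.ne'
  constructor
  · rintro ⟨h1, h2⟩ ⟨s, hs, h⟩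
    have key (θ : ℝ) (h3 : z = linePoint η φ θ s) :
        unitAt (-θ) * ((z - groundFrequency η φ) / η) ∉ slitPlaneFrom 0 := by
      have h4 : unitAt (-θ) * ((z - groundFrequency η φ) / η) = ((s / η : ℝ) : ℂ) := by
        rw [h3, linePoint_eq]
        push_cast
        field_simp
        linear_combination (s : ℂ) * unitAt_neg_mul θ
      rw [h4]
      rintro (h5 | h5)
      · exact h5 (Complex.ofReal_im _)
      · rw [Complex.ofReal_re, abs_div, abs_of_pos hη, div_lt_iff₀ hη] at h5
        simp at h5
        linarith
    rcases h with h | h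
    · exact key _ h (by rwa [neg_neg])
    · exact key _ h h2
  · intro h
    constructor
    · by_contra h1
      exact h (mem_cutSet_of_not_mem hη (Or.inr rfl) (by rwa [neg_neg]))
    · by_contra h1
      exact h (mem_cutSet_of_not_mem hη (Or.inl rfl) h1)

theorem convExp_kernel_differentiableOn (φ : ℝ) :
    DifferentiableOn ℂ (convExp (kernel φ)) (kernelDomain φ) :=
  convExp_differentiableOn (isOpen_kernelDomain φ) (isStar_kernelDomain φ)
    (kernel_differentiableOn φ)

theorem density_analyticAt {η φ : ℝ} (hη : 0 < η) {z : ℂ} (hz : z ∉ cutSet η φ) :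
    AnalyticAt ℂ (density η φ) z := by
  have h1 : AnalyticAt ℂ (convExp (kernel φ)) ((z - groundFrequency η φ) / η) :=
    (convExp_kernel_differentiableOn φ).analyticAt
      ((isOpen_kernelDomain φ).mem_nhds ((mem_kernelDomain_iff hη).2 hz))
  exact analyticAt_const.mul (h1.fun_comp (f := fun z => (z - groundFrequency η φ) / (η : ℂ))
    ((analyticAt_id.sub analyticAt_const).div_const))

open ComplexConjugate in
theorem density_conj (η φ : ℝ) (z : ℂ) : density η φ (conj z) = conj (density η φ z) := by
  unfold density
  rw [map_mul, map_inv₀, Complex.conj_ofReal, ← convExp_conj (kernel_conj φ), map_div₀, map_sub,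
    Complex.conj_ofReal, Complex.conj_ofReal]

/-- On the ray with angle `θ`, the kernel is a constant multiple of `rayKernel`. -/
theorem exists_unitAt_mul_kernel {φ θ : ℝ} (hθ : θ = φ ∨ θ = -φ) :
    ∃ σ : ℂ, ∀ z, unitAt θ * kernel φ (unitAt θ * z) = σ * rayKernel θ z := by
  rcases hθ with rfl | rfl
  · exact ⟨1, fun z => by rw [one_mul, unitAt_mul_kernel]⟩
  · refine ⟨-1, fun z => ?_⟩
    rw [← unitAt_mul_kernel, kernel_neg_left]
    ring

theorem unitAt_two_mul_ne {φ θ : ℝ} (hφ : 0 < φ) (hφ' : φ ≤ Real.pi / 2) (hθ : θ = φ ∨ θ = -φ) :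
    (unitAt (2 * θ)).im ≠ 0 ∨ unitAt (2 * θ) = -1 := by
  rcases hφ'.lt_or_eq with h | rfl
  · left
    have h1 : 0 < Real.sin (2 * φ) := Real.sin_pos_of_pos_of_lt_pi (by linarith) (by linarith)
    rw [unitAt_im]
    rcases hθ with rfl | rfl
    · exact h1.ne'
    · rw [mul_neg, Real.sin_neg]; exact (neg_neg_of_pos h1).ne
  · right
    have h1 : 2 * (Real.pi / 2) = Real.pi := by ring
    rcases hθ with rfl | rfl
    · apply Complex.ext <;> simp [unitAt_re, unitAt_im, h1]
    · apply Complex.ext <;> simp [unitAt_re, unitAt_im, h1]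

/-- Transports the continuation across the real axis by the affine map that sends the real axis to
the line in direction `e^{iθ}` through `ω_φ`; the side of the line is preserved since `η > 0`. -/
theorem density_continuation {η φ θ : ℝ} (hη : 0 < η) (hφ : 0 < φ) (hφ' : φ ≤ Real.pi / 2)
    (hθ : θ = φ ∨ θ = -φ) {x : ℝ} (hx : ∀ n : ℤ, x ≠ n) {ε : ℝ} (hε : ε = 1 ∨ ε = -1) :
    ∃ G : ℂ → ℂ, AnalyticAt ℂ G (linePoint η φ θ (x * η)) ∧
      ∀ᶠ z in 𝓝 (linePoint η φ θ (x * η)),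
        0 < ε * ((z - linePoint η φ θ (x * η)) / unitAt θ).im → density η φ z = G z := by
  have hη' : (η : ℂ) ≠ 0 := by exact_mod_cast hη.ne'
  have hu := unitAt_ne_zero θ
  obtain ⟨σ, hσ⟩ := exists_unitAt_mul_kernel hθ
  obtain ⟨G, hG, hGe⟩ := convExp_rayKernel_continuation (unitAt_two_mul_ne hφ hφ' hθ) σ hx hε
  have hL : AnalyticAt ℂ (fun z : ℂ => (z - groundFrequency η φ) / (η * unitAt θ))
      (linePoint η φ θ (x * η)) := (analyticAt_id.sub analyticAt_const).div_const
  have hL0 : (linePoint η φ θ (x * η) - groundFrequency η φ) / (η * unitAt θ) = x := by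
    rw [linePoint_eq]; push_cast; field_simp; ring
  refine ⟨fun z => (η : ℂ)⁻¹ * ((unitAt θ)⁻¹ *
    G ((z - groundFrequency η φ) / (η * unitAt θ))), ?_, ?_⟩
  · refine analyticAt_const.mul (analyticAt_const.mul (AnalyticAt.fun_comp ?_ hL))
    rw [hL0]; exact hG
  · have ht : Tendsto (fun z : ℂ => (z - groundFrequency η φ) / (η * unitAt θ))
        (𝓝 (linePoint η φ θ (x * η))) (𝓝 (x : ℂ)) := by
      have := hL.continuousAt.tendsto
      rwa [hL0] at this
    filter_upwards [ht.eventually hGe] with z hz hzi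
    have h1 : (z - groundFrequency η φ) / (η * unitAt θ) =
        ((η⁻¹ : ℝ) : ℂ) * ((z - linePoint η φ θ (x * η)) / unitAt θ) + (x : ℂ) := by
      rw [linePoint_eq]; push_cast; field_simp; ring
    have h2 : 0 < ε * ((z - groundFrequency η φ) / (η * unitAt θ)).im := by
      rw [h1, Complex.add_im, Complex.ofReal_im, Complex.im_ofReal_mul, add_zero, mul_left_comm]
      exact mul_pos (inv_pos.2 hη) hzi
    have h3 := convExp_comp_mul (unitAt θ) (kernel φ)
      ((z - groundFrequency η φ) / (η * unitAt θ))
    simp only [hσ] at h3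
    rw [← hz h2, h3, density, inv_mul_cancel_left₀ hu]
    congr 2
    field_simp

theorem density_hasAtMostCutAt {η φ θ : ℝ} (hη : 0 < η) (hφ : 0 < φ) (hφ' : φ ≤ Real.pi / 2)
    (hθ : θ = φ ∨ θ = -φ) {s : ℝ} (hs : η ≤ |s|)
    (hns : linePoint η φ θ s ∉ singularPoints η φ) :
    HasAtMostCutAt (density η φ) (Complex.exp (Complex.I * θ)) (linePoint η φ θ s) := by
  obtain ⟨x, rfl⟩ : ∃ x : ℝ, s = x * η := ⟨s / η, by field_simp⟩
  have hx : ∀ n : ℤ, x ≠ n := by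
    rintro n rfl
    refine hns ⟨n, ?_, ?_⟩
    · rintro rfl
      simp at hs
      linarith
    · rcases hθ with rfl | rfl
      · exact Or.inr rfl
      · exact Or.inl rfl
  obtain ⟨G, hG, hGe⟩ := density_continuation hη hφ hφ' hθ hx (Or.inl rfl)
  obtain ⟨G', hG', hGe'⟩ := density_continuation hη hφ hφ' hθ hx (Or.inr rfl)
  refine ⟨⟨G, hG, ?_⟩, ⟨G', hG', ?_⟩⟩
  · filter_upwards [hGe] with z hz h
    exact hz (by rw [one_mul]; exact h)
  · filter_upwards [hGe'] with z hz h
    exact hz (by rw [neg_one_mul]; exact neg_pos.2 h)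

/-- An analytic `G` is bounded near `p`, so `ε G(γ ε)` would tend to `0`. -/
theorem isSingularPointOff_of_tendsto {F : ℂ → ℂ} {S : Set ℂ} {p c : ℂ} (hc : c ≠ 0)
    {γ : ℝ → ℂ} (hγ : Tendsto γ (𝓝[>] 0) (𝓝 p)) (hS : ∀ᶠ ε in 𝓝[>] (0 : ℝ), γ ε ∉ S)
    (h : Tendsto (fun ε : ℝ => (ε : ℂ) * F (γ ε)) (𝓝[>] 0) (𝓝 c)) : IsSingularPointOff F S p := by
  rintro ⟨G, hG, hFG⟩
  have h1 : Tendsto (fun ε : ℝ => (ε : ℂ) * G (γ ε)) (𝓝[>] 0) (𝓝 (((0 : ℝ) : ℂ) * G p)) :=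
    ((Complex.continuous_ofReal.tendsto 0).mono_left nhdsWithin_le_nhds).mul
      (hG.continuousAt.tendsto.comp hγ)
  rw [Complex.ofReal_zero, zero_mul] at h1
  refine hc (tendsto_nhds_unique (h.congr' ?_) h1)
  filter_upwards [hS, hγ.eventually hFG] with ε h2 h3
  rw [h3 h2]

/-- Along a suitable path, off the cuts, the density blows up at the singular point on the ray with direction
`σ e^{iθ}`. -/
theorem tendsto_density_below_pole {η φ θ σ : ℝ} (hη : 0 < η) (hφ : 0 < φ)
    (hφ' : φ ≤ Real.pi / 2) (h : (θ = φ ∧ σ = 1) ∨ (θ = -φ ∧ σ = -1)) (k : ℕ) :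
    ∃ γ : ℝ → ℂ, Tendsto γ (𝓝[>] 0) (𝓝 (linePoint η φ θ (σ * (k + 1) * η))) ∧
      (∀ᶠ ε in 𝓝[>] (0 : ℝ), γ ε ∉ cutSet η φ) ∧
      ∃ c : ℂ, c ≠ 0 ∧ Tendsto (fun ε : ℝ => (ε : ℂ) * density η φ (γ ε)) (𝓝[>] 0) (𝓝 c) := by
  have hη' : (η : ℂ) ≠ 0 := by exact_mod_cast hη.ne'
  have hpi : (Real.pi : ℂ) ≠ 0 := by exact_mod_cast Real.pi_ne_zero
  have hu := unitAt_ne_zero θ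
  have hθ : θ = φ ∨ θ = -φ := h.imp And.left And.left
  have hσ2 : (σ : ℂ) * σ = 1 := by rcases h with ⟨-, rfl⟩ | ⟨-, rfl⟩ <;> simp
  have hσ0 : (σ : ℂ) ≠ 0 := left_ne_zero_of_mul_eq_one hσ2
  have hθ2 := unitAt_two_mul_ne hφ hφ' hθ
  -- The sign `σ` is matched to `θ` so that the rotated kernel is `rayKernel θ` itself, whose
  -- residues have the sign required by the positivity argument, and not its negative.
  have hK (z : ℂ) : (σ * unitAt θ) * kernel φ ((σ * unitAt θ) * z) = rayKernel θ z := by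
    rcases h with ⟨rfl, rfl⟩ | ⟨rfl, rfl⟩
    · rw [Complex.ofReal_one, one_mul, unitAt_mul_kernel]
    · rw [← unitAt_mul_kernel, kernel_neg_left, Complex.ofReal_neg, Complex.ofReal_one,
        neg_one_mul, neg_mul (unitAt _) z, kernel_neg]
      ring
  obtain ⟨c, hc, hlim⟩ := tendsto_convExp_rayKernel hθ2 k
  obtain ⟨δ, hδ, -, -, -, -, -, hmem⟩ := exists_rayKernel_eq hθ2
  set t : ℝ → ℂ := fun ε => (k + 1 : ℝ) - (ε : ℝ) * Complex.I with ht
  set γ : ℝ → ℂ := fun ε => groundFrequency η φ + η * (σ * unitAt θ * t ε) with hγ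
  have hγt (ε : ℝ) : (γ ε - groundFrequency η φ) / η = σ * unitAt θ * t ε := by
    rw [hγ]; field_simp; ring
  refine ⟨γ, ?_, ?_, ?_⟩
  · have h1 : Continuous γ := by fun_prop
    have h2 := (h1.tendsto 0).mono_left (nhdsWithin_le_nhds (s := Ioi 0))
    convert h2 using 2
    simp only [hγ, ht, linePoint_eq]
    push_cast
    ring
  · have hσm {z : ℂ} (hz : z ∈ slitPlaneFrom 0) : (σ : ℂ) * z ∈ slitPlaneFrom 0 := by
      rcases h with ⟨-, rfl⟩ | ⟨-, rfl⟩
      · simpa using hz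
      · simpa using neg_mem_slitPlaneFrom hz
    filter_upwards [Ioo_mem_nhdsGT hδ] with ε hε
    have hts : t ε ∈ slitStrip δ := by
      have : (t ε).im = -ε := by simp [ht]
      refine ⟨?_, Or.inl ?_⟩
      · rw [this, abs_neg, abs_of_pos hε.1]; exact hε.2
      · rw [this]; exact (neg_neg_of_pos hε.1).ne
    have h1 := hσm (slitStrip_subset_slitPlaneFrom δ hts)
    have h2 := hσm (hmem _ hts)
    rw [← mem_kernelDomain_iff hη, hγt]
    have e1 : unitAt (-θ) * (σ * unitAt θ * t ε) = σ * t ε := by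
      linear_combination (σ * t ε) * unitAt_neg_mul θ
    have e2 : unitAt θ * (σ * unitAt θ * t ε) = σ * (unitAt (2 * θ) * t ε) := by
      rw [two_mul, unitAt_add]; ring
    rw [← e1] at h1
    rw [← e2] at h2
    rcases hθ with rfl | rfl
    · exact ⟨h2, h1⟩
    · exact ⟨by rwa [neg_neg] at h1, h2⟩
  · refine ⟨(η : ℂ)⁻¹ * ((σ * unitAt θ)⁻¹ * ((2 * Real.pi : ℂ)⁻¹ * c)), ?_, ?_⟩
    · simp [hη', hσ0, hu, hpi, hc.ne']
    · refine (((hlim.const_mul ((2 * Real.pi : ℂ)⁻¹)).const_mul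
        (σ * unitAt θ : ℂ)⁻¹).const_mul (η : ℂ)⁻¹).congr fun ε => ?_
      have h3 := convExp_comp_mul (σ * unitAt θ) (kernel φ) (t ε)
      simp only [hK] at h3
      rw [density, hγt, h3]
      field_simp

open ComplexConjugate in
theorem conj_mem_cutSet {η φ : ℝ} {z : ℂ} (h : conj z ∈ cutSet η φ) : z ∈ cutSet η φ := by
  have key (θ s : ℝ) (h1 : conj z = linePoint η φ θ s) : z = linePoint η φ (-θ) s := by
    rw [linePoint_eq] at h1 ⊢
    rw [← Complex.conj_conj z, h1, map_add, map_mul, unitAt_conj, Complex.conj_ofReal,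
      Complex.conj_ofReal]
  obtain ⟨s, hs, h1 | h1⟩ := h
  · exact ⟨s, hs, Or.inr (by simpa using key _ _ h1)⟩
  · exact ⟨s, hs, Or.inl (key _ _ h1)⟩

-- The residue argument reaches the points with `j > 0` on the line of angle `φ` and those with `j <
-- 0` on the line of angle `-φ`. The others are their complex conjugates, and the density commutes
-- with conjugation.
open ComplexConjugate in
theorem density_isSingularPointOff {η φ : ℝ} (hη : 0 < η) (hφ : 0 < φ) (hφ' : φ ≤ Real.pi / 2)
    {p : ℂ} (hp : p ∈ singularPoints η φ) : IsSingularPointOff (density η φ) (cutSet η φ) p := by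
  have key (θ σ : ℝ) (h : (θ = φ ∧ σ = 1) ∨ (θ = -φ ∧ σ = -1)) (k : ℕ) :
      IsSingularPointOff (density η φ) (cutSet η φ) (linePoint η φ θ (σ * (k + 1) * η)) ∧
      IsSingularPointOff (density η φ) (cutSet η φ) (linePoint η φ (-θ) (σ * (k + 1) * η)) := by
    obtain ⟨γ, hγ, hγS, c, hc, hlim⟩ := tendsto_density_below_pole hη hφ hφ' h k
    refine ⟨isSingularPointOff_of_tendsto hc hγ hγS hlim,
      isSingularPointOff_of_tendsto (γ := fun ε => conj (γ ε)) (c := conj c) ?_ ?_ ?_ ?_⟩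
    · simpa using hc
    · have h1 := (Complex.continuous_conj.tendsto _).comp hγ
      rwa [linePoint_eq, map_add, map_mul, unitAt_conj, Complex.conj_ofReal,
        Complex.conj_ofReal] at h1
    · filter_upwards [hγS] with ε h1 h2
      exact h1 (conj_mem_cutSet h2)
    · refine ((Complex.continuous_conj.tendsto _).comp hlim).congr fun ε => ?_
      rw [Function.comp_apply, map_mul, Complex.conj_ofReal, density_conj]
  obtain ⟨j, hj, h⟩ := hp
  obtain ⟨k, rfl | rfl⟩ : ∃ k : ℕ, j = k + 1 ∨ j = -(k + 1) := by
    rcases lt_or_gt_of_ne hj with h1 | h1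
    · exact ⟨(-j - 1).toNat, Or.inr (by omega)⟩
    · exact ⟨(j - 1).toNat, Or.inl (by omega)⟩
  · have h1 := key φ 1 (Or.inl ⟨rfl, rfl⟩) k
    push_cast at h
    rw [one_mul] at h1
    rcases h with rfl | rfl
    · exact h1.2
    · exact h1.1
  · have h1 := key (-φ) (-1) (Or.inr ⟨rfl, rfl⟩) k
    push_cast at h
    rw [neg_one_mul, neg_neg] at h1
    rcases h with rfl | rfl
    · exact h1.1
    · exact h1.2

/-! ### Gudermann's series for the Gamma function -/

/-- The terms of Gudermann's series for the logarithm of the Gamma function. -/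
noncomputable def gudermannTerm (w : ℂ) (n : ℕ) : ℂ :=
  (w + n + 1 / 2) * (Complex.log (w + n + 1) - Complex.log (w + n)) - 1

/-- Summation by parts; the sum of logarithms that remains is the denominator of Euler's product. -/
theorem sum_gudermannTerm (w : ℂ) (n : ℕ) :
    ∑ j ∈ Finset.range n, gudermannTerm w j =
      (w + n + 1 / 2) * Complex.log (w + n) - (w - 1 / 2) * Complex.log w -
        ∑ j ∈ Finset.range (n + 1), Complex.log (w + j) - n := by
  induction n with
  | zero => simp; ring
  | succ n ih =>
    rw [Finset.sum_range_succ, ih, Finset.sum_range_succ _ (n + 1), gudermannTerm]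
    push_cast
    rw [← add_assoc]
    ring

theorem integral_gudermannTerm {w : ℂ} (hw : 0 < w.re) (n : ℕ) :
    ∫ x in (0 : ℝ)..1, ((1 / 2 - x : ℝ) : ℂ) / (w + n + x) = gudermannTerm w n := by
  have hre (x : ℝ) (hx : 0 ≤ x) : 0 < (w + n + x).re := by
    rw [Complex.add_re, Complex.add_re, Complex.natCast_re, Complex.ofReal_re]
    positivity
  have hne (x : ℝ) (hx : 0 ≤ x) : w + n + x ≠ 0 := fun h => by
    have := hre x hx; rw [h] at this; exact lt_irrefl _ this
  have h1 : ∀ x ∈ uIcc (0 : ℝ) 1, HasDerivAt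
      (fun x : ℝ => (w + n + 1 / 2) * Complex.log (w + n + x) - x)
      (((1 / 2 - x : ℝ) : ℂ) / (w + n + x)) x := by
    intro x hx
    rw [uIcc_of_le zero_le_one] at hx
    have h2 : HasDerivAt (fun x : ℂ => (w + n + 1 / 2) * Complex.log (w + n + x) - x)
        ((w + n + 1 / 2) * (1 / (w + n + x)) - 1) (x : ℂ) :=
      ((((hasDerivAt_id (x : ℂ)).const_add (w + n)).clog (Or.inl (hre x hx.1))).const_mul
        _).sub (hasDerivAt_id _)
    convert h2.comp_ofReal using 1
    have := hne x hx.1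
    push_cast
    field_simp
    ring
  rw [intervalIntegral.integral_eq_sub_of_hasDerivAt h1, gudermannTerm]
  · push_cast; ring_nf
  · refine ContinuousOn.intervalIntegrable (ContinuousOn.div (by fun_prop) (by fun_prop) ?_)
    intro x hx
    rw [uIcc_of_le zero_le_one] at hx
    exact hne x hx.1

theorem factorial_eq_stirlingSeq {n : ℕ} (hn : n ≠ 0) :
    (n.factorial : ℝ) = Stirling.stirlingSeq n * (√2 *
      Real.exp ((n + 1 / 2) * Real.log n - n)) := by
  have hn0 : (0 : ℝ) < n := by exact_mod_cast Nat.pos_of_ne_zero hn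
  have h1 : √(2 * n : ℝ) * (n / Real.exp 1) ^ n =
      √2 * Real.exp ((n + 1 / 2) * Real.log n - n) := by
    rw [Real.sqrt_mul zero_le_two, Real.sqrt_eq_rpow (n : ℝ), Real.rpow_def_of_pos hn0, mul_assoc,
      show (n : ℝ) / Real.exp 1 = Real.exp (Real.log n - 1) by
        rw [Real.exp_sub, Real.exp_log hn0], ← Real.exp_nat_mul, ← Real.exp_add]
    congr 2
    ring
  rw [← h1, Stirling.stirlingSeq, div_mul_cancel₀]
  positivity

/-- Euler's limit formula for `Γ`, with `n!` replaced by means of Stirling's sequence. Everything is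
exponentiated, so no branch of `log Γ` has to be chosen. -/
theorem tendsto_exp_sum_gudermannTerm {w : ℂ} (hw : 0 < w.re) :
    Tendsto (fun n : ℕ => Complex.exp (∑ j ∈ Finset.range n, gudermannTerm w j) *
      ((Stirling.stirlingSeq n : ℂ) * ((√2 : ℝ) *
        Complex.exp (-((w + n + 1 / 2) * Complex.log (1 + w / n)))))) atTop
      (𝓝 (Complex.Gamma w * Complex.exp (-((w - 1 / 2) * Complex.log w)))) := by
  refine ((Complex.GammaSeq_tendsto_Gamma w).mul_const _).congr' ?_
  filter_upwards [eventually_ne_atTop 0] with n hn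
  have hn0 : (0 : ℝ) < n := by exact_mod_cast Nat.pos_of_ne_zero hn
  have hnc : (n : ℂ) ≠ 0 := by exact_mod_cast hn
  have hne (j : ℕ) : w + j ≠ 0 := fun h => by
    have := congrArg Complex.re h
    rw [Complex.add_re, Complex.natCast_re, Complex.zero_re] at this
    linarith [(Nat.cast_nonneg j : (0 : ℝ) ≤ j)]
  have h1 : ∏ j ∈ Finset.range (n + 1), (w + j) =
      Complex.exp (∑ j ∈ Finset.range (n + 1), Complex.log (w + j)) := by
    rw [Complex.exp_sum]
    exact Finset.prod_congr rfl fun j _ => (Complex.exp_log (hne j)).symm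
  have h2 : Complex.log (w + n) = Real.log n + Complex.log (1 + w / n) := by
    rw [← Complex.log_ofReal_mul hn0]
    · congr 1; push_cast; field_simp; ring
    · intro h
      apply hne n
      field_simp at h
      rw [add_comm, h, mul_zero]
  have h3 : (n.factorial : ℂ) = Stirling.stirlingSeq n * ((√2 : ℝ) *
      Complex.exp ((n + 1 / 2) * Real.log n - n)) := by
    have := congrArg (fun x : ℝ => (x : ℂ)) (factorial_eq_stirlingSeq hn)
    push_cast at this ⊢
    exact this
  rw [Complex.GammaSeq, h1, h3, Complex.cpow_def_of_ne_zero hnc, ← Complex.natCast_log,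
    sum_gudermannTerm, h2, div_eq_mul_inv, ← Complex.exp_neg]
  set S := ∑ j ∈ Finset.range (n + 1), Complex.log (w + j)
  set l : ℂ := ((Real.log n : ℝ) : ℂ)
  set q := Complex.log (1 + w / n)
  have h4 : Complex.exp (l * w) * Complex.exp ((n + 1 / 2) * l - n) * Complex.exp (-S) *
      Complex.exp (-((w - 1 / 2) * Complex.log w)) =
      Complex.exp ((w + n + 1 / 2) * (l + q) - (w - 1 / 2) * Complex.log w - S - n) *
      Complex.exp (-((w + n + 1 / 2) * q)) := by
    simp only [← Complex.exp_add]
    congr 1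
    ring
  linear_combination (Stirling.stirlingSeq n : ℂ) * ((√2 : ℝ) : ℂ) * h4

/-- The limit of the preceding products is computed a second time, from `(w + n + 1/2) log(1 + w/n)
→ w` and Stirling's constant `√π`; comparison gives Stirling's formula with exact remainder `S`. -/
theorem exp_mul_eq_gamma {w S : ℂ} (hw : 0 < w.re) (hS : HasSum (gudermannTerm w) S) :
    Complex.Gamma w = (√(2 * Real.pi) : ℝ) * Complex.exp ((w - 1 / 2) * Complex.log w - w + S) := by
  have h1 : Tendsto (fun n : ℕ => (w + n + 1 / 2) * Complex.log (1 + w / n)) atTop (𝓝 w) := by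
    have h2 : Tendsto (fun n : ℕ => (n : ℂ) * Complex.log (1 + w / n)) atTop (𝓝 w) := by
      refine Complex.tendsto_nat_mul_log_one_add_of_tendsto (tendsto_const_nhds.congr' ?_)
      filter_upwards [eventually_ne_atTop 0] with n hn
      have hnc : (n : ℂ) ≠ 0 := by exact_mod_cast hn
      field_simp
    have h3 : Tendsto (fun n : ℕ => 1 + (w + 1 / 2) * ((n : ℂ))⁻¹) atTop
        (𝓝 (1 + (w + 1 / 2) * 0)) :=
      (tendsto_inv_atTop_nhds_zero_nat (𝕜 := ℂ)).const_mul _ |>.const_add _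
    rw [mul_zero, add_zero] at h3
    have h4 := h3.mul h2
    rw [one_mul] at h4
    refine h4.congr' ?_
    filter_upwards [eventually_ne_atTop 0] with n hn
    have hnc : (n : ℂ) ≠ 0 := by exact_mod_cast hn
    field_simp
    ring
  have h5 := tendsto_exp_sum_gudermannTerm hw
  have h6 := ((Complex.continuous_exp.tendsto S).comp hS.tendsto_sum_nat).mul
    (((Complex.continuous_ofReal.tendsto _).comp Stirling.tendsto_stirlingSeq_sqrt_pi).mul
      (((Complex.continuous_exp.tendsto _).comp h1.neg).const_mul ((√2 : ℝ) : ℂ)))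
  have h7 := tendsto_nhds_unique h5 h6
  have h8 : Complex.exp (-((w - 1 / 2) * Complex.log w)) *
      Complex.exp ((w - 1 / 2) * Complex.log w - w + S) = Complex.exp S * Complex.exp (-w) := by
    rw [← Complex.exp_add, ← Complex.exp_add]; congr 1; ring
  rw [Real.sqrt_mul zero_le_two]
  push_cast
  apply mul_right_cancel₀ (Complex.exp_ne_zero (-((w - 1 / 2) * Complex.log w)))
  rw [h7]
  linear_combination -((√2 : ℝ) : ℂ) * ((√Real.pi : ℝ) : ℂ) * h8

/-! ### The Laplace transform of the kernel -/

/-- Integration by parts. The factor `z` yields `‖h(z)‖ ≤ ‖z‖` in the right half-plane, so the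
Laplace integrals below decay like `1/n²` and may be summed under the integral sign. -/
theorem hKernel_eq_mul (z : ℂ) : hKernel z =
    z * ∫ x in (0 : ℝ)..1, (((x - x ^ 2) / 2 : ℝ) : ℂ) * Complex.exp (-(z * x)) := by
  have h1 : ∀ x ∈ uIcc (0 : ℝ) 1, HasDerivAt
      (fun x : ℝ => (((x - x ^ 2) / 2 : ℝ) : ℂ) * Complex.exp (-(z * x)))
      (((1 / 2 - x : ℝ) : ℂ) * Complex.exp (-(z * x)) -
        z * ((((x - x ^ 2) / 2 : ℝ) : ℂ) * Complex.exp (-(z * x)))) x := by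
    intro x _
    have h0 : HasDerivAt (fun x : ℂ => x - x ^ 2) (1 - (2 : ℕ) * (x : ℂ) ^ (2 - 1)) (x : ℂ) :=
      (hasDerivAt_id (x : ℂ)).sub (hasDerivAt_pow 2 (x : ℂ))
    have h2 : HasDerivAt (fun x : ℂ => (x - x ^ 2) / 2 * Complex.exp (-(z * x)))
        ((1 - (2 : ℕ) * (x : ℂ) ^ (2 - 1)) / 2 * Complex.exp (-(z * x)) +
          (x - x ^ 2) / 2 * (Complex.exp (-(z * x)) * (-(z * 1)))) (x : ℂ) :=
      HasDerivAt.mul (h0.div_const 2) (((hasDerivAt_id _).const_mul z).neg.cexp)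
    convert h2.comp_ofReal using 1
    · funext x; push_cast; rfl
    · push_cast; ring
  have h3 := intervalIntegral.integral_eq_sub_of_hasDerivAt h1
    (Continuous.intervalIntegrable (by fun_prop) _ _)
  rw [intervalIntegral.integral_sub (Continuous.intervalIntegrable (by fun_prop) _ _)
    (Continuous.intervalIntegrable (by fun_prop) _ _), intervalIntegral.integral_const_mul] at h3
  rw [← sub_eq_zero]
  refine h3.trans ?_
  norm_num

theorem norm_hKernel_le_norm {z : ℂ} (hz : 0 ≤ z.re) : ‖hKernel z‖ ≤ ‖z‖ := by
  rw [hKernel_eq_mul, norm_mul]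
  refine mul_le_of_le_one_right (norm_nonneg _) ?_
  have := intervalIntegral.norm_integral_le_of_norm_le_const (a := (0 : ℝ)) (b := 1) (C := 1)
    (f := fun x : ℝ => (((x - x ^ 2) / 2 : ℝ) : ℂ) * Complex.exp (-(z * x))) fun x hx => ?_
  · simpa using this
  · rw [uIoc_of_le zero_le_one] at hx
    rw [norm_mul, Complex.norm_real, Complex.norm_exp, Real.norm_eq_abs]
    have h1 : |(x - x ^ 2) / 2| ≤ 1 := by
      rw [abs_le]; constructor <;> nlinarith [hx.1, hx.2]
    have h2 : Real.exp (-(z * x)).re ≤ 1 := by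
      rw [Real.exp_le_one_iff, Complex.neg_re, Complex.re_mul_ofReal]
      have := mul_nonneg hz hx.1.le
      linarith
    exact mul_le_one₀ h1 (Real.exp_pos _).le h2

theorem integrable_tsum_of_summable_integral_norm {α : Type*} [MeasurableSpace α] {μ : Measure α}
    {F : ℕ → α → ℂ} (hF : ∀ i, Integrable (F i) μ) (hs : Summable fun i => ∫ a, ‖F i a‖ ∂μ)
    (hm : AEStronglyMeasurable (fun a => ∑' i, F i a) μ) : Integrable (fun a => ∑' i, F i a) μ := by
  refine ⟨hm, ?_⟩
  have h1 (i : ℕ) : ∫⁻ a, ‖F i a‖ₑ ∂μ = ENNReal.ofReal (∫ a, ‖F i a‖ ∂μ) :=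
    (ofReal_integral_norm_eq_lintegral_enorm (hF i)).symm
  calc ∫⁻ a, ‖∑' i, F i a‖ₑ ∂μ ≤ ∫⁻ a, ∑' i, ‖F i a‖ₑ ∂μ :=
        lintegral_mono fun a => enorm_tsum_le_tsum_enorm
    _ = ∑' i, ∫⁻ a, ‖F i a‖ₑ ∂μ := lintegral_tsum fun i => (hF i).1.enorm
    _ = ENNReal.ofReal (∑' i, ∫ a, ‖F i a‖ ∂μ) := by
        rw [tsum_congr h1, ENNReal.ofReal_tsum_of_nonneg
          (fun i => integral_nonneg fun a => norm_nonneg _) hs]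
    _ < ⊤ := ENNReal.ofReal_lt_top

/-- Fubini, and `∫₀^∞ e^{-(a + bx) y} dy = 1/(a + bx)`. -/
theorem integral_hKernel_mul_exp {a b : ℂ} (ha : 0 < a.re) (hb : 0 < b.re) :
    ∫ y in Ioi (0 : ℝ), hKernel (b * y) * Complex.exp (-(a * y)) =
      ∫ x in (0 : ℝ)..1, ((1 / 2 - x : ℝ) : ℂ) / (a + b * x) := by
  have h1 : Integrable (Function.uncurry fun x y : ℝ =>
      ((1 / 2 - x : ℝ) : ℂ) * Complex.exp (-(b * y * x)) * Complex.exp (-(a * y)))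
      ((volume.restrict (uIoc (0 : ℝ) 1)).prod (volume.restrict (Ioi (0 : ℝ)))) := by
    have hg : Integrable (fun z : ℝ × ℝ => (1 : ℝ) * Real.exp (-a.re * z.2))
        ((volume.restrict (uIoc (0 : ℝ) 1)).prod (volume.restrict (Ioi (0 : ℝ)))) := by
      refine Integrable.mul_prod (f := fun _ => (1 : ℝ)) (g := fun y => Real.exp (-a.re * y)) ?_
        (integrableOn_exp_mul_Ioi (neg_neg_of_pos ha) 0)
      rw [uIoc_of_le zero_le_one]
      exact integrableOn_const (by simp)
    refine hg.mono' (Continuous.aestronglyMeasurable (by unfold Function.uncurry; fun_prop)) ?_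
    rw [Measure.prod_restrict]
    refine ae_restrict_of_forall_mem (by measurability) fun z hz => ?_
    rw [uIoc_of_le zero_le_one] at hz
    obtain ⟨⟨hx0, hx1⟩, hy⟩ := hz
    have hy' : 0 < z.2 := hy
    rw [Function.uncurry_def, norm_mul, norm_mul, Complex.norm_real, Complex.norm_exp,
      Complex.norm_exp, Real.norm_eq_abs, Complex.neg_re, Complex.neg_re, Complex.re_mul_ofReal,
      Complex.re_mul_ofReal, Complex.re_mul_ofReal, neg_mul]
    refine mul_le_mul_of_nonneg_right (mul_le_one₀ ?_ (Real.exp_pos _).le ?_) (Real.exp_pos _).le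
    · rw [abs_le]; constructor <;> linarith
    · rw [Real.exp_le_one_iff, neg_nonpos]; positivity
  have h2 := intervalIntegral_integral_swap h1
  have h3 : ∫ y in Ioi (0 : ℝ), hKernel (b * y) * Complex.exp (-(a * y)) =
      ∫ y in Ioi (0 : ℝ), ∫ x in (0 : ℝ)..1,
        ((1 / 2 - x : ℝ) : ℂ) * Complex.exp (-(b * y * x)) * Complex.exp (-(a * y)) := by
    refine integral_congr_ae (.of_forall fun y => ?_)
    change hKernel (b * y) * _ = _
    rw [hKernel, ← intervalIntegral.integral_mul_const]
  rw [h3, ← h2]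
  refine intervalIntegral.integral_congr fun x hx => ?_
  rw [uIcc_of_le zero_le_one] at hx
  have hre : (-(a + b * x)).re < 0 := by
    rw [Complex.neg_re, Complex.add_re, Complex.re_mul_ofReal]
    have := mul_nonneg hb.le hx.1
    linarith
  have h4 : ∀ y : ℝ, ((1 / 2 - x : ℝ) : ℂ) * Complex.exp (-(b * y * x)) * Complex.exp (-(a * y)) =
      ((1 / 2 - x : ℝ) : ℂ) * Complex.exp (-(a + b * x) * y) := by
    intro y
    rw [mul_assoc, ← Complex.exp_add]
    congr 2
    ring
  simp only [h4]
  rw [integral_const_mul, integral_exp_mul_complex_Ioi hre, Complex.ofReal_zero, mul_zero,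
    Complex.exp_zero, neg_div_neg_eq, mul_one_div]

/-- The terms of the Laplace integrand of the kernel. -/
noncomputable def laplaceTerm (b : ℂ) (s : ℝ) (n : ℕ) (y : ℝ) : ℂ :=
  b * (hKernel (b * y) * Complex.exp (-((s + b * n) * y)))

theorem continuous_laplaceTerm (b : ℂ) (s : ℝ) (n : ℕ) : Continuous (laplaceTerm b s n) := by
  have := hKernel_differentiable.continuous
  unfold laplaceTerm
  fun_prop

theorem integral_laplaceTerm {b : ℂ} {s : ℝ} (hb : 0 < b.re) (hs : 0 < s) (n : ℕ) :
    ∫ y in Ioi (0 : ℝ), laplaceTerm b s n y = gudermannTerm (s / b) n := by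
  have hb0 : b ≠ 0 := fun h => by rw [h] at hb; exact lt_irrefl _ hb
  have ha : 0 < ((s : ℂ) + b * n).re := by
    rw [Complex.add_re, Complex.ofReal_re, ← Complex.ofReal_natCast, Complex.re_mul_ofReal]
    positivity
  have hw : 0 < ((s : ℂ) / b).re := by
    rw [Complex.div_re, Complex.ofReal_re, Complex.ofReal_im]
    have := Complex.normSq_pos.2 hb0
    have : 0 < s * b.re / Complex.normSq b := by positivity
    simpa using this
  unfold laplaceTerm
  rw [integral_const_mul, integral_hKernel_mul_exp ha hb, ← integral_gudermannTerm hw,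
    ← intervalIntegral.integral_const_mul]
  refine intervalIntegral.integral_congr fun x hx => ?_
  have h1 : (s : ℂ) / b + n + x = (s + b * n + b * x) / b := by field_simp
  rw [h1]
  field_simp

theorem norm_laplaceTerm_le {b : ℂ} {s : ℝ} (hb : 0 < b.re) (n : ℕ) {y : ℝ} (hy : 0 < y) :
    ‖laplaceTerm b s n y‖ ≤ ‖b‖ ^ 2 * (y ^ ((2 : ℝ) - 1) * Real.exp (-((s + b.re * n) * y))) := by
  have h0 : 0 ≤ (b * y).re := by rw [Complex.re_mul_ofReal]; positivity
  have h1 := norm_hKernel_le_norm h0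
  have h2 : ‖Complex.exp (-((s + b * n) * y))‖ = Real.exp (-((s + b.re * n) * y)) := by
    rw [Complex.norm_exp]
    congr 1
    rw [Complex.neg_re, Complex.re_mul_ofReal, Complex.add_re, Complex.ofReal_re,
      ← Complex.ofReal_natCast, Complex.re_mul_ofReal]
  unfold laplaceTerm
  rw [norm_mul, norm_mul, h2]
  rw [norm_mul, Complex.norm_real, Real.norm_of_nonneg hy.le] at h1
  have h3 : y ^ ((2 : ℝ) - 1) = y := by norm_num
  rw [h3]
  calc ‖b‖ * (‖hKernel (b * y)‖ * Real.exp (-((s + b.re * n) * y))) ≤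
      ‖b‖ * (‖b‖ * y * Real.exp (-((s + b.re * n) * y))) := by gcongr
    _ = _ := by ring

theorem integrableOn_rpow_mul_exp {c : ℝ} (hc : 0 < c) :
    IntegrableOn (fun y : ℝ => y ^ ((2 : ℝ) - 1) * Real.exp (-(c * y))) (Ioi 0) := by
  refine (integrableOn_rpow_mul_exp_neg_mul_rpow (s := (2 : ℝ) - 1) (p := 1) (by norm_num)
    one_pos hc).congr_fun (fun y hy => ?_) measurableSet_Ioi
  simp only [Real.rpow_one, neg_mul]

theorem integrableOn_laplaceTerm {b : ℂ} {s : ℝ} (hb : 0 < b.re) (hs : 0 < s) (n : ℕ) :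
    IntegrableOn (laplaceTerm b s n) (Ioi 0) := by
  refine Integrable.mono' ((integrableOn_rpow_mul_exp (c := s + b.re * n) (by positivity)).const_mul
    (‖b‖ ^ 2)) (continuous_laplaceTerm b s n).aestronglyMeasurable ?_
  exact ae_restrict_of_forall_mem measurableSet_Ioi fun y hy => norm_laplaceTerm_le hb n hy

theorem integral_norm_laplaceTerm_le {b : ℂ} {s : ℝ} (hb : 0 < b.re) (hs : 0 < s) (n : ℕ) :
    ∫ y in Ioi (0 : ℝ), ‖laplaceTerm b s n y‖ ≤ ‖b‖ ^ 2 * ((s + b.re * n) ^ 2)⁻¹ := by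
  have hc : 0 < s + b.re * n := by positivity
  calc ∫ y in Ioi (0 : ℝ), ‖laplaceTerm b s n y‖ ≤ ∫ y in Ioi (0 : ℝ),
        ‖b‖ ^ 2 * (y ^ ((2 : ℝ) - 1) * Real.exp (-((s + b.re * n) * y))) :=
        setIntegral_mono_on (integrableOn_laplaceTerm hb hs n).norm
          ((integrableOn_rpow_mul_exp hc).const_mul _) measurableSet_Ioi
          fun y hy => norm_laplaceTerm_le hb n hy
    _ = _ := by
        rw [integral_const_mul, Real.integral_rpow_mul_exp_neg_mul_Ioi two_pos hc, Real.Gamma_two]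
        norm_num

theorem summable_integral_norm_laplaceTerm {b : ℂ} {s : ℝ} (hb : 0 < b.re) (hs : 0 < s) :
    Summable fun n => ∫ y in Ioi (0 : ℝ), ‖laplaceTerm b s n y‖ := by
  set m := min s b.re
  have hm : 0 < m := lt_min hs hb
  have h1 : Summable fun n : ℕ => (‖b‖ ^ 2 * (m ^ 2)⁻¹) * (((n + 1 : ℕ) : ℝ) ^ 2)⁻¹ :=
    ((summable_nat_add_iff 1).2 (Real.summable_nat_pow_inv.2 (le_refl 2))).mul_left _
  refine .of_nonneg_of_le (fun n => integral_nonneg fun _ => norm_nonneg _) (fun n => ?_) h1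
  refine (integral_norm_laplaceTerm_le hb hs n).trans ?_
  rw [mul_assoc, ← mul_inv, ← mul_pow]
  have h2 : m * ((n + 1 : ℕ) : ℝ) ≤ s + b.re * n := by
    push_cast
    have e1 : m ≤ s := min_le_left _ _
    have e2 : m ≤ b.re := min_le_right _ _
    nlinarith [(Nat.cast_nonneg n : (0 : ℝ) ≤ n)]
  gcongr

/-- The sum over `n` is geometric with ratio `e^{-by}`, of modulus less than one because `Re b = 2π
sin φ > 0`. The quotient `h(by)/(1 - e^{-by})` is then evaluated by the expansion of the cotangent.
-/
theorem tsum_laplaceTerm {φ : ℝ} (h : 0 < Real.sin φ) (s : ℝ) {y : ℝ} (hy : 0 < y) :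
    ∑' n, laplaceTerm (-(2 * Real.pi * Complex.I) * unitAt φ) s n y =
      (Real.exp (-(s * y)) : ℂ) * (-(Complex.I / Real.pi) * unitAt φ *
        qTail 0 (unitAt φ * y)) := by
  have hpi : (Real.pi : ℂ) ≠ 0 := by exact_mod_cast Real.pi_ne_zero
  set b : ℂ := -(2 * Real.pi * Complex.I) * unitAt φ with hb
  have hbre : b.re = 2 * Real.pi * Real.sin φ := by
    rw [hb, show -(2 * Real.pi * Complex.I) * unitAt φ =
      ((2 * Real.pi : ℝ) : ℂ) * (-(Complex.I * unitAt φ)) by push_cast; ring,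
      Complex.re_ofReal_mul, Complex.neg_re, Complex.I_mul_re, unitAt_im, neg_neg]
  have hlt : ‖Complex.exp (-(b * y))‖ < 1 := by
    rw [Complex.norm_exp, Real.exp_lt_one_iff, Complex.neg_re, Complex.re_mul_ofReal, hbre]
    have := Real.pi_pos
    have : 0 < 2 * Real.pi * Real.sin φ * y := by positivity
    linarith
  have h1 (n : ℕ) : laplaceTerm b s n y =
      b * hKernel (b * y) * Complex.exp (-(s * y)) * Complex.exp (-(b * y)) ^ n := by
    rw [laplaceTerm, ← Complex.exp_nat_mul,
      show -((s + b * n) * (y : ℂ)) = -(s * y) + n * -(b * y) by ring, Complex.exp_add]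
    ring
  have hz := neg_mem_slitPlaneFrom (unitAt_mul_mem_slitPlaneFrom h.ne' y)
  have h2 := one_sub_exp_mul_qTail hz
  rw [qTail_neg, show 2 * Real.pi * Complex.I * -(unitAt φ * y) = b * y by rw [hb]; ring] at h2
  have h3 : 1 - Complex.exp (-(b * y)) ≠ 0 := by
    intro h3
    rw [← sub_eq_zero.1 h3] at hlt
    simp at hlt
  rw [tsum_congr h1, tsum_mul_left, tsum_geometric_of_norm_lt_one hlt]
  push_cast
  rw [← div_eq_mul_inv, div_eq_iff h3]
  have h4 : Complex.I / Real.pi * Real.pi ^ 2 = Complex.I * Real.pi := by field_simp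
  set E := Complex.exp (-(s * y))
  set k := hKernel (b * y)
  linear_combination (E * k) * hb + (E * (Complex.I / Real.pi) * unitAt φ) * h2 +
    (2 * E * k * unitAt φ) * h4

theorem continuous_qTail_ray {φ : ℝ} (h : 0 < Real.sin φ) :
    Continuous fun y : ℝ => qTail 0 (unitAt φ * y) :=
  ((qTail_differentiableOn 0).continuousOn).comp_continuous (by fun_prop)
    fun y => unitAt_mul_mem_slitPlaneFrom h.ne' y

/-- The Laplace transform of the kernel in terms of Gudermann's series. -/
theorem exists_hasSum_gudermannTerm {φ s : ℝ} (h : 0 < Real.sin φ) (hs : 0 < s) :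
    ∃ S : ℂ, HasSum (gudermannTerm (s / (-(2 * Real.pi * Complex.I) * unitAt φ))) S ∧
      ∫⁻ y in Ioi (0 : ℝ), ENNReal.ofReal (Real.exp (-(s * y)) * (kernel φ y).re) =
        ENNReal.ofReal (6 * S.re) ∧ 0 ≤ 6 * S.re := by
  have hpi := Real.pi_pos
  set b : ℂ := -(2 * Real.pi * Complex.I) * unitAt φ with hb
  have hbre : 0 < b.re := by
    rw [hb, show -(2 * Real.pi * Complex.I) * unitAt φ =
      ((2 * Real.pi : ℝ) : ℂ) * (-(Complex.I * unitAt φ)) by push_cast; ring,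
      Complex.re_ofReal_mul, Complex.neg_re, Complex.I_mul_re, unitAt_im, neg_neg]
    positivity
  have hF := integrableOn_laplaceTerm hbre hs
  have hsum := summable_integral_norm_laplaceTerm hbre hs
  have heq : ∀ᵐ y ∂(volume.restrict (Ioi (0 : ℝ))), (Real.exp (-(s * y)) : ℂ) *
      (-(Complex.I / Real.pi) * unitAt φ * qTail 0 (unitAt φ * y)) =
      ∑' n, laplaceTerm b s n y :=
    ae_restrict_of_forall_mem measurableSet_Ioi fun y hy => (tsum_laplaceTerm h s hy).symm
  have hint := integrable_tsum_of_summable_integral_norm hF hsum (AEStronglyMeasurable.congr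
    (Continuous.aestronglyMeasurable (by
      have := continuous_qTail_ray h
      fun_prop)) heq)
  have hS := hasSum_integral_of_summable_integral_norm hF hsum
  simp only [integral_laplaceTerm hbre hs] at hS
  refine ⟨_, hS, ?_⟩
  have h1 : ∀ᵐ y ∂(volume.restrict (Ioi (0 : ℝ))), Real.exp (-(s * y)) * (kernel φ y).re =
      6 * (∑' n, laplaceTerm b s n y).re := by
    filter_upwards [heq] with y hy
    rw [← hy, Complex.re_ofReal_mul, kernel_re,
      show -(Complex.I / Real.pi) * unitAt φ * qTail 0 (unitAt φ * y) = ((Real.pi⁻¹ : ℝ) : ℂ) *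
        (-(Complex.I * unitAt φ * qTail 0 (unitAt φ * y))) by push_cast; ring,
      Complex.re_ofReal_mul]
    ring
  have h2 : Integrable (fun y => 6 * (∑' n, laplaceTerm b s n y).re)
      (volume.restrict (Ioi (0 : ℝ))) := hint.re.const_mul 6
  have h3 : ∫ y in Ioi (0 : ℝ), Real.exp (-(s * y)) * (kernel φ y).re =
      6 * (∫ y in Ioi (0 : ℝ), ∑' n, laplaceTerm b s n y).re := by
    rw [integral_congr_ae h1, integral_const_mul]
    exact congrArg (6 * ·) (integral_re hint)
  have h4 (y : ℝ) : 0 ≤ Real.exp (-(s * y)) * (kernel φ y).re :=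
    mul_nonneg (Real.exp_pos _).le (kernel_pos h y).le
  rw [← h3]
  exact ⟨(ofReal_integral_eq_lintegral_ofReal (h2.congr (h1.mono fun y hy => hy.symm))
    (.of_forall h4)).symm, integral_nonneg h4⟩

/-- The logarithm of `Z_φ` splits into the linear term `-β ω_φ`, which becomes the point mass, and a
Laplace transform. The factor `6` is the exponent of `|Γ|` in `Z_φ`. -/
theorem partitionFunction_eq {η φ β : ℝ} (hη : 0 < η) (hφ : 0 < φ) (hφ' : φ ≤ Real.pi / 2)
    (hβ : 0 < β) : ∃ Λ : ℝ, 0 ≤ Λ ∧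
      partitionFunction η φ β = Real.exp (-(β * groundFrequency η φ)) * Real.exp Λ ∧
      ∫⁻ y in Ioi (0 : ℝ), ENNReal.ofReal (Real.exp (-(β * η * y)) * (kernel φ y).re) =
        ENNReal.ofReal Λ := by
  have hpi := Real.pi_pos
  have hsin : 0 < Real.sin φ := Real.sin_pos_of_pos_of_lt_pi hφ (by linarith)
  obtain ⟨S, hS, hlap, hnn⟩ := exists_hasSum_gudermannTerm hsin (mul_pos hβ hη)
  refine ⟨6 * S.re, hnn, ?_, hlap⟩
  set ρ : ℝ := η * β / (2 * Real.pi) with hρ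
  have hρ0 : 0 < ρ := by positivity
  -- Polar form of the argument of `Γ`: the angle `π/2 - φ` lies in `[0, π/2)`, which gives both `Re
  -- w > 0` and the principal logarithm.
  set w : ℂ := ρ * Complex.exp (((Real.pi / 2 - φ : ℝ) : ℂ) * Complex.I) with hw
  have hw1 : w = Complex.I * ρ * Complex.exp (-(Complex.I * φ)) := by
    have : Complex.exp (((Real.pi / 2 - φ : ℝ) : ℂ) * Complex.I) =
        Complex.exp (Real.pi / 2 * Complex.I) * Complex.exp (-(Complex.I * φ)) := by
      rw [← Complex.exp_add]; congr 1; push_cast; ring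
    rw [hw, this, Complex.exp_pi_div_two_mul_I]
    ring
  have hw2 : ((β * η : ℝ) : ℂ) / (-(2 * Real.pi * Complex.I) * unitAt φ) = w := by
    have hpc : (Real.pi : ℂ) ≠ 0 := by exact_mod_cast hpi.ne'
    have h1 : Complex.exp (-(Complex.I * φ)) * unitAt φ = 1 := by
      rw [unitAt, ← Complex.exp_add, neg_add_cancel, Complex.exp_zero]
    rw [hw1, div_eq_iff (by simp [hpc, Complex.I_ne_zero, unitAt_ne_zero]), hρ]
    push_cast
    field_simp
    linear_combination (β * η * Complex.I ^ 2) * h1 + (β * η) * Complex.I_sq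
  have hre : w.re = ρ * Real.sin φ := by
    rw [hw, Complex.re_ofReal_mul, Complex.exp_ofReal_mul_I_re, Real.cos_pi_div_two_sub]
  have him : w.im = ρ * Real.cos φ := by
    rw [hw, Complex.im_ofReal_mul, Complex.exp_ofReal_mul_I_im, Real.sin_pi_div_two_sub]
  have hlog : Complex.log w = Real.log ρ + ((Real.pi / 2 - φ : ℝ) : ℂ) * Complex.I := by
    rw [hw, Complex.log_ofReal_mul hρ0 (Complex.exp_ne_zero _), Complex.log_exp]
    · rw [Complex.im_ofReal_mul, Complex.I_im]; linarith
    · rw [Complex.im_ofReal_mul, Complex.I_im]; linarith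
  rw [hw2] at hS
  have hG := exp_mul_eq_gamma (by rw [hre]; positivity) hS
  have hG2 : ‖Complex.Gamma w‖ ^ 2 = 2 * Real.pi * Real.exp (2 * ((ρ * Real.sin φ - 1 / 2) *
      Real.log ρ - ρ * Real.cos φ * (Real.pi / 2 - φ) - ρ * Real.sin φ + S.re)) := by
    rw [hG, norm_mul, Complex.norm_real, Real.norm_of_nonneg (Real.sqrt_nonneg _), Complex.norm_exp,
      mul_pow, Real.sq_sqrt (by positivity), ← Real.exp_nat_mul]
    congr 3
    rw [hlog, Complex.add_re, Complex.sub_re, Complex.mul_re, Complex.sub_re, Complex.sub_im,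
      hre, him]
    simp
  -- `ρ / (2π)` cancels the factor `2π ρ⁻¹` of `|Γ|²`, and the exponential prefactor cancels `ρ ^
  -- (2ρ sin φ)`; apart from `S`, the exponent is linear in `ρ`.
  have hexp : ρ / (2 * Real.pi) * Real.exp (-2 * ρ * Real.log ρ * Real.sin φ) *
      ‖Complex.Gamma w‖ ^ 2 = Real.exp (-(2 * ρ * (Real.sin φ + (Real.pi / 2 - φ) * Real.cos φ)) +
        2 * S.re) := by
    rw [hG2]
    calc _ = Real.exp (Real.log ρ) * Real.exp (-2 * ρ * Real.log ρ * Real.sin φ) *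
          Real.exp (2 * ((ρ * Real.sin φ - 1 / 2) * Real.log ρ -
            ρ * Real.cos φ * (Real.pi / 2 - φ) - ρ * Real.sin φ + S.re)) := by
          rw [Real.exp_log hρ0]; field_simp
      _ = _ := by rw [← Real.exp_add, ← Real.exp_add]; congr 1; ring
  unfold partitionFunction
  simp only
  rw [← hρ, ← hw1, hexp, ← Real.exp_nat_mul, ← Real.exp_add, groundFrequency, hρ]
  congr 1
  field_simp
  push_cast
  ring

/-! ### Laplace transforms of convolution powers -/

/-- The Laplace transform of a continuous nonnegative convolution is the product of the Laplace
transforms. -/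
theorem lintegral_exp_mul_conv {k c : ℝ → ℝ} (hk : Continuous k) (hc : Continuous c)
    (hk0 : ∀ y, 0 ≤ y → 0 ≤ k y) (hc0 : ∀ y, 0 ≤ y → 0 ≤ c y) (s : ℝ) :
    ∫⁻ y in Ioi (0 : ℝ), ENNReal.ofReal (Real.exp (-(s * y)) * ∫ t in (0 : ℝ)..y, k t * c (y - t)) =
      (∫⁻ y in Ioi (0 : ℝ), ENNReal.ofReal (Real.exp (-(s * y)) * k y)) *
        ∫⁻ y in Ioi (0 : ℝ), ENNReal.ofReal (Real.exp (-(s * y)) * c y) := by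
  set A : ℝ → ENNReal := (Ioi 0).indicator fun y => ENNReal.ofReal (Real.exp (-(s * y)) * k y)
    with hA
  set B : ℝ → ENNReal := (Ioi 0).indicator fun y => ENNReal.ofReal (Real.exp (-(s * y)) * c y)
    with hB
  have hAm : Measurable A := Measurable.indicator (by fun_prop) measurableSet_Ioi
  have hBm : Measurable B := Measurable.indicator (by fun_prop) measurableSet_Ioi
  -- Once `A` and `B` are extended by zero, the half-line convolution is a convolution on the whole
  -- line, and Tonelli with translation invariance gives the product.
  have hin (y : ℝ) : ∫⁻ t, A t * B (y - t) = (Ioi 0).indicator (fun y =>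
      ENNReal.ofReal (Real.exp (-(s * y)) * ∫ t in (0 : ℝ)..y, k t * c (y - t))) y := by
    by_cases hy : 0 < y
    · rw [indicator_of_mem (mem_Ioi.2 hy)]
      have h1 : ∀ t, A t * B (y - t) = (Ioo 0 y).indicator (fun t =>
          ENNReal.ofReal (Real.exp (-(s * y)) * (k t * c (y - t)))) t := by
        intro t
        by_cases ht : t ∈ Ioo 0 y
        · rw [indicator_of_mem ht, hA, hB, indicator_of_mem (mem_Ioi.2 ht.1),
            indicator_of_mem (mem_Ioi.2 (sub_pos.2 ht.2)), ← ENNReal.ofReal_mul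
              (mul_nonneg (Real.exp_pos _).le (hk0 t ht.1.le))]
          congr 1
          rw [show -(s * y) = -(s * t) + -(s * (y - t)) by ring, Real.exp_add]
          ring
        · rw [indicator_of_notMem ht]
          rw [mem_Ioo, not_and_or] at ht
          rcases ht with ht | ht
          · rw [hA, indicator_of_notMem (by simpa using ht), zero_mul]
          · rw [hB, indicator_of_notMem (by simpa using ht), mul_zero]
      rw [lintegral_congr h1, lintegral_indicator measurableSet_Ioo,
        Measure.restrict_congr_set Ioo_ae_eq_Ioc, ← intervalIntegral.integral_const_mul,
        intervalIntegral.integral_of_le hy.le, ofReal_integral_eq_lintegral_ofReal]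
      · exact Continuous.integrableOn_Ioc (by fun_prop)
      · refine ae_restrict_of_forall_mem measurableSet_Ioc fun t ht => ?_
        exact mul_nonneg (Real.exp_pos _).le
          (mul_nonneg (hk0 t ht.1.le) (hc0 _ (sub_nonneg.2 ht.2)))
    · rw [indicator_of_notMem (by simpa using hy), ← lintegral_zero]
      refine lintegral_congr fun t => ?_
      by_cases ht : 0 < t
      · rw [hB, indicator_of_notMem (by rw [mem_Ioi]; linarith), mul_zero]
      · rw [hA, indicator_of_notMem (by simpa using ht), zero_mul]
  rw [← lintegral_indicator measurableSet_Ioi, ← lintegral_indicator measurableSet_Ioi,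
    ← lintegral_indicator measurableSet_Ioi, ← hA, ← hB, ← lintegral_congr hin,
    lintegral_lintegral_swap, ← lintegral_mul_const _ hAm]
  · refine lintegral_congr fun t => ?_
    rw [lintegral_const_mul _ (by fun_prop), lintegral_sub_right_eq_self B t]
  · exact Measurable.aemeasurable (by unfold Function.uncurry; fun_prop)

theorem segConv_ofReal {f g : ℂ → ℂ} {k c : ℝ → ℝ} (hf : ∀ y : ℝ, f y = k y)
    (hg : ∀ y : ℝ, g y = c y) (y : ℝ) :
    segConv f g y = ((∫ t in (0 : ℝ)..y, k t * c (y - t) : ℝ) : ℂ) := by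
  have h1 := intervalIntegral.mul_integral_comp_mul_right (a := 0) (b := 1)
    (f := fun t => k t * c (y - t)) y
  rw [zero_mul, one_mul] at h1
  rw [← h1, segConv, Complex.ofReal_mul, ← intervalIntegral.integral_ofReal]
  congr 1
  refine intervalIntegral.integral_congr fun t _ => ?_
  rw [← Complex.ofReal_mul, ← Complex.ofReal_mul, hf, hg, ← Complex.ofReal_mul]
  congr 3
  ring

/-- The iterated convolutions of the kernel on the real half-line. -/
noncomputable def kernelPow (φ : ℝ) (n : ℕ) (y : ℝ) : ℝ := (convPow (kernel φ) n y).re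

theorem kernel_ofReal (φ y : ℝ) : kernel φ y = ((kernel φ y).re : ℂ) :=
  Complex.ext (by simp) (by simp [kernel_im])

theorem convPow_kernel_ofReal (φ : ℝ) (n : ℕ) (y : ℝ) :
    convPow (kernel φ) n y = (kernelPow φ n y : ℂ) := by
  induction n generalizing y with
  | zero => exact kernel_ofReal φ y
  | succ n ih =>
    have h := segConv_ofReal (kernel_ofReal φ) ih y
    rw [kernelPow, convPow, h, Complex.ofReal_re]

theorem kernelPow_succ (φ : ℝ) (n : ℕ) (y : ℝ) :
    kernelPow φ (n + 1) y = ∫ t in (0 : ℝ)..y, (kernel φ t).re * kernelPow φ n (y - t) := by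
  rw [kernelPow, convPow, segConv_ofReal (kernel_ofReal φ) (convPow_kernel_ofReal φ n),
    Complex.ofReal_re]

theorem continuous_kernelPow {φ : ℝ} (h : 0 < Real.sin φ) (n : ℕ) : Continuous (kernelPow φ n) :=
  Complex.continuous_re.comp (((convPow_differentiableOn (isOpen_kernelDomain φ)
    (isStar_kernelDomain φ) (kernel_differentiableOn φ) n).continuousOn).comp_continuous
    Complex.continuous_ofReal (ofReal_mem_kernelDomain h))

theorem kernelPow_nonneg {φ : ℝ} (h : 0 < Real.sin φ) (n : ℕ) {y : ℝ} (hy : 0 ≤ y) :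
    0 ≤ kernelPow φ n y := by
  induction n generalizing y with
  | zero => exact (kernel_pos h y).le
  | succ n ih =>
    rw [kernelPow_succ]
    exact intervalIntegral.integral_nonneg hy fun t ht =>
      mul_nonneg (kernel_pos h t).le (ih (sub_nonneg.2 ht.2))

theorem lintegral_exp_mul_kernelPow {φ : ℝ} (h : 0 < Real.sin φ) (s : ℝ) (n : ℕ) :
    ∫⁻ y in Ioi (0 : ℝ), ENNReal.ofReal (Real.exp (-(s * y)) * kernelPow φ n y) =
      (∫⁻ y in Ioi (0 : ℝ), ENNReal.ofReal (Real.exp (-(s * y)) * (kernel φ y).re)) ^ (n + 1) := by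
  induction n with
  | zero => rw [zero_add, pow_one]; rfl
  | succ n ih =>
    simp only [kernelPow_succ]
    rw [lintegral_exp_mul_conv (k := fun y => (kernel φ y).re) (continuous_kernelPow h 0)
      (continuous_kernelPow h n) (fun y _ => (kernel_pos h y).le)
      (fun y hy => kernelPow_nonneg h n hy), ih, pow_succ' _ (n + 1)]

theorem hasSum_convExp_kernel {φ : ℝ} (h : 0 < Real.sin φ) (y : ℝ) :
    HasSum (fun n => kernelPow φ n y / ((n + 1).factorial : ℝ)) (convExp (kernel φ) y).re := by
  have h1 := summable_convExp (isStar_kernelDomain φ) (kernel_differentiableOn φ).continuousOn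
    (ofReal_mem_kernelDomain h y)
  convert! Complex.hasSum_re h1.hasSum using 2 with n
  rw [convPow_kernel_ofReal, ← Complex.ofReal_natCast, ← Complex.ofReal_div, Complex.ofReal_re]

theorem convExp_kernel_pos {φ : ℝ} (h : 0 < Real.sin φ) {y : ℝ} (hy : 0 ≤ y) :
    0 < (convExp (kernel φ) y).re := by
  rw [← (hasSum_convExp_kernel h y).tsum_eq]
  refine (hasSum_convExp_kernel h y).summable.tsum_pos
    (fun n => div_nonneg (kernelPow_nonneg h n hy) (by positivity)) 0 ?_
  simp only [zero_add, Nat.factorial_one, Nat.cast_one, div_one]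
  exact kernel_pos h y

theorem convExp_kernel_zero (φ : ℝ) : convExp (kernel φ) 0 = kernel φ 0 := by
  unfold convExp
  rw [tsum_eq_single 0]
  · simp [convPow]
  · intro n hn
    obtain ⟨m, rfl⟩ := Nat.exists_eq_succ_of_ne_zero hn
    simp [convPow, segConv]

/-- The `n`th term of the convolution exponential has transform `Λ^(n+1)/(n+1)!`; all terms are
nonnegative, so the sum and the integral may be interchanged freely. -/
theorem lintegral_exp_mul_convExp_kernel {φ s Λ : ℝ} (h : 0 < Real.sin φ) (hΛ : 0 ≤ Λ)
    (hK : ∫⁻ y in Ioi (0 : ℝ), ENNReal.ofReal (Real.exp (-(s * y)) * (kernel φ y).re) =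
      ENNReal.ofReal Λ) :
    ∫⁻ y in Ioi (0 : ℝ), ENNReal.ofReal (Real.exp (-(s * y)) * (convExp (kernel φ) y).re) =
      ENNReal.ofReal (Real.exp Λ - 1) := by
  have h1 : ∀ y ∈ Ioi (0 : ℝ),
      ENNReal.ofReal (Real.exp (-(s * y)) * (convExp (kernel φ) y).re) =
        ∑' n : ℕ, ENNReal.ofReal ((((n + 1).factorial : ℝ))⁻¹ *
          (Real.exp (-(s * y)) * kernelPow φ n y)) := by
    intro y hy
    have h2 := (hasSum_convExp_kernel h y).mul_left (Real.exp (-(s * y)))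
    rw [← h2.tsum_eq, ENNReal.ofReal_tsum_of_nonneg _ h2.summable]
    · refine tsum_congr fun n => ?_
      congr 1
      ring
    · exact fun n => mul_nonneg (Real.exp_pos _).le
        (div_nonneg (kernelPow_nonneg h n (mem_Ioi.1 hy).le) (by positivity))
  have h3 (n : ℕ) : Measurable fun y => ENNReal.ofReal ((((n + 1).factorial : ℝ))⁻¹ *
      (Real.exp (-(s * y)) * kernelPow φ n y)) := by
    have := continuous_kernelPow h n
    fun_prop
  have h4 (n : ℕ) : ∫⁻ y in Ioi (0 : ℝ), ENNReal.ofReal ((((n + 1).factorial : ℝ))⁻¹ *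
      (Real.exp (-(s * y)) * kernelPow φ n y)) =
      ENNReal.ofReal (Λ ^ (n + 1) / ((n + 1).factorial : ℝ)) := by
    have h5 : Measurable fun y => ENNReal.ofReal (Real.exp (-(s * y)) * kernelPow φ n y) := by
      have := continuous_kernelPow h n
      fun_prop
    simp only [ENNReal.ofReal_mul (inv_nonneg.2 (Nat.cast_nonneg (α := ℝ) (n + 1).factorial))]
    rw [lintegral_const_mul _ h5, lintegral_exp_mul_kernelPow h, hK,
      ← ENNReal.ofReal_pow hΛ, ← ENNReal.ofReal_mul (by positivity)]
    congr 1
    ring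
  have h6 : HasSum (fun n : ℕ => Λ ^ (n + 1) / ((n + 1).factorial : ℝ)) (Real.exp Λ - 1) := by
    have h7 := (hasSum_nat_add_iff' 1).2 (NormedSpace.expSeries_div_hasSum_exp Λ)
    rw [← Real.exp_eq_exp_ℝ] at h7
    simpa using h7
  rw [setLIntegral_congr_fun measurableSet_Ioi h1, lintegral_tsum fun n => (h3 n).aemeasurable,
    tsum_congr h4, ← ENNReal.ofReal_tsum_of_nonneg (fun n => by positivity) h6.summable,
    h6.tsum_eq]

/-! ### Uniqueness of the measure -/

/-- A measure on the line is determined by its Laplace transform on the half-line of positive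
reals, if that is finite. -/
theorem ext_of_lintegral_exp {μ ν : Measure ℝ}
    (hμ : ∀ β : ℝ, 0 < β → ∫⁻ x, ENNReal.ofReal (Real.exp (-(β * x))) ∂μ ≠ ⊤)
    (h : ∀ β : ℝ, 0 < β → ∫⁻ x, ENNReal.ofReal (Real.exp (-(β * x))) ∂μ =
      ∫⁻ x, ENNReal.ofReal (Real.exp (-(β * x))) ∂ν) : μ = ν := by
  -- The measures may be infinite; the weight `e^{-x}` makes them finite, with moment generating
  -- function defined for all `t < 1`.
  set w : ℝ → ENNReal := fun x => ENNReal.ofReal (Real.exp (-x)) with hw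
  have hwm : Measurable w := by fun_prop
  have hlap (κ : Measure ℝ) (t : ℝ) :
      ∫⁻ x, ENNReal.ofReal (Real.exp (t * x)) ∂(κ.withDensity w) =
        ∫⁻ x, ENNReal.ofReal (Real.exp (-((1 - t) * x))) ∂κ := by
    rw [lintegral_withDensity_eq_lintegral_mul _ hwm (by fun_prop)]
    refine lintegral_congr fun x => ?_
    rw [Pi.mul_apply, hw, ← ENNReal.ofReal_mul (Real.exp_pos _).le, ← Real.exp_add]
    congr 2
    ring
  have hint (κ : Measure ℝ)
      (hκ : ∀ β : ℝ, 0 < β → ∫⁻ x, ENNReal.ofReal (Real.exp (-(β * x))) ∂κ ≠ ⊤)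
      {t : ℝ} (ht : t < 1) : Integrable (fun x => Real.exp (t * x)) (κ.withDensity w) := by
    refine (lintegral_ofReal_ne_top_iff_integrable (by fun_prop)
      (.of_forall fun x => (Real.exp_pos _).le)).1 ?_
    rw [hlap]
    exact hκ _ (sub_pos.2 ht)
  have hν : ∀ β : ℝ, 0 < β → ∫⁻ x, ENNReal.ofReal (Real.exp (-(β * x))) ∂ν ≠ ⊤ :=
    fun β hβ => by rw [← h β hβ]; exact hμ β hβ
  have hfin (κ : Measure ℝ)
      (hκ : ∀ β : ℝ, 0 < β → ∫⁻ x, ENNReal.ofReal (Real.exp (-(β * x))) ∂κ ≠ ⊤) :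
      IsFiniteMeasure (κ.withDensity w) := by
    refine ⟨?_⟩
    have h1 := hlap κ 0
    simp only [zero_mul, Real.exp_zero, ENNReal.ofReal_one, lintegral_const, one_mul] at h1
    rw [h1]
    exact (hκ _ (by norm_num)).lt_top
  have hset (κ : Measure ℝ)
      (hκ : ∀ β : ℝ, 0 < β → ∫⁻ x, ENNReal.ofReal (Real.exp (-(β * x))) ∂κ ≠ ⊤) :
      AnalyticOnNhd ℂ (ProbabilityTheory.complexMGF id (κ.withDensity w)) {z | z.re < 1} := by
    refine ProbabilityTheory.analyticOnNhd_complexMGF.mono fun z hz => ?_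
    exact interior_maximal (fun t (ht : t < 1) => hint κ hκ ht) isOpen_Iio hz
  have hmgf (t : ℝ) (ht : t < 1) : ProbabilityTheory.complexMGF id (μ.withDensity w) t =
      ProbabilityTheory.complexMGF id (ν.withDensity w) t := by
    rw [ProbabilityTheory.complexMGF_ofReal, ProbabilityTheory.complexMGF_ofReal]
    unfold ProbabilityTheory.mgf
    simp only [id]
    rw [integral_eq_lintegral_of_nonneg_ae (.of_forall fun x => (Real.exp_pos _).le)
      (by fun_prop), integral_eq_lintegral_of_nonneg_ae (.of_forall fun x => (Real.exp_pos _).le)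
      (by fun_prop), hlap, hlap, h _ (sub_pos.2 ht)]
  -- By the identity theorem, agreement for real `t < 1` extends to the half-plane `Re z < 1`. This
  -- contains the imaginary axis, where the values are the characteristic functions.
  have hEq : EqOn (ProbabilityTheory.complexMGF id (μ.withDensity w))
      (ProbabilityTheory.complexMGF id (ν.withDensity w)) {z | z.re < 1} := by
    refine AnalyticOnNhd.eqOn_of_preconnected_of_frequently_eq (hset μ hμ) (hset ν hν)
      (convex_halfSpace_re_lt 1).isPreconnected (z₀ := (0 : ℂ)) (by simp) ?_
    have h1 : Tendsto (fun x : ℝ => (x : ℂ)) (𝓝[≠] 0) (𝓝[≠] 0) := by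
      refine tendsto_nhdsWithin_iff.2 ⟨?_, ?_⟩
      · exact (Complex.continuous_ofReal.tendsto' 0 0 (by simp)).mono_left nhdsWithin_le_nhds
      · filter_upwards [self_mem_nhdsWithin] with x hx
        simpa using hx
    refine h1.frequently (Eventually.frequently ?_)
    filter_upwards [nhdsWithin_le_nhds (Iio_mem_nhds one_pos)] with t ht
    exact hmgf t ht
  have := hfin μ hμ
  have := hfin ν hν
  have hwd : μ.withDensity w = ν.withDensity w := by
    refine Measure.ext_of_charFun (funext fun t => ?_)
    rw [← ProbabilityTheory.complexMGF_id_mul_I, ← ProbabilityTheory.complexMGF_id_mul_I]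
    exact hEq (by simp)
  have hinv (κ : Measure ℝ) : (κ.withDensity w).withDensity w⁻¹ = κ :=
    withDensity_inv_same hwm (.of_forall fun x => by simp [hw, Real.exp_pos])
      (.of_forall fun x => ENNReal.ofReal_ne_top)
  rw [← hinv μ, hwd, hinv]

/-! ### The density on the real line and the main theorem -/

/-- The density of states on the real line. -/
noncomputable def realDensity (η φ : ℝ) : ℝ → ℝ :=
  (Ici (groundFrequency η φ)).indicator fun ω => (density η φ ω).re

theorem ofReal_notMem_cutSet {η φ : ℝ} (hη : 0 < η) (h : 0 < Real.sin φ) (x : ℝ) :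
    (x : ℂ) ∉ cutSet η φ := by
  rw [← mem_kernelDomain_iff hη]
  exact_mod_cast ofReal_mem_kernelDomain h ((x - groundFrequency η φ) / η)

theorem analyticAt_density_re {η φ : ℝ} (hη : 0 < η) (h : 0 < Real.sin φ) (x : ℝ) :
    AnalyticAt ℝ (fun ω : ℝ => (density η φ ω).re) x :=
  (Complex.reCLM.analyticAt _).comp (((density_analyticAt hη
    (ofReal_notMem_cutSet hη h x)).restrictScalars (𝕜 := ℝ)).comp (Complex.ofRealCLM.analyticAt x))

theorem continuous_density_re {η φ : ℝ} (hη : 0 < η) (h : 0 < Real.sin φ) :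
    Continuous fun ω : ℝ => (density η φ ω).re :=
  continuous_iff_continuousAt.2 fun x => (analyticAt_density_re hη h x).continuousAt

theorem density_re_eq {η φ : ℝ} (hη : η ≠ 0) (y : ℝ) :
    (density η φ ((groundFrequency η φ + η * y : ℝ) : ℂ)).re =
      η⁻¹ * (convExp (kernel φ) y).re := by
  have hη' : (η : ℂ) ≠ 0 := by exact_mod_cast hη
  rw [density, ← Complex.ofReal_inv, Complex.re_ofReal_mul]
  congr 3
  push_cast
  field_simp
  ring

theorem realDensity_pos {η φ : ℝ} (hη : 0 < η) (h : 0 < Real.sin φ) {ω : ℝ}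
    (hω : groundFrequency η φ ≤ ω) : 0 < realDensity η φ ω := by
  obtain ⟨y, rfl⟩ : ∃ y, ω = groundFrequency η φ + η * y :=
    ⟨(ω - groundFrequency η φ) / η, by field_simp; ring⟩
  have hy : 0 ≤ y := by
    by_contra hy
    nlinarith [mul_pos hη (neg_pos.2 (not_le.1 hy))]
  rw [realDensity, indicator_of_mem (mem_Ici.2 hω), density_re_eq hη.ne']
  exact mul_pos (inv_pos.2 hη) (convExp_kernel_pos h hy)

theorem realDensity_groundFrequency {η φ : ℝ} (hη : 0 < η) :
    realDensity η φ (groundFrequency η φ) = Real.pi / η * Real.sin φ := by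
  have h1 := density_re_eq (φ := φ) hη.ne' 0
  rw [mul_zero, add_zero, Complex.ofReal_zero, convExp_kernel_zero, kernel_zero,
    Complex.ofReal_re] at h1
  rw [realDensity, indicator_of_mem (mem_Ici.2 le_rfl), h1]
  field_simp

theorem density_ofReal (η φ x : ℝ) : density η φ x = ((density η φ x).re : ℂ) := by
  have h := density_conj η φ x
  rw [Complex.conj_ofReal] at h
  exact Complex.ext (by simp) (by simpa using Complex.conj_eq_iff_im.1 h.symm)

theorem groundFrequency_pos {η φ : ℝ} (hη : 0 < η) (hφ : 0 < φ) (hφ' : φ ≤ Real.pi / 2) :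
    0 < groundFrequency η φ := by
  have hpi := Real.pi_pos
  have hsin : 0 < Real.sin φ := Real.sin_pos_of_pos_of_lt_pi hφ (by linarith)
  have hcos : 0 ≤ Real.cos φ := Real.cos_nonneg_of_mem_Icc ⟨by linarith, hφ'⟩
  have : 0 ≤ Real.pi / 2 - φ := by linarith
  unfold groundFrequency
  positivity

theorem lintegral_exp_realDensity {η φ β : ℝ} (hη : 0 < η) (h : 0 < Real.sin φ) :
    ∫⁻ ω, ENNReal.ofReal (Real.exp (-(β * ω))) * ENNReal.ofReal (realDensity η φ ω) =
      ENNReal.ofReal (Real.exp (-(β * groundFrequency η φ))) *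
      ∫⁻ y in Ioi (0 : ℝ), ENNReal.ofReal (Real.exp (-(β * η * y)) *
        (convExp (kernel φ) y).re) := by
  set ω₀ := groundFrequency η φ
  set g : ℝ → ENNReal := fun ω => ENNReal.ofReal (Real.exp (-(β * ω))) *
    ENNReal.ofReal ((density η φ ω).re) with hg
  have hgm : Measurable g := by
    have := (continuous_density_re hη h).measurable
    fun_prop
  have h1 : ∀ ω, ENNReal.ofReal (Real.exp (-(β * ω))) * ENNReal.ofReal (realDensity η φ ω) =
      (Ici ω₀).indicator g ω := by
    intro ω
    rw [realDensity]
    by_cases hω : ω ∈ Ici ω₀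
    · rw [indicator_of_mem hω, indicator_of_mem hω]
    · rw [indicator_of_notMem hω, indicator_of_notMem hω, ENNReal.ofReal_zero, mul_zero]
  have h2 := lintegral_image_eq_lintegral_abs_deriv_mul (s := Ioi (0 : ℝ)) measurableSet_Ioi
    (f := fun y => ω₀ + η * y) (f' := fun _ => η)
    (fun y _ => by simpa using (((hasDerivAt_id y).const_mul η).const_add ω₀).hasDerivWithinAt)
    (fun x _ y _ hxy => by simpa [hη.ne'] using hxy) g
  have h3 : (fun y => ω₀ + η * y) '' Ioi (0 : ℝ) = Ioi ω₀ := by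
    ext ω
    constructor
    · rintro ⟨y, hy, rfl⟩
      have := mul_pos hη (mem_Ioi.1 hy)
      simpa using this
    · intro hω
      refine ⟨(ω - ω₀) / η, div_pos (sub_pos.2 hω) hη, ?_⟩
      field_simp
      ring
  rw [h3] at h2
  rw [lintegral_congr h1, lintegral_indicator measurableSet_Ici, ← Measure.restrict_congr_set Ioi_ae_eq_Ici, h2,
    ← lintegral_const_mul' _ _ ENNReal.ofReal_ne_top]
  refine lintegral_congr fun y => ?_
  rw [hg, abs_of_pos hη]
  simp only
  rw [density_re_eq hη.ne', ← ENNReal.ofReal_mul (Real.exp_pos _).le, ← ENNReal.ofReal_mul hη.le,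
    ← ENNReal.ofReal_mul (Real.exp_pos _).le, mul_add, neg_add, Real.exp_add, mul_assoc β]
  congr 1
  field_simp

theorem isEffectiveMeasureOfStates_dirac_add {η φ : ℝ} (hη : 0 < η) (hφ : 0 < φ)
    (hφ' : φ ≤ Real.pi / 2) :
    IsEffectiveMeasureOfStates η φ (Measure.dirac (groundFrequency η φ) +
      volume.withDensity fun ω => ENNReal.ofReal (realDensity η φ ω)) := by
  have hsin : 0 < Real.sin φ :=
    Real.sin_pos_of_pos_of_lt_pi hφ (by linarith [Real.pi_pos])
  have hω := groundFrequency_pos hη hφ hφ'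
  have hm : Measurable (realDensity η φ) :=
    (continuous_density_re hη hsin).measurable.indicator measurableSet_Ici
  constructor
  · rw [Measure.add_apply, Measure.dirac_apply' _ measurableSet_Iio,
      withDensity_apply _ measurableSet_Iio, indicator_of_notMem (by simpa using hω.le), zero_add,
      setLIntegral_congr_fun (g := fun _ => 0) measurableSet_Iio, lintegral_zero]
    intro ω hω'
    simp only
    rw [realDensity, indicator_of_notMem, ENNReal.ofReal_zero]
    exact not_le.2 ((mem_Iio.1 hω').trans hω)
  · intro β hβ
    obtain ⟨Λ, hΛ, hZ, hK⟩ := partitionFunction_eq hη hφ hφ' hβ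
    rw [lintegral_add_measure, lintegral_dirac' _ (by fun_prop),
      lintegral_withDensity_eq_lintegral_mul _ (by fun_prop) (by fun_prop)]
    simp only [Pi.mul_apply]
    simp only [mul_comm (ENNReal.ofReal (realDensity η φ _))]
    rw [lintegral_exp_realDensity hη hsin, lintegral_exp_mul_convExp_kernel hsin hΛ hK, hZ,
      ← ENNReal.ofReal_mul (Real.exp_pos _).le, ← ENNReal.ofReal_add (Real.exp_pos _).le]
    · congr 1; ring
    · exact mul_nonneg (Real.exp_pos _).le (sub_nonneg.2 (Real.one_le_exp hΛ))

end ChargedOscillator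

theorem theorem3p5 (η φ : ℝ) (hη : 0 < η) (hφ : 0 < φ) (hφ' : φ ≤ Real.pi / 2) :
    ∃ ϕ : ℝ → ℝ,
      -- part (i)
      (∀ ω, ω < ChargedOscillator.groundFrequency η φ → ϕ ω = 0) ∧
      (∀ ω, ChargedOscillator.groundFrequency η φ ≤ ω → 0 < ϕ ω) ∧
      ContinuousOn ϕ (Set.Ici (ChargedOscillator.groundFrequency η φ)) ∧
      ϕ (ChargedOscillator.groundFrequency η φ) = Real.pi / η * Real.sin φ ∧
      -- existence and uniqueness of the effective measure of states, and its form
      (∀ μ : Measure ℝ, ChargedOscillator.IsEffectiveMeasureOfStates η φ μ ↔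
        μ = Measure.dirac (ChargedOscillator.groundFrequency η φ) +
          volume.withDensity (fun ω => ENNReal.ofReal (ϕ ω))) ∧
      -- part (ii)
      (∀ ω, ChargedOscillator.groundFrequency η φ < ω → AnalyticAt ℝ ϕ ω) ∧
      ∃ F : ℂ → ℂ,
        (∀ ω : ℝ, ChargedOscillator.groundFrequency η φ < ω → F (ω : ℂ) = (ϕ ω : ℂ)) ∧
        (∀ z : ℂ, z ∉ ChargedOscillator.cutSet η φ → AnalyticAt ℂ F z) ∧
        (∀ θ : ℝ, θ = φ ∨ θ = -φ → ∀ s : ℝ, η ≤ |s| →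
          ChargedOscillator.linePoint η φ θ s ∉ ChargedOscillator.singularPoints η φ →
          ChargedOscillator.HasAtMostCutAt F (Complex.exp (Complex.I * θ))
            (ChargedOscillator.linePoint η φ θ s)) ∧
        (∀ p ∈ ChargedOscillator.singularPoints η φ,
          ChargedOscillator.IsSingularPointOff F (ChargedOscillator.cutSet η φ) p) := by
  open ChargedOscillator in
  have hsin : 0 < Real.sin φ :=
    Real.sin_pos_of_pos_of_lt_pi hφ (by linarith [Real.pi_pos])
  have hμ₀ := isEffectiveMeasureOfStates_dirac_add hη hφ hφ'
  refine ⟨realDensity η φ, fun ω hω => Set.indicator_of_notMem (not_le.2 hω) _,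
    fun ω hω => realDensity_pos hη hsin hω, ?_, realDensity_groundFrequency hη, fun μ => ⟨?_, ?_⟩,
    fun ω hω => ?_, density η φ, fun ω hω => ?_, fun z hz => density_analyticAt hη hz,
    fun θ hθ s hs hns => density_hasAtMostCutAt hη hφ hφ' hθ hs hns,
    fun p hp => density_isSingularPointOff hη hφ hφ' hp⟩
  · exact (continuous_density_re hη hsin).continuousOn.congr
      fun ω hω => Set.indicator_of_mem hω _
  · intro hμ
    refine ext_of_lintegral_exp (fun β hβ => ?_) fun β hβ => ?_
    · rw [hμ.2 β hβ]; exact ENNReal.ofReal_ne_top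
    · rw [hμ.2 β hβ, hμ₀.2 β hβ]
  · rintro rfl
    exact hμ₀
  · refine (analyticAt_density_re hη hsin ω).congr ?_
    filter_upwards [Ioi_mem_nhds hω] with x hx
    rw [realDensity, Set.indicator_of_mem (Set.mem_Ici.2 (Set.mem_Ioi.1 hx).le)]
  · rw [realDensity, Set.indicator_of_mem (Set.mem_Ici.2 hω.le)]
    exact density_ofReal η φ ω
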